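/- Let $k$ be an algebraically closed field and $A$ a finite-dimensional $k$-algebra with Jacobson radical $R$. A *minimal $A$-complex* is a bounded complex $P_\bullet$ of finitely generated projective right $A$-modules with $\operatorname{im} d_i\subseteq P_{i-1}R$ for all $i$; its *vector rank* is the sequence of isomorphism classes of the modules $P_i$ (equivalently, of the multiplicity vectors of the indecomposable projective modules in the $P_i$). Isomorphism and indecomposability of such complexes are meant in the category of complexes. *Number of parameters.* A *family of minimal $A$-complexes* over an algebraic variety $X$ over $k$ (a reduced separated scheme of finite type) is a bounded complex $\mathcal P_\bullet$ of flat coherent sheaves of right $\mathcal O_X\otimes_k A$-modules with $\operatorname{im} d_i\subseteq\mathcal P_{i-1}R$ for all $i$; its fibre at a point $x\in X(k)$ is a minimal $A$-complex $\mathcal P_\bullet(x)$. Let $X_i(\mathcal P_\bullet)$ be the set of points $x\in X(k)$ such that $\dim\{y\in X(k) : \mathcal P_\bullet(y)\simeq\mathcal P_\bullet(x)\}\le i$, and put $\operatorname{par}(\mathcal P_\bullet)=\max_i\{\dim X_i(\mathcal P_\bullet)-i\}$. For a sequence $\mathfrak B=(b_n,b_{n-1},\dots,b_m)$ of non-negative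 integers let $\operatorname{par}(\mathfrak B,A)$ be the maximum of $\operatorname{par}(\mathcal P_\bullet)$ over all varieties $X$ and all families of minimal $A$-complexes over $X$ such that, for all $x\in X(k)$, $\mathcal P_i(x)\simeq A^{b_i}$ for $m\le i\le n$ and $\mathcal P_i(x)=0$ for all other $i$. Put $|\mathfrak B|=\sum_{i=m}^n b_i$ and $c\mathfrak B=(cb_n,\dots,cb_m)$. *Derived tame and derived wild.* For a $k$-algebra $B$, a *family of minimal $A$-complexes based on $B$* is a bounded complex $P_\bullet$ of finitely generated projective $B$-$A$-bimodules (left over $B$, right over $A$, with $k$ acting centrally; that is, finitely generated projective $B\otimes_k A^{\mathrm{op}}$-modules) with $\operatorname{im} d_i\subseteq P_{i-1}R$ for all $i$. For a right $B$-module $L$ of finite dimension over $k$ put $P_\bullet(L)=L\otimes_B P_\bullet$. The family is *strict* if for all such $L,L'$: $P_\bullet(L)\simeq P_\bullet(L')$ if and only if $L\simeq L'$, and $P_\bullet(L)$ is indecomposable if and only if $L$ is. The algebra $A$ is *derived wild* if for every finitely generated $k$-algebra $B$ there is a strict family of minimal $A$-complexes based on $B$. The algebra $A$ is *derived tame* if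 there is a set $\mathfrak M$ of families of minimal $A$-complexes, each based on an algebra of the form $k[x,f(x)^{-1}]$ with a non-zero polynomial $f$ (depending on the family), such that for every vector rank $r$: (a) only finitely many $P_\bullet\in\mathfrak M$ have vector rank $r$, where the vector rank of $P_\bullet$ is that of $P_\bullet(L)$ for a one-dimensional module $L$; (b) all indecomposable minimal $A$-complexes of vector rank $r$, except for at most finitely many isomorphism classes, are isomorphic to $P_\bullet(L)$ for some $P_\bullet\in\mathfrak M$ and some finite-dimensional module $L$ over the algebra on which $P_\bullet$ is based. **Proposition.** (i) If $A$ is derived tame, then $\operatorname{par}(\mathfrak B,A)\le|\mathfrak B|\dim_k A$ for every sequence $\mathfrak B=(b_n,b_{n-1},\dots,b_m)$ of non-negative integers. (ii) If $A$ is derived wild, then there is a sequence $\mathfrak B$ of non-negative integers such that $\operatorname{par}(c\mathfrak B,A)\ge c^2$ for every integer $c\ge0$. In particular, no finite-dimensional $k$-algebra is both derived tame and derived wild. -/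

import Mathlib

open CategoryTheory CategoryTheory.Limits AlgebraicGeometry MulOpposite
open scoped TensorProduct

universe u

noncomputable section

namespace DerivedParam

/-! ### Minimal complexes of right modules

Right `A`-modules are modules over `Aᵐᵒᵖ`.  Left-`B` right-`A` bimodules, on which `k` acts
centrally, are modules over `B ⊗[k] Aᵐᵒᵖ`.  Complexes are graded by `ℤ`, with differentials
`d i j` of degree `-1`. -/

/-- `C` is a bounded complex of finitely generated projective `S`-modules each of whose
differentials has its image in the submodule `J C_j` generated by all `s • m` with `s ∈ J`. -/
structure IsMinimalOver {S : Type u} [Ring S] (J : Set S)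
    (C : ChainComplex (ModuleCat.{u} S) ℤ) : Prop where
  bounded : ∃ m n : ℤ, ∀ i : ℤ, (i < m ∨ n < i) → IsZero (C.X i)
  finite : ∀ i, Module.Finite S (C.X i)
  projective : ∀ i, Module.Projective S (C.X i)
  minimal : ∀ (i j : ℤ) (x : C.X i),
    C.d i j x ∈ Submodule.span S {y : C.X j | ∃ s ∈ J, ∃ m : C.X j, y = s • m}

/-- Minimal complexes of finitely generated projective right `A`-modules:
`im d ⊆ P_{i-1} R` with `R` the Jacobson radical of `A`. -/
def IsMinimal {A : Type u} [Ring A] (C : ChainComplex (ModuleCat.{u} Aᵐᵒᵖ) ℤ) : Prop :=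
  IsMinimalOver {s : Aᵐᵒᵖ | s.unop ∈ Ring.jacobson A} C

/-- A vector rank.  A rank vector `(p_1, …, p_t)` is given by the projective module
`p_1 A_1 ⊕ … ⊕ p_t A_t` that it stands for, where `A_1, …, A_t` are the indecomposable projective
right modules; a vector rank is a family of these indexed by the degree.  As the decomposition of
a finitely generated projective module is unique, two projective modules have the same rank exactly
when they are isomorphic. -/
abbrev VectorRank (A : Type u) [Ring A] := ℤ → ModuleCat.{u} Aᵐᵒᵖ

/-- The complex `C` has vector rank `r`. -/
def HasVectorRank {A : Type u} [Ring A] (C : ChainComplex (ModuleCat.{u} Aᵐᵒᵖ) ℤ)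
    (r : VectorRank A) : Prop :=
  ∀ i, Nonempty (C.X i ≅ r i)

/-- The vector rank of complexes of free right modules of the ranks `b i`. -/
def freeRank (A : Type u) [Ring A] (b : ℤ →₀ ℕ) : VectorRank A :=
  fun i => ModuleCat.of Aᵐᵒᵖ (Fin (b i) → A)

/-! ### The tensor product over a noncommutative algebra -/

section Tensor

variable {k B A : Type u} [Field k] [Ring B] [Algebra k B] [Ring A] [Algebra k A]

/-- The right `A`-module underlying a left-`B` right-`A` bimodule. -/
abbrev toRight (M : ModuleCat.{u} (B ⊗[k] Aᵐᵒᵖ)) : ModuleCat.{u} Aᵐᵒᵖ :=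
  (ModuleCat.restrictScalars
    (Algebra.TensorProduct.includeRight : Aᵐᵒᵖ →ₐ[k] B ⊗[k] Aᵐᵒᵖ).toRingHom).obj M

/-- Left multiplication by `b ∈ B` on a left-`B` right-`A` bimodule. -/
def leftMul (M : ModuleCat.{u} (B ⊗[k] Aᵐᵒᵖ)) (b : B) (m : toRight M) : toRight M :=
  (((b ⊗ₜ[k] (1 : Aᵐᵒᵖ)) • (show M from m) : M))

variable (L : Type u) [AddCommGroup L] [Module Bᵐᵒᵖ L]

/-- The relations `(b m) ⊗ l = m ⊗ (l b)`, which cut `L ⊗_B M` out of the tensor product over `ℤ`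
(written with its factors interchanged). -/
def tensorRel (M : ModuleCat.{u} (B ⊗[k] Aᵐᵒᵖ)) : Submodule Aᵐᵒᵖ (toRight M ⊗[ℤ] L) :=
  Submodule.span Aᵐᵒᵖ
    {z | ∃ (b : B) (m : toRight M) (l : L), z = leftMul M b m ⊗ₜ[ℤ] l - m ⊗ₜ[ℤ] (op b • l)}

/-- The map `M ⊗_ℤ L → N ⊗_ℤ L` given by a bimodule map `M → N`. -/
def tensorMapAux {M N : ModuleCat.{u} (B ⊗[k] Aᵐᵒᵖ)} (f : M ⟶ N) :
    (toRight M ⊗[ℤ] L) →ₗ[Aᵐᵒᵖ] (toRight N ⊗[ℤ] L) :=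
  TensorProduct.AlgebraTensorModule.map
    ((ModuleCat.restrictScalars
      (Algebra.TensorProduct.includeRight : Aᵐᵒᵖ →ₐ[k] B ⊗[k] Aᵐᵒᵖ).toRingHom).map f).hom
    (LinearMap.id : L →ₗ[ℤ] L)

theorem tensorMapAux_le {M N : ModuleCat.{u} (B ⊗[k] Aᵐᵒᵖ)} (f : M ⟶ N) :
    tensorRel L M ≤ (tensorRel L N).comap (tensorMapAux L f) := by
  refine Submodule.span_le.2 ?_
  rintro _ ⟨b, m, l, rfl⟩
  refine Submodule.subset_span ⟨b, f.hom m, l, ?_⟩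
  have h : f.hom (leftMul M b m) = leftMul N b (f.hom m) := f.hom.map_smul _ _
  rw [map_sub, ← h]
  rfl

/-- The functor `M ↦ L ⊗_B M` from left-`B` right-`A` bimodules to right `A`-modules, for a right
`B`-module `L`. -/
def tensorFunctor : ModuleCat.{u} (B ⊗[k] Aᵐᵒᵖ) ⥤ ModuleCat.{u} Aᵐᵒᵖ where
  obj M := ModuleCat.of Aᵐᵒᵖ ((toRight M ⊗[ℤ] L) ⧸ tensorRel L M)
  map f := ModuleCat.ofHom (Submodule.mapQ _ _ (tensorMapAux L f) (tensorMapAux_le L f))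
  map_id M := by
    refine ModuleCat.hom_ext (LinearMap.ext fun x => ?_)
    obtain ⟨x, rfl⟩ := Submodule.Quotient.mk_surjective _ x
    induction x using TensorProduct.induction_on with
    | zero => simp
    | tmul m l => rfl
    | add x y hx hy => rw [Submodule.Quotient.mk_add, map_add, map_add, hx, hy]
  map_comp f g := by
    refine ModuleCat.hom_ext (LinearMap.ext fun x => ?_)
    obtain ⟨x, rfl⟩ := Submodule.Quotient.mk_surjective _ x
    induction x using TensorProduct.induction_on with
    | zero => simp
    | tmul m l => rfl
    | add x y hx hy => rw [Submodule.Quotient.mk_add, map_add, map_add, hx, hy]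

instance : (tensorFunctor (k := k) (B := B) (A := A) L).Additive where
  map_add {M N f g} := by
    have h : tensorMapAux L (f + g) = tensorMapAux L f + tensorMapAux L g := by
      simp only [tensorMapAux, Functor.map_add, ModuleCat.hom_add,
        TensorProduct.AlgebraTensorModule.map_add_left]
    refine ModuleCat.hom_ext (LinearMap.ext fun x => ?_)
    obtain ⟨x, rfl⟩ := Submodule.Quotient.mk_surjective _ x
    exact congrArg (fun φ => Submodule.Quotient.mk (p := tensorRel L N) (φ x)) h

/-- The complex `L ⊗_B P` of right `A`-modules. -/
def tensorComplex (P : ChainComplex (ModuleCat.{u} (B ⊗[k] Aᵐᵒᵖ)) ℤ) :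
    ChainComplex (ModuleCat.{u} Aᵐᵒᵖ) ℤ :=
  ((tensorFunctor (k := k) (B := B) (A := A) L).mapHomologicalComplex _).obj P

end Tensor

/-! ### Families of minimal complexes based on an algebra, derived tame and derived wild -/

/-- `P` is a family of minimal `A`-complexes based on the `k`-algebra `B`: a bounded complex of
finitely generated projective bimodules with `im d ⊆ P_{i-1} R`. -/
def IsMinimalFamily (k B A : Type u) [Field k] [Ring B] [Algebra k B] [Ring A] [Algebra k A]
    (P : ChainComplex (ModuleCat.{u} (B ⊗[k] Aᵐᵒᵖ)) ℤ) : Prop :=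
  IsMinimalOver {s | ∃ r ∈ Ring.jacobson A, s = (1 : B) ⊗ₜ[k] op r} P

/-- A family of complexes is strict if `L ↦ L ⊗_B P`, on finite-dimensional right `B`-modules,
preserves and reflects isomorphism and indecomposability. -/
structure IsStrict {k B A : Type u} [Field k] [Ring B] [Algebra k B] [Ring A] [Algebra k A]
    (P : ChainComplex (ModuleCat.{u} (B ⊗[k] Aᵐᵒᵖ)) ℤ) : Prop where
  iso_iff : ∀ (L L' : Type u) [AddCommGroup L] [AddCommGroup L'] [Module k L] [Module k L']
    [Module Bᵐᵒᵖ L] [Module Bᵐᵒᵖ L'] [IsScalarTower k Bᵐᵒᵖ L] [IsScalarTower k Bᵐᵒᵖ L']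
    [Module.Finite k L] [Module.Finite k L'],
    Nonempty (tensorComplex L P ≅ tensorComplex L' P) ↔ Nonempty (L ≃ₗ[Bᵐᵒᵖ] L')
  indecomposable_iff : ∀ (L : Type u) [AddCommGroup L] [Module k L]
    [Module Bᵐᵒᵖ L] [IsScalarTower k Bᵐᵒᵖ L] [Module.Finite k L],
    Indecomposable (tensorComplex L P) ↔ Indecomposable (ModuleCat.of Bᵐᵒᵖ L)

/-- Derived wild algebras. -/
def DerivedWild (k A : Type u) [Field k] [Ring A] [Algebra k A] : Prop :=
  ∀ (B : Type u) [Ring B] [Algebra k B] [Algebra.FiniteType k B],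
    ∃ P : ChainComplex (ModuleCat.{u} (B ⊗[k] Aᵐᵒᵖ)) ℤ, IsMinimalFamily k B A P ∧ IsStrict P

/-- A family of minimal `A`-complexes based on a rational algebra `k[x, f(x)⁻¹]`, `f ≠ 0`. -/
structure RationalFamily (k A : Type u) [Field k] [Ring A] [Algebra k A] where
  f : Polynomial k
  f_ne_zero : f ≠ 0
  P : ChainComplex (ModuleCat.{u} (Localization.Away f ⊗[k] Aᵐᵒᵖ)) ℤ
  isMinimalFamily : IsMinimalFamily k (Localization.Away f) A P

/-- The vector rank of a rational family is that of `P(L)` for a one-dimensional `L`. -/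
def RationalFamily.HasVectorRank {k A : Type u} [Field k] [Ring A] [Algebra k A]
    (F : RationalFamily k A) (r : VectorRank A) : Prop :=
  ∃ (L : Type u) (_ : AddCommGroup L) (_ : Module k L) (_ : Module (Localization.Away F.f)ᵐᵒᵖ L)
    (_ : IsScalarTower k (Localization.Away F.f)ᵐᵒᵖ L),
    Module.finrank k L = 1 ∧ DerivedParam.HasVectorRank (tensorComplex L F.P) r

/-- `C` is isomorphic to `P(L)` for some finite-dimensional module `L`. -/
def RationalFamily.Realizes {k A : Type u} [Field k] [Ring A] [Algebra k A]
    (F : RationalFamily k A) (C : ChainComplex (ModuleCat.{u} Aᵐᵒᵖ) ℤ) : Prop :=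
  ∃ (L : Type u) (_ : AddCommGroup L) (_ : Module k L) (_ : Module (Localization.Away F.f)ᵐᵒᵖ L)
    (_ : IsScalarTower k (Localization.Away F.f)ᵐᵒᵖ L),
    Module.Finite k L ∧ Nonempty (C ≅ tensorComplex L F.P)

/-- Derived tame algebras. -/
def DerivedTame (k A : Type u) [Field k] [Ring A] [Algebra k A] : Prop :=
  ∃ M : Set (RationalFamily k A),
    (∀ r : VectorRank A, {F ∈ M | F.HasVectorRank r}.Finite) ∧
    ∀ r : VectorRank A, ∃ E : Set (ChainComplex (ModuleCat.{u} Aᵐᵒᵖ) ℤ), E.Finite ∧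
      ∀ C : ChainComplex (ModuleCat.{u} Aᵐᵒᵖ) ℤ, IsMinimal C → Indecomposable C →
        HasVectorRank C r → (∃ D ∈ E, Nonempty (C ≅ D)) ∨ ∃ F ∈ M, F.Realizes C

/-! ### Families of minimal complexes over algebraic varieties -/

/-- An algebraic variety over `k`: a reduced separated scheme of finite type over `k`. -/
structure Variety (k : Type u) [Field k] where
  X : Scheme.{u}
  s : X ⟶ Spec (.of k)
  [reduced : IsReduced X]
  [separated : IsSeparated s]
  [locallyOfFiniteType : LocallyOfFiniteType s]
  [quasiCompact : QuasiCompact s]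

namespace Variety

variable {k : Type u} [Field k] (V : Variety k)

/-- The functions on an open set form a `k`-algebra. -/
instance sectionsAlgebra (U : V.X.Opens) : Algebra k Γ(V.X, U) :=
  ((Scheme.ΓSpecIso (.of k)).inv ≫ V.s.appLE ⊤ U le_top).hom.toAlgebra

/-- The `k`-points of the variety, that is, sections of `X → Spec k`. -/
def Point : Type u := {x : Spec (.of k) ⟶ V.X // x ≫ V.s = 𝟙 _}

variable {V}

/-- The closed point of the scheme `X` underlying a `k`-point. -/
def Point.pt (x : V.Point) : V.X := x.1 (IsLocalRing.closedPoint k)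

theorem Point.le_preimage (x : V.Point) {U : V.X.Opens} (hx : x.pt ∈ U) : ⊤ ≤ x.1 ⁻¹ᵁ U := by
  intro y _
  have hy : y = IsLocalRing.closedPoint k := Subsingleton.elim (α := PrimeSpectrum k) _ _
  subst hy
  exact hx

/-- The value at `x` of a function on a neighbourhood of `x`. -/
def Point.eval (x : V.Point) {U : V.X.Opens} (hx : x.pt ∈ U) : Γ(V.X, U) →+* k :=
  (x.1.appLE U ⊤ (x.le_preimage hx) ≫ (Scheme.ΓSpecIso (.of k)).hom).hom

/-- The dimension of a set of `k`-points, in the Zariski topology. -/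
def dim (S : Set V.Point) : WithBot ℕ∞ :=
  topologicalKrullDim (Point.pt '' S : Set V.X)

end Variety

/-- A complex of sheaves of (right) `O_X ⊗ A`-modules on a variety `X`: a complex of
`O_X`-modules with a right action of `A` by endomorphisms of the complex, through which `k ⊆ A`
acts as it does through `O_X`. -/
structure ModuleComplex (k A : Type u) [Field k] [Ring A] [Algebra k A] (V : Variety k) where
  K : ChainComplex V.X.Modules ℤ
  act : Aᵐᵒᵖ →+* End K
  act_algebraMap : ∀ (c : k) (i : ℤ) (U : V.X.Opens) (m : Γ(K.X i, U)),
    ((act (algebraMap k Aᵐᵒᵖ c)).f i).app U m = algebraMap k Γ(V.X, U) c • m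

namespace ModuleComplex

variable {k A : Type u} [Field k] [Ring A] [Algebra k A] {V : Variety k}
  (P : ModuleComplex k A V)

/-- The sections over `U` of the degree `i` term. -/
def Sec (_P : ModuleComplex k A V) (U : V.X.Opens) (i : ℤ) : Type u := Γ(_P.K.X i, U)

variable (U : V.X.Opens) (i : ℤ)

instance : AddCommGroup (P.Sec U i) := inferInstanceAs (AddCommGroup Γ(P.K.X i, U))
instance : Module Γ(V.X, U) (P.Sec U i) := inferInstanceAs (Module Γ(V.X, U) Γ(P.K.X i, U))
instance : Module k (P.Sec U i) := Module.compHom _ (algebraMap k Γ(V.X, U))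
instance : IsScalarTower k Γ(V.X, U) (P.Sec U i) where
  smul_assoc c f m := by
    rw [Algebra.smul_def, mul_smul]
    rfl

/-- The action of `a ∈ A` on sections. -/
def actSec (a : Aᵐᵒᵖ) : P.Sec U i →ₗ[Γ(V.X, U)] P.Sec U i where
  toFun m := ((P.act a).f i).app U m
  map_add' m n := map_add (((P.act a).f i).app U).hom m n
  map_smul' f m := Scheme.Modules.Hom.app_smul ((P.act a).f i) f m

/-- The action of `A` on sections. -/
def actSecHom : Aᵐᵒᵖ →ₐ[k] Module.End k (P.Sec U i) where
  toFun a := (P.actSec U i a).restrictScalars k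
  map_one' := by
    ext m
    change ((P.act 1).f i).app U m = m
    rw [map_one]
    rfl
  map_mul' a b := by
    ext m
    change ((P.act (a * b)).f i).app U m = _
    rw [map_mul]
    rfl
  map_zero' := by
    ext m
    change ((P.act 0).f i).app U m = 0
    rw [map_zero]
    rfl
  map_add' a b := by
    ext m
    change ((P.act (a + b)).f i).app U m = _
    rw [map_add]
    rfl
  commutes' c := by
    ext m
    exact P.act_algebraMap c i U m

/-- The action of `Γ(X, U) ⊗ Aᵐᵒᵖ` on sections over `U`. -/
def secHom : Γ(V.X, U) ⊗[k] Aᵐᵒᵖ →ₐ[k] Module.End k (P.Sec U i) :=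
  Algebra.TensorProduct.lift (Algebra.lsmul k k (P.Sec U i)) (P.actSecHom U i) (by
    intro f a
    ext m
    exact ((P.actSec U i a).map_smul f m).symm)

instance : Module (Γ(V.X, U) ⊗[k] Aᵐᵒᵖ) (P.Sec U i) := Module.compHom _ (P.secHom U i).toRingHom

/-- The differential on sections, as a map of abelian groups. -/
def dSecHom (i j : ℤ) : P.Sec U i →+ P.Sec U j := ((P.K.d i j).app U).hom

/-- The differential on sections. -/
def dSec (i j : ℤ) : P.Sec U i →ₗ[Γ(V.X, U) ⊗[k] Aᵐᵒᵖ] P.Sec U j where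
  toFun := P.dSecHom U i j
  map_add' := map_add _
  map_smul' s m := by
    induction s using TensorProduct.induction_on with
    | zero =>
      change P.dSecHom U i j (P.secHom U i 0 m) = P.secHom U j 0 (P.dSecHom U i j m)
      rw [map_zero, map_zero, LinearMap.zero_apply, LinearMap.zero_apply, map_zero]
    | tmul f a =>
      have h : P.dSecHom U i j (P.actSec U i a m) = P.actSec U j a (P.dSecHom U i j m) :=
        congrArg (fun φ => Scheme.Modules.Hom.app φ U m) ((P.act a).comm i j)
      have h' : P.dSecHom U i j (f • P.actSec U i a m) =
          f • P.dSecHom U i j (P.actSec U i a m) :=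
        Scheme.Modules.Hom.app_smul (P.K.d i j) f _
      exact h'.trans (congrArg (f • ·) h)
    | add s t hs ht => simp only [add_smul, map_add, hs, ht, RingHom.id_apply] at *

/-- The complex of sections over `U`, as a complex of `Γ(X, U) ⊗ Aᵐᵒᵖ`-modules. -/
def sections : ChainComplex (ModuleCat.{u} (Γ(V.X, U) ⊗[k] Aᵐᵒᵖ)) ℤ where
  X i := ModuleCat.of _ (P.Sec U i)
  d i j := ModuleCat.ofHom (P.dSec U i j)
  shape i j h := by
    ext m
    change (P.K.d i j).app U m = 0
    rw [P.K.shape i j h]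
    rfl
  d_comp_d' i j l _ _ := by
    ext m
    change (P.K.d i j ≫ P.K.d j l).app U m = 0
    rw [P.K.d_comp_d]
    rfl

end ModuleComplex

/-- A family of minimal `A`-complexes over a variety: a bounded complex of flat coherent sheaves of
`O_X ⊗ A`-modules with `im d ⊆ P_{i-1} R`.  Flat coherent sheaves are the quasi-coherent ones whose
sections over suitable affine neighbourhoods of all points are finitely generated projective
modules (`Γ(X, U) ⊗ A` being noetherian, finitely generated flat modules over it are projective). -/
structure VarietyFamily (k A : Type u) [Field k] [Ring A] [Algebra k A] (V : Variety k)
    extends ModuleComplex k A V where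
  bounded : ∃ m n : ℤ, ∀ i : ℤ, (i < m ∨ n < i) → IsZero (K.X i)
  quasicoherent : ∀ i, (K.X i).IsQuasicoherent
  exists_chart : ∀ x : V.X, ∃ U : V.X.Opens, IsAffineOpen U ∧ x ∈ U ∧
    IsMinimalFamily k Γ(V.X, U) A (toModuleComplex.sections U)

namespace VarietyFamily

variable {k A : Type u} [Field k] [Ring A] [Algebra k A] {V : Variety k}
  (P : VarietyFamily k A V)

/-- The field `k` as a module over the functions on a neighbourhood of the point `x`. -/
def ResidueModule (x : V.Point) {U : V.X.Opens} (_hx : x.pt ∈ U) : Type u := k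

instance (x : V.Point) {U : V.X.Opens} (hx : x.pt ∈ U) : AddCommGroup (ResidueModule x hx) :=
  inferInstanceAs (AddCommGroup k)

instance (x : V.Point) {U : V.X.Opens} (hx : x.pt ∈ U) :
    Module Γ(V.X, U)ᵐᵒᵖ (ResidueModule x hx) :=
  Module.compHom k ((x.eval hx).fromOpposite fun _ _ => Commute.all _ _)

/-- An affine neighbourhood of the point `x` as in the definition of a family. -/
def chart (x : V.Point) : V.X.Opens := (P.exists_chart x.pt).choose

theorem mem_chart (x : V.Point) : x.pt ∈ P.chart x := (P.exists_chart x.pt).choose_spec.2.1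

/-- The complex `P(x) = k ⊗_{O_X} P` at a point `x`, computed on an affine neighbourhood of `x`
(up to isomorphism it does not depend on this neighbourhood). -/
def fiber (x : V.Point) : ChainComplex (ModuleCat.{u} Aᵐᵒᵖ) ℤ :=
  tensorComplex (k := k) (B := Γ(V.X, P.chart x)) (ResidueModule x (P.mem_chart x))
    (P.sections (P.chart x))

/-- The set of all points `y` with `P(y) ≅ P(x)`. -/
def isoLocus (x : V.Point) : Set V.Point := {y | Nonempty (P.fiber y ≅ P.fiber x)}

/-- The set of all points `x` with `dim {y | P(y) ≅ P(x)} ≤ i`. -/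
def locus (i : ℕ) : Set V.Point := {x | Variety.dim (P.isoLocus x) ≤ i}

/-- The number of parameters of the family, `max_i (dim X_i - i)` where `X_i = P.locus i`: the
largest `j` such that `j ≤ dim X_i - i` for some `i`. -/
def par : WithBot ℕ∞ := sSup {j | ∃ i : ℕ, j + (i : WithBot ℕ∞) ≤ Variety.dim (P.locus i)}

/-- All complexes of the family have the vector rank `r`. -/
def HasVectorRank (r : VectorRank A) : Prop := ∀ x, DerivedParam.HasVectorRank (P.fiber x) r

end VarietyFamily

/-- The number of parameters in families of minimal `A`-complexes of vector rank `r`. -/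
def parRank (k : Type u) {A : Type u} [Field k] [Ring A] [Algebra k A] (r : VectorRank A) :
    WithBot ℕ∞ :=
  sSup {j | ∃ (V : Variety k) (P : VarietyFamily k A V), P.HasVectorRank r ∧ j = P.par}

/-- `par(b, A)` for a sequence `b` of nonnegative integers: the number of parameters in families of
minimal complexes of free modules of the ranks `b i`. -/
def par (k A : Type u) [Field k] [Ring A] [Algebra k A] (b : ℤ →₀ ℕ) : WithBot ℕ∞ :=
  parRank k (freeRank A b)

end DerivedParam

end

noncomputable section

namespace DerivedParam

section

/-! ### Points and dimension of finitely generated algebras -/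

section Dimension

/-! Upper bound. Over a derived tame algebra the indecomposable minimal complexes of bounded total
dimension form, up to isomorphism, finitely many families with at most one parameter each
(`DerivedTame.finCovered_indecomposable`). A nonexceptional one is `L ⊗ P` for a rational family `P`
over `B = k[x, 1/f]`. As `B` is a principal ideal domain and the complex is indecomposable, `L` may
be taken to be `B/𝔪^e`. The dimension bounds `e`, and finiteness of the possible vector ranks leaves
only finitely many `P`. For fixed `P` and `e` all `B/𝔪^e ⊗ P` are fibres of one family over `Spec B`
(`isFiber_generic`). A complex of total dimension `n` is a direct sum of at most `n`
indecomposables, so complexes of dimension at most `n` occur in finitely many families with at most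
`n` parameters (`finCovered_of_indecomposable`). For free terms of ranks `b`, the total dimension is
`|b| dim A`.

It remains to see that being covered by finitely many `n`-parameter families forces `par ≤ n`
(`VarietyFamily.par_le`). Isomorphisms between members of two families described by matrices are the
points of a ring of finite type (`InterRing`). If `dim X_i > n + i`, one of these isomorphism
varieties dominates the closure of a piece of dimension at least `n + i + 1`. It has a multisection,
integral over an open set, and fixing the `n` parameters on it costs at most `n` dimensions by
Krull's height theorem (`exists_chain_of_covering`). Thus some `x ∈ X_i` has at least `i + 1`
dimensions of points with isomorphic fibre, a contradiction.

Lower bound. Take a strict family `P` over the free algebra on four generators. Fix three generators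
so that the fourth, an arbitrary `c × c` matrix `Z`, becomes an isomorphism invariant of a
`2c`-dimensional module (`blockMat_injective`). This gives a family over affine space of dimension
`c²`. The terms of `P` need not be free, so `P` is enlarged by a complement with zero differential
to a complex `F` with free terms. Cancellation of minimal complexes (`InClass.cancel`) recovers `L ⊗
P` from `L ⊗ F` once the vector rank of the complement is known. There are finitely many such ranks,
so isomorphism classes are finite sets of points and all `c²` parameters count.

Linear growth in `c` contradicts quadratic growth, so the two properties exclude each other. -/

open MvPolynomial in
-- Induction on the number of variables: over a Jacobson ring a maximal ideal of a polynomial ring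
-- contracts to a maximal ideal, and the extra variable raises the height by one.
theorem le_height_of_isMaximal_mvPolynomial {k : Type u} [Field k] (s : ℕ)
    (M : Ideal (MvPolynomial (Fin s) k)) [M.IsMaximal] : (s : ℕ∞) ≤ M.height := by
  induction s with
  | zero => simp
  | succ n ih =>
    let e := (finSuccEquiv k n).toRingEquiv
    let M' : Ideal (Polynomial (MvPolynomial (Fin n) k)) := M.comap e.symm
    have hM' : M'.IsMaximal := Ideal.comap_isMaximal_of_equiv e.symm
    have h1 : M'.height = M.height := e.symm.height_comap M
    have hmax : (M'.comap (Polynomial.C : MvPolynomial (Fin n) k →+* _)).IsMaximal :=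
      Polynomial.isMaximal_comap_C_of_isJacobsonRing M'
    have : M'.LiesOver (M'.comap (Polynomial.C : MvPolynomial (Fin n) k →+* _)) := ⟨rfl⟩
    rw [← h1, Polynomial.height_eq_height_add_one (M'.comap Polynomial.C) M']
    push_cast
    gcongr
    exact ih _

/-- By Noether normalization `B` is integral over a polynomial ring in `s` variables, and `e ≤ s` by
transcendence degree. Going down for this extension of domains transfers the height of the
contracted maximal ideal to `M`. -/
theorem le_height_of_isMaximal {k B : Type u} [Field k] [CommRing B] [IsDomain B] [Algebra k B]
    [Algebra.FiniteType k B] {e : ℕ} {z : Fin e → B} (hz : AlgebraicIndependent k z)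
    (M : Ideal B) [M.IsMaximal] : (e : ℕ∞) ≤ M.height := by
  obtain ⟨s, g, hg, hint⟩ := exists_integral_inj_algHom_of_fg k B
  let : Algebra (MvPolynomial (Fin s) k) B := g.toRingHom.toAlgebra
  have : IsScalarTower k (MvPolynomial (Fin s) k) B := .of_algebraMap_eq fun r => (g.commutes r).symm
  have hI : Algebra.IsIntegral (MvPolynomial (Fin s) k) B := ⟨hint⟩
  have : FaithfulSMul (MvPolynomial (Fin s) k) B := (faithfulSMul_iff_algebraMap_injective _ _).2 hg
  have : IsNoetherianRing B := Algebra.FiniteType.isNoetherianRing k B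
  have hes : e ≤ s := by
    have h1 := hz.lift_cardinalMk_le_trdeg
    have h2 : AlgebraicIndependent k fun i : Fin s => g (MvPolynomial.X i) := by
      have := (MvPolynomial.algebraicIndependent_X (Fin s) k).map' hg
      exact this
    -- Integrality makes the normalizing variables a transcendence basis, so `s` is the
    -- transcendence degree, which bounds `e`.
    have h3 : Algebra.IsAlgebraic (Algebra.adjoin k (Set.range fun i : Fin s => g (.X i))) B := by
      have hr : Algebra.adjoin k (Set.range fun i : Fin s => g (.X i)) = g.range := by
        rw [← Algebra.map_top, ← MvPolynomial.adjoin_range_X, AlgHom.map_adjoin, ← Set.range_comp]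
        rfl
      rw [hr]
      refine ⟨fun b => ?_⟩
      obtain ⟨p, hp, hpb⟩ := (hI.isIntegral b)
      refine ⟨p.map (g.rangeRestrict : _ →+* g.range), (hp.map _).ne_zero, ?_⟩
      rw [Polynomial.aeval_def, Polynomial.eval₂_map]
      exact hpb
    have h4 := (h2.isTranscendenceBasis_iff_isAlgebraic.2 h3).lift_cardinalMk_eq_trdeg
    rw [← h4] at h1
    simpa using h1
  let m := M.under (MvPolynomial (Fin s) k)
  have : m.IsMaximal := Ideal.isMaximal_comap_of_isIntegral_of_isMaximal M
  have : M.LiesOver m := ⟨rfl⟩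
  rw [Ideal.height_eq_height_add_of_liesOver_of_hasGoingDown m M]
  calc (e : ℕ∞) ≤ s := by exact_mod_cast hes
    _ ≤ m.height := le_height_of_isMaximal_mvPolynomial s m
    _ ≤ _ := le_self_add

/-- Incomparability: contraction of primes along an integral extension is strictly monotone. -/
theorem ringKrullDim_le_of_isIntegral {R S : Type u} [CommRing R] [CommRing S] [Algebra R S]
    [Algebra.IsIntegral R S] : ringKrullDim S ≤ ringKrullDim R :=
  Order.krullDim_le_of_strictMono (PrimeSpectrum.comap (algebraMap R S)) fun I J h =>
    Ideal.IsIntegral.comap_lt_comap (I := I.asIdeal) (J := J.asIdeal) h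

/-- Noether normalization again: the number of normalizing variables is at least the Krull
dimension, and `d` of them are kept. -/
theorem exists_algebraicIndependent_of_le_ringKrullDim {k R : Type u} [Field k] [CommRing R]
    [IsDomain R] [Algebra k R] [Algebra.FiniteType k R] {d : ℕ}
    (hd : (d : WithBot ℕ∞) ≤ ringKrullDim R) : ∃ z : Fin d → R, AlgebraicIndependent k z := by
  obtain ⟨s, g, hg, hint⟩ := exists_integral_inj_algHom_of_fg k R
  have h : ringKrullDim R ≤ s := by
    let : Algebra (MvPolynomial (Fin s) k) R := g.toRingHom.toAlgebra
    have hI : Algebra.IsIntegral (MvPolynomial (Fin s) k) R := ⟨hint⟩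
    refine (ringKrullDim_le_of_isIntegral (R := MvPolynomial (Fin s) k)).trans ?_
    rw [MvPolynomial.ringKrullDim_of_isNoetherianRing]
    simp
  have hds : d ≤ s := by exact_mod_cast hd.trans h
  have h2 : AlgebraicIndependent k fun i : Fin s => g (MvPolynomial.X i) :=
    (MvPolynomial.algebraicIndependent_X (Fin s) k).map' hg
  exact ⟨_, h2.comp (Fin.castLE hds) (Fin.castLE_injective hds)⟩

/-- The Nullstellensatz: `k`-points are dense in closed subsets. -/
theorem exists_point {k R : Type u} [Field k] [IsAlgClosed k] [CommRing R] [Algebra k R]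
    [Algebra.FiniteType k R] (p : Ideal R) [p.IsPrime] {r : R} (hr : r ∉ p) :
    ∃ x : R →ₐ[k] k, p ≤ RingHom.ker x ∧ x r ≠ 0 := by
  have : IsJacobsonRing R := isJacobsonRing_of_finiteType (A := k)
  have hj : p.jacobson = p := ‹IsJacobsonRing R›.out (Ideal.IsPrime.isRadical ‹_›)
  rw [← hj, Ideal.jacobson, Ideal.mem_sInf] at hr
  push Not at hr
  obtain ⟨m, ⟨hpm, hm⟩, hrm⟩ := hr
  let := Ideal.Quotient.field m
  have : Module.Finite k (R ⧸ m) := finite_of_finite_type_of_isJacobsonRing k (R ⧸ m)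
  have hb : Function.Bijective (algebraMap k (R ⧸ m)) :=
    IsAlgClosed.algebraMap_bijective_of_isIntegral
  let e : k ≃ₐ[k] R ⧸ m := AlgEquiv.ofBijective (Algebra.ofId k _) hb
  refine ⟨e.symm.toAlgHom.comp (Ideal.Quotient.mkₐ k m), fun a ha => ?_, fun h => hrm ?_⟩
  · have : (Ideal.Quotient.mkₐ k m) a = 0 := Ideal.Quotient.eq_zero_iff_mem.2 (hpm ha)
    exact (congrArg e.symm this).trans (map_zero _)
  · exact Ideal.Quotient.eq_zero_iff_mem.1 (e.symm.map_eq_zero_iff.1 h)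

theorem exists_point_of_le {k R : Type u} [Field k] [IsAlgClosed k] [CommRing R] [Algebra k R]
    [Algebra.FiniteType k R] (I : Ideal R) (hI : I ≠ ⊤) :
    ∃ x : R →ₐ[k] k, I ≤ RingHom.ker x := by
  obtain ⟨m, hm, hIm⟩ := Ideal.exists_le_maximal I hI
  obtain ⟨x, hx, -⟩ := exists_point (k := k) m (r := 1) (fun h => hm.ne_top (m.eq_top_iff_one.2 h))
  exact ⟨x, hIm.trans hx⟩

/-- A dominant morphism has a quasi-section, which is finite over a basic open set. -/
theorem exists_integral_cover {R W : Type u} [CommRing R] [IsDomain R] [CommRing W] [Algebra R W]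
    [Algebra.FiniteType R W] (inj : Function.Injective (algebraMap R W)) :
    ∃ f : R, f ≠ 0 ∧ ∃ (B : Type u) (_ : CommRing B) (_ : IsDomain B)
      (_ : Algebra (Localization.Away f) B), Algebra.IsIntegral (Localization.Away f) B ∧
      Algebra.FiniteType (Localization.Away f) B ∧
      Function.Injective (algebraMap (Localization.Away f) B) ∧
      ∃ φ : W →+* B, ∀ r, φ (algebraMap R W r) =
        algebraMap (Localization.Away f) B (algebraMap R _ r) := by
  let K := FractionRing R
  -- `T` is the generic fibre. It is nonzero since `R → W` is injective, and the residue field `L`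
  -- of a closed point of it is finite over `K` by Zariski's lemma, hence algebraic over `R`.
  let T := K ⊗[R] W
  have hT : Nontrivial T := by
    have h : Function.Injective ((Algebra.linearMap R W).lTensor K) :=
      Module.Flat.lTensor_preserves_injective_linearMap _ inj
    exact h.nontrivial
  obtain ⟨m, hm⟩ := Ideal.exists_maximal T
  let L := T ⧸ m
  let _ : Field L := Ideal.Quotient.field m
  have : Algebra.FiniteType K T := inferInstance
  have : Algebra.FiniteType K L := .of_surjective (Ideal.Quotient.mkₐ K m) Ideal.Quotient.mk_surjective
  have : Module.Finite K L := finite_of_finite_type_of_isJacobsonRing K L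
  have hRL : Function.Injective (algebraMap R L) := by
    rw [IsScalarTower.algebraMap_eq R K L]
    exact (algebraMap K L).injective.comp (IsFractionRing.injective R K)
  have halg : Algebra.IsAlgebraic R L := by
    have : Algebra.IsAlgebraic R K := IsLocalization.isAlgebraic K (nonZeroDivisors R)
    have : Algebra.IsAlgebraic K L := Algebra.IsAlgebraic.of_finite K L
    exact Algebra.IsAlgebraic.trans R K L
  let ψ : W →ₐ[R] L := (Ideal.Quotient.mkₐ R m).comp Algebra.TensorProduct.includeRight
  obtain ⟨s, hs⟩ := ‹Algebra.FiniteType R W›.out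
  choose c hc hci using fun x : L => (halg.isAlgebraic x).exists_integral_multiple
  -- A common denominator: once `f` is inverted, the images in `L` of the generators of `W` become
  -- integral, and they generate the required `B`.
  let f := ∏ w ∈ s, c (ψ w)
  have hf : f ≠ 0 := Finset.prod_ne_zero_iff.2 fun w _ => hc _
  let R' := Localization.Away f
  let ι : R' →+* L := IsLocalization.Away.lift f (g := algebraMap R L)
    (IsUnit.mk0 _ fun h => hf (hRL (h.trans (map_zero _).symm)))
  have hι : ∀ r, ι (algebraMap R R' r) = algebraMap R L r := IsLocalization.Away.lift_eq f _
  let _ : Algebra R' L := ι.toAlgebra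
  have : IsScalarTower R R' L := .of_algebraMap_eq fun r => (hι r).symm
  have hinj : Function.Injective ι := by
    rw [injective_iff_map_eq_zero]
    intro a ha
    obtain ⟨⟨r, t⟩, h⟩ := IsLocalization.surj (Submonoid.powers f) a
    have h1 := congrArg ι h
    rw [map_mul, ha, zero_mul, hι] at h1
    have h2 : r = 0 := hRL (h1.symm.trans (map_zero _).symm)
    rw [h2, map_zero] at h
    exact (IsLocalization.map_units R' t).mul_left_eq_zero.1 h
  let B : Subalgebra R' L := Algebra.adjoin R' (ψ '' s)
  have hB : Algebra.IsIntegral R' B := by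
    refine Algebra.IsIntegral.adjoin ?_
    rintro _ ⟨w, hw, rfl⟩
    have h1 : IsIntegral R' (c (ψ w) • ψ w) := (hci _).tower_top
    have h2 : IsUnit (algebraMap R R' (c (ψ w))) :=
      isUnit_of_dvd_unit (map_dvd _ (Finset.dvd_prod_of_mem (fun w => c (ψ w)) hw))
        (IsLocalization.Away.algebraMap_isUnit f)
    obtain ⟨u, hu⟩ := h2
    have h3 : ψ w = (u⁻¹ : R'ˣ) • (c (ψ w) • ψ w) := by
      rw [← algebraMap_smul R' (c (ψ w)), ← hu]
      exact (inv_smul_smul u (ψ w)).symm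
    rw [h3]
    exact h1.smul ((u⁻¹ : R'ˣ) : R')
  have hψ : ∀ w, ψ w ∈ B := by
    intro w
    have h1 : w ∈ Algebra.adjoin R (s : Set W) := hs ▸ Algebra.mem_top
    induction h1 using Algebra.adjoin_induction with
    | mem x hx => exact Algebra.subset_adjoin ⟨x, hx, rfl⟩
    | algebraMap r =>
      rw [AlgHom.commutes, IsScalarTower.algebraMap_apply R R' L]
      exact B.algebraMap_mem _
    | add x y _ _ hx hy => rw [map_add]; exact B.add_mem hx hy
    | mul x y _ _ hx hy => rw [map_mul]; exact B.mul_mem hx hy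
  refine ⟨f, hf, B, inferInstance, inferInstance, inferInstance, hB, ?_, fun a b h => hinj ?_,
    ψ.toRingHom.codRestrict B hψ, fun r => Subtype.ext ?_⟩
  · classical exact (Subalgebra.fg_iff_finiteType _).1 ⟨s.image ψ, by rw [Finset.coe_image]⟩
  · exact congrArg Subtype.val h
  · exact (ψ.commutes r).trans (hι r).symm

/-- A family of sets of points given by finitely many dominant-or-not morphisms `W i → Spec R`, which
together are surjective on points, has large fibres over an open set of points: given at most `N`
functions on each of the `W i`, the locus of points which lift to a point of some `W i` with fixed
values of these functions contains a closed subset of codimension at most `N`. -/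
theorem exists_chain_of_covering {k R : Type u} [Field k] [IsAlgClosed k] [CommRing R] [IsDomain R]
    [Algebra k R] [Algebra.FiniteType k R] {ι : Type u} [Finite ι] (W : ι → Type u)
    [∀ i, CommRing (W i)] [∀ i, Algebra k (W i)] [∀ i, Algebra R (W i)]
    [∀ i, IsScalarTower k R (W i)] [∀ i, Algebra.FiniteType R (W i)] (n : ι → ℕ)
    (l : ∀ i, Fin (n i) → W i) {N d : ℕ} (hn : ∀ i, n i ≤ N)
    (hcov : ∀ x : R →ₐ[k] k, ∃ i, ∃ w : W i →ₐ[k] k, ∀ r, w (algebraMap R (W i) r) = x r)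
    (hd : ((d + N : ℕ) : WithBot ℕ∞) ≤ ringKrullDim R) :
    ∃ f : R, f ≠ 0 ∧ ∀ x : R →ₐ[k] k, x f ≠ 0 → ∃ i, ∃ w : W i →ₐ[k] k,
      (∀ r, w (algebraMap R (W i) r) = x r) ∧ ∃ q : LTSeries (PrimeSpectrum R), q.length = d ∧
      (∀ j, f ∉ (q j).asIdeal) ∧
      ∀ x' : R →ₐ[k] k, x' f ≠ 0 → (∀ r ∈ (q 0).asIdeal, x' r = 0) →
        ∃ w' : W i →ₐ[k] k, (∀ r, w' (algebraMap R (W i) r) = x' r) ∧ ∀ j, w' (l i j) = w (l i j) := by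
  -- If no `W i` were dominant, each image would lie in the zero set of a nonzero `r i`. A point
  -- where the product of the `r i` does not vanish would then remain uncovered.
  obtain ⟨i, hi⟩ : ∃ i, Function.Injective (algebraMap R (W i)) := by
    by_contra! h
    have h1 : ∀ i, ∃ r, algebraMap R (W i) r = 0 ∧ r ≠ 0 := fun i => by
      simpa [injective_iff_map_eq_zero] using h i
    choose r hr hr0 using h1
    cases nonempty_fintype ι
    obtain ⟨x, -, hx⟩ := exists_point (k := k) (⊥ : Ideal R) (r := ∏ i, r i)
      (fun h => Finset.prod_ne_zero_iff.2 (fun i _ => hr0 i) h)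
    obtain ⟨i, w, hw⟩ := hcov x
    rw [map_prod, Finset.prod_ne_zero_iff] at hx
    exact hx i (Finset.mem_univ i) (by rw [← hw, hr, map_zero])
  obtain ⟨f, hf, B, _, _, _, hint, hft, hinj, φ, hφ⟩ := exists_integral_cover hi
  let R' := Localization.Away f
  let _ : Algebra k B := ((algebraMap R' B).comp (algebraMap k R')).toAlgebra
  have : IsScalarTower k R' B := .of_algebraMap_eq fun _ => rfl
  have : Algebra.FiniteType R R' := IsLocalization.finiteType_of_monoid_fg (Submonoid.powers f) R'
  have : Algebra.FiniteType k R' := .trans ‹_› this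
  have : Algebra.FiniteType k B := .trans ‹_› hft
  have : IsNoetherianRing B := Algebra.FiniteType.isNoetherianRing k B
  have hRB : Function.Injective ((algebraMap R' B).comp (algebraMap R R')) :=
    hinj.comp (IsLocalization.injective R' (powers_le_nonZeroDivisors_of_noZeroDivisors hf))
  let φk : W i →ₐ[k] B := { φ with
    commutes' := fun c => by
      change φ (algebraMap k (W i) c) = _
      rw [IsScalarTower.algebraMap_apply k R (W i), hφ, ← IsScalarTower.algebraMap_apply k R R']
      rfl }
  have hφk : ∀ r, φk (algebraMap R (W i) r) = algebraMap R' B (algebraMap R R' r) := hφ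
  -- lifting points
  have lift : ∀ (x : R →ₐ[k] k), x f ≠ 0 → ∀ P : Ideal B, P.IsPrime →
      (∀ r, algebraMap R' B (algebraMap R R' r) ∈ P → x r = 0) →
      ∃ y : B →ₐ[k] k, (∀ r, y (algebraMap R' B (algebraMap R R' r)) = x r) ∧ ∀ b ∈ P, y b = 0 := by
    intro x hx P _ hP
    let x' : R' →ₐ[k] k := IsLocalization.liftAlgHom (M := Submonoid.powers f) (f := x) (by
      rintro ⟨_, n, rfl⟩
      simpa using (hx.isUnit).pow n)
    have hx' : ∀ r, x' (algebraMap R R' r) = x r := fun r => by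
      simp [x']
    have hle : P.comap (algebraMap R' B) ≤ RingHom.ker x' := by
      intro a ha
      obtain ⟨⟨r, t⟩, h⟩ := IsLocalization.surj (Submonoid.powers f) a
      have h1 : algebraMap R' B (algebraMap R R' r) ∈ P := by
        rw [← h, map_mul]
        exact P.mul_mem_right _ ha
      have h2 := congrArg x' h
      rw [map_mul, hx' r, hP r h1] at h2
      exact ((IsLocalization.map_units R' t).map x').mul_left_eq_zero.1 h2
    have : (RingHom.ker x').IsPrime := RingHom.ker_isPrime x'.toRingHom
    -- Lying over gives a prime above the point `x` and containing `P`. Any point of its zero set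
    -- restricts to `x`, because `r - x r` lies in `Q`.
    obtain ⟨Q, hPQ, hQ, hQx⟩ := Ideal.exists_ideal_over_prime_of_isIntegral_of_isPrime
      (RingHom.ker x') P hle
    obtain ⟨y, hy⟩ := exists_point_of_le (k := k) Q hQ.ne_top
    refine ⟨y, fun r => ?_, fun b hb => hy (hPQ hb)⟩
    have h3 : algebraMap R' B (algebraMap R R' (r - algebraMap k R (x r))) ∈ Q := by
      rw [← Ideal.mem_comap, hQx, RingHom.mem_ker]
      rw [hx', map_sub, AlgHom.commutes]
      simp
    have h4 : y _ = 0 := hy h3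
    rw [map_sub, map_sub, map_sub, sub_eq_zero] at h4
    rw [h4, ← IsScalarTower.algebraMap_apply k R R', ← IsScalarTower.algebraMap_apply k R' B,
      AlgHom.commutes]
    rfl
  refine ⟨f, hf, fun x hx => ?_⟩
  obtain ⟨y, hyx, -⟩ := lift x hx ⊥ Ideal.isPrime_bot fun r hr => by
    rw [hRB (hr.trans (map_zero _).symm), map_zero]
  refine ⟨i, y.comp φk, fun r => by rw [AlgHom.comp_apply, hφk, hyx], ?_⟩
  -- Independent elements of `R` stay independent in `B`, so the maximal ideal of the chosen point
  -- `y` has height at least `d + N`.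
  obtain ⟨z, hz⟩ := exists_algebraicIndependent_of_le_ringKrullDim (k := k) hd
  let jk : R →ₐ[k] B := (IsScalarTower.toAlgHom k R' B).comp (IsScalarTower.toAlgHom k R R')
  have hz' := hz.map' (f := jk) hRB
  have : (RingHom.ker y).IsMaximal := RingHom.ker_isMaximal_of_surjective _
    fun c => ⟨algebraMap k B c, y.commutes c⟩
  have hht := le_height_of_isMaximal hz' (RingHom.ker y)
  -- These at most `N` equations fix the values of the functions `l i j`. They vanish at `y`, so by
  -- Krull's height theorem the quotient still has dimension at least `d`.
  let s : Set B := Set.range fun j => φk (l i j) - algebraMap k B (y (φk (l i j)))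
  have hs : s ⊆ RingHom.ker y := by
    rintro _ ⟨j, rfl⟩
    change y _ = 0
    rw [map_sub, AlgHom.commutes]
    simp
  have hkr := Ideal.height_le_ringKrullDim_quotient_add_encard s hs
  have hcard : s.encard ≤ N := by
    have h1 : s.encard ≤ (Set.univ : Set (Fin (n i))).encard := by
      rw [show s = _ from Set.image_univ.symm]
      exact Set.encard_image_le _ _
    refine h1.trans ?_
    simpa using hn i
  have hdim : (d : WithBot ℕ∞) ≤ ringKrullDim (B ⧸ Ideal.span s) := by
    have h1 : ((d + N : ℕ) : WithBot ℕ∞) ≤ ringKrullDim (B ⧸ Ideal.span s) + N :=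
      le_trans (by exact_mod_cast hht) (hkr.trans (add_le_add_right (by exact_mod_cast hcard) _))
    push_cast at h1
    have : Nontrivial (B ⧸ Ideal.span s) := Ideal.Quotient.nontrivial_iff.2 fun h =>
      (RingHom.ker_ne_top y.toRingHom) (top_le_iff.1 (h ▸ Ideal.span_le.2 hs))
    generalize ringKrullDim (B ⧸ Ideal.span s) = D at h1
    induction D using WithBot.recBotCoe with
    | bot => simp at h1
    | coe D =>
      have h2 : (d : ℕ∞) + N ≤ D + N := by exact_mod_cast h1
      exact_mod_cast (ENat.add_le_add_iff_right (ENat.natCast_ne_top N)).1 h2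
  obtain ⟨p, hp⟩ := Order.le_krullDim_iff.1 hdim
  -- A chain of primes in the quotient of `B` stays strict when contracted through the quotient map,
  -- the integral extension and the localization. It avoids `f` because `f` becomes a unit in `B`.
  have m1 : StrictMono (PrimeSpectrum.comap (algebraMap R' B)) := fun I J h =>
    Ideal.IsIntegral.comap_lt_comap (I := I.asIdeal) (J := J.asIdeal) h
  have m2 : StrictMono (PrimeSpectrum.comap (algebraMap R R')) :=
    Monotone.strictMono_of_injective (fun I J h => Ideal.comap_mono h)
      (PrimeSpectrum.localization_comap_injective R' (Submonoid.powers f))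
  have m3 := RingHom.strictMono_comap_of_surjective
    (Ideal.Quotient.mk_surjective (I := Ideal.span s))
  refine ⟨p.map _ (m2.comp (m1.comp m3)), hp, fun j hj => ?_, fun x' hx' h => ?_⟩
  · refine ((p j).comap (Ideal.Quotient.mk _)).isPrime.ne_top (Ideal.eq_top_of_isUnit_mem _ hj ?_)
    exact (IsLocalization.Away.algebraMap_isUnit f).map (algebraMap R' B)
  · obtain ⟨y', hy', hyp⟩ := lift x' hx' ((p 0).comap (Ideal.Quotient.mk (Ideal.span s))).asIdeal
      (PrimeSpectrum.isPrime _) fun r hr => h r hr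
    refine ⟨y'.comp φk, fun r => by rw [AlgHom.comp_apply, hφk, hy'], fun j => ?_⟩
    have h1 := hyp (φk (l i j) - algebraMap k B (y (φk (l i j)))) (by
      change Ideal.Quotient.mk (Ideal.span s) _ ∈ (p 0).asIdeal
      have h2 : φk (l i j) - algebraMap k B (y (φk (l i j))) ∈ Ideal.span s :=
        Ideal.subset_span ⟨j, rfl⟩
      rw [Ideal.Quotient.eq_zero_iff_mem.2 h2]
      exact Ideal.zero_mem _)
    rw [map_sub, AlgHom.commutes, sub_eq_zero] at h1
    exact h1

end Dimension

end

section

/-! ### Calculus of the tensor product over a noncommutative algebra -/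

section TensorCalculus

variable {k B A : Type u} [Field k] [Ring B] [Algebra k B] [Ring A] [Algebra k A]
variable {L L' L'' : Type u} [AddCommGroup L] [Module Bᵐᵒᵖ L] [AddCommGroup L'] [Module Bᵐᵒᵖ L']
  [AddCommGroup L''] [Module Bᵐᵒᵖ L'']
variable {M N : ModuleCat.{u} (B ⊗[k] Aᵐᵒᵖ)}

/-- The element `l ⊗ m` of `L ⊗_B M`. -/
def tmk (m : M) (l : L) : (tensorFunctor (k := k) (A := A) L).obj M :=
  Submodule.Quotient.mk (p := tensorRel L M) ((show toRight M from m) ⊗ₜ[ℤ] l)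

theorem tmk_add_left (m m' : M) (l : L) : tmk (m + m') l = tmk m l + tmk m' l :=
  congrArg (Submodule.Quotient.mk (p := tensorRel L M))
    (TensorProduct.add_tmul (R := ℤ) (show toRight M from m) m' l)

theorem tmk_add_right (m : M) (l l' : L) : tmk m (l + l') = tmk m l + tmk m l' :=
  congrArg (Submodule.Quotient.mk (p := tensorRel L M))
    (TensorProduct.tmul_add (R := ℤ) (show toRight M from m) l l')

theorem smul_tmk (a : Aᵐᵒᵖ) (m : M) (l : L) :
    a • tmk m l = tmk (((1 : B) ⊗ₜ[k] a) • m) l := rfl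

theorem tmk_balanced (b : B) (m : M) (l : L) :
    tmk ((b ⊗ₜ[k] (1 : Aᵐᵒᵖ)) • m) l = tmk m (op b • l) :=
  (Submodule.Quotient.eq _).2 (Submodule.subset_span ⟨b, m, l, rfl⟩)

/-- `tmk` as a biadditive map. -/
def tmkHom (m : M) : L →+ (tensorFunctor (k := k) (A := A) L).obj M :=
  AddMonoidHom.mk' (tmk m) (tmk_add_right m)

theorem tmk_zero_right (m : M) : tmk m (0 : L) = 0 := (tmkHom m).map_zero

theorem tmk_zero_left (l : L) : tmk (0 : M) l = 0 :=
  (AddMonoidHom.mk' (fun m : M => tmk m l) fun m m' => tmk_add_left m m' l).map_zero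

/-- No case for zero is needed, as `0 = 0 ⊗ 0` is itself a pure tensor. -/
theorem tmk_induction {p : (tensorFunctor (k := k) (A := A) L).obj M → Prop}
    (h : ∀ m l, p (tmk m l)) (hadd : ∀ x y, p x → p y → p (x + y)) (x) : p x := by
  obtain ⟨x, rfl⟩ := Submodule.Quotient.mk_surjective _ x
  induction x using TensorProduct.induction_on with
  | zero =>
    have := h 0 0
    rwa [tmk_zero_left] at this
  | tmul m l => exact h m l
  | add x y hx hy => exact hadd _ _ hx hy

/-- A biadditive map on `M × L`, as an additive map on the tensor product over `ℤ`. -/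
def tensorLiftAux {X : Type*} [AddCommGroup X] (φ : M →+ L →+ X) : (toRight M ⊗[ℤ] L) →+ X :=
  TensorProduct.liftAddHom (R := ℤ) (M := toRight M) (N := L) φ (fun r m l =>
    (congrArg (fun f : L →+ X => f l) (φ.map_zsmul r m)).trans ((φ m).map_zsmul r l).symm)

/-- The universal property of `L ⊗_B M`. -/
def tensorLift {X : Type*} [AddCommGroup X] (φ : M →+ L →+ X)
    (h : ∀ (b : B) m l, φ ((b ⊗ₜ[k] (1 : Aᵐᵒᵖ)) • m) l = φ m (op b • l)) :
    (tensorFunctor (k := k) (A := A) L).obj M →+ X :=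
  QuotientAddGroup.lift (tensorRel L M).toAddSubgroup (tensorLiftAux φ) (by
      intro x hx
      change x ∈ tensorRel L M at hx
      change tensorLiftAux φ x = 0
      rw [tensorRel] at hx
      induction hx using Submodule.closure_induction with
      | zero => exact map_zero _
      | add x y _ _ hx hy => exact (map_add _ x y).trans (by rw [hx, hy, add_zero])
      -- The relations span an `Aᵐᵒᵖ`-submodule while `φ` is only biadditive. Since `1 ⊗ a` commutes
      -- with `b ⊗ 1`, a multiple of a relation is again a relation.
      | smul_mem a x hx =>
        obtain ⟨b, m, l, rfl⟩ := hx
        rw [smul_sub, map_sub, sub_eq_zero]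
        change φ (((1 : B) ⊗ₜ[k] a) • (b ⊗ₜ[k] (1 : Aᵐᵒᵖ)) • (show M from m)) l =
          φ (((1 : B) ⊗ₜ[k] a) • (show M from m)) (op b • l)
        rw [← h, smul_smul, smul_smul]
        simp)

theorem tensor_hom_ext {X : Type*} [AddCommGroup X]
    {f g : (tensorFunctor (k := k) (A := A) L).obj M →+ X}
    (h : ∀ m l, f (tmk m l) = g (tmk m l)) : f = g :=
  AddMonoidHom.ext fun x => by
    induction x using tmk_induction with
    | h m l => exact h m l
    | hadd x y hx hy => rw [map_add, map_add, hx, hy]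

/-- Functoriality of `L ⊗_B M` in `L`, as an additive map. -/
def tensorMapLAux (M : ModuleCat.{u} (B ⊗[k] Aᵐᵒᵖ)) (g : L →ₗ[Bᵐᵒᵖ] L') :
    (tensorFunctor (k := k) (A := A) L).obj M →+
      (tensorFunctor (k := k) (A := A) L').obj M :=
  tensorLift (AddMonoidHom.mk' (fun m => (tmkHom m).comp g.toAddMonoidHom)
    fun m m' => AddMonoidHom.ext fun l => tmk_add_left m m' (g l))
    (fun b m l => by
      change tmk _ (g l) = tmk m (g (op b • l))
      rw [tmk_balanced, map_smul])

theorem tensorMapLAux_smul (M : ModuleCat.{u} (B ⊗[k] Aᵐᵒᵖ)) (g : L →ₗ[Bᵐᵒᵖ] L') (a : Aᵐᵒᵖ)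
    (x) : tensorMapLAux M g (a • x) = a • tensorMapLAux M g x := by
  induction x using tmk_induction with
  | h m l => rfl
  | hadd x y hx hy => rw [smul_add, map_add, hx, hy, map_add, smul_add]

/-- Functoriality of `L ⊗_B M` in `L`. -/
def tensorMapL (M : ModuleCat.{u} (B ⊗[k] Aᵐᵒᵖ)) (g : L →ₗ[Bᵐᵒᵖ] L') :
    (tensorFunctor (k := k) (A := A) L).obj M ⟶ (tensorFunctor L').obj M :=
  ModuleCat.ofHom
    { tensorMapLAux M g with map_smul' := tensorMapLAux_smul M g }

theorem tensor_cat_ext {X : ModuleCat.{u} Aᵐᵒᵖ}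
    {f g : (tensorFunctor (k := k) (A := A) L).obj M ⟶ X}
    (h : ∀ m l, f (tmk m l) = g (tmk m l)) : f = g :=
  ModuleCat.hom_ext (LinearMap.toAddMonoidHom_injective (tensor_hom_ext h))

/-- Functoriality of the complex `L ⊗_B P` in `L`. -/
def tensorComplexMap (P : ChainComplex (ModuleCat.{u} (B ⊗[k] Aᵐᵒᵖ)) ℤ) (g : L →ₗ[Bᵐᵒᵖ] L') :
    tensorComplex L P ⟶ tensorComplex L' P where
  f i := tensorMapL (P.X i) g
  comm' _ _ _ := tensor_cat_ext fun _ _ => rfl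

variable (P : ChainComplex (ModuleCat.{u} (B ⊗[k] Aᵐᵒᵖ)) ℤ)

theorem tensorComplexMap_id : tensorComplexMap P (LinearMap.id : L →ₗ[Bᵐᵒᵖ] L) = 𝟙 _ := by
  ext i : 1
  exact tensor_cat_ext fun _ _ => rfl

theorem tensorComplexMap_comp (g : L →ₗ[Bᵐᵒᵖ] L') (g' : L' →ₗ[Bᵐᵒᵖ] L'') :
    tensorComplexMap P (g' ∘ₗ g) = tensorComplexMap P g ≫ tensorComplexMap P g' := by
  ext i : 1
  exact tensor_cat_ext fun _ _ => rfl

theorem tensorComplexMap_add (g g' : L →ₗ[Bᵐᵒᵖ] L') :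
    tensorComplexMap P (g + g') = tensorComplexMap P g + tensorComplexMap P g' := by
  ext i : 1
  exact tensor_cat_ext fun m l => tmk_add_right m (g l) (g' l)

theorem tensorComplexMap_zero : tensorComplexMap P (0 : L →ₗ[Bᵐᵒᵖ] L') = 0 := by
  ext i : 1
  exact tensor_cat_ext fun m l => tmk_zero_right m

/-- `L ≃ L'` induces `L ⊗_B P ≅ L' ⊗_B P`. -/
def tensorComplexIso (g : L ≃ₗ[Bᵐᵒᵖ] L') : tensorComplex L P ≅ tensorComplex L' P where
  hom := tensorComplexMap P g.toLinearMap
  inv := tensorComplexMap P g.symm.toLinearMap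
  hom_inv_id := by
    rw [← tensorComplexMap_comp, ← tensorComplexMap_id]
    congr 1
    ext
    simp
  inv_hom_id := by
    rw [← tensorComplexMap_comp, ← tensorComplexMap_id]
    congr 1
    ext
    simp

/-- `(L × L') ⊗_B P ≅ (L ⊗_B P) ⊞ (L' ⊗_B P)`. -/
theorem tensorComplex_prod :
    Nonempty (tensorComplex (L × L') P ≅ tensorComplex L P ⊞ tensorComplex L' P) := by
  let b : BinaryBicone (tensorComplex L P) (tensorComplex L' P) :=
    { pt := tensorComplex (L × L') P
      fst := tensorComplexMap P (LinearMap.fst _ _ _)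
      snd := tensorComplexMap P (LinearMap.snd _ _ _)
      inl := tensorComplexMap P (LinearMap.inl _ _ _)
      inr := tensorComplexMap P (LinearMap.inr _ _ _)
      inl_fst := by
        rw [← tensorComplexMap_comp, LinearMap.fst_comp_inl, tensorComplexMap_id]
      inl_snd := by
        rw [← tensorComplexMap_comp, LinearMap.snd_comp_inl, tensorComplexMap_zero]
      inr_fst := by
        rw [← tensorComplexMap_comp, LinearMap.fst_comp_inr, tensorComplexMap_zero]
      inr_snd := by
        rw [← tensorComplexMap_comp, LinearMap.snd_comp_inr, tensorComplexMap_id] }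
  -- By additivity in `L`, the biproduct identities are the images of those for `L × L'`.
  have hb : b.IsBilimit := isBinaryBilimitOfTotal b (by
    change tensorComplexMap P _ ≫ tensorComplexMap P _ +
      tensorComplexMap P _ ≫ tensorComplexMap P _ = 𝟙 (tensorComplex (L × L') P)
    rw [← tensorComplexMap_comp, ← tensorComplexMap_comp, ← tensorComplexMap_add,
      ← tensorComplexMap_id]
    congr 1
    ext <;> simp)
  exact ⟨biprod.uniqueUpToIso _ _ hb⟩

end TensorCalculus

end

section

/-! ### Families of complexes obtained from a bimodule -/

section BaseFamily

variable {k B A S L : Type u} [Field k] [Ring B] [Algebra k B] [Ring A] [Algebra k A]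
  [AddCommGroup L] [Module Bᵐᵒᵖ L]

/-- The action of `s : S` on a bimodule `L`. -/
def smulL {S : Type u} [CommRing S] (B L : Type u) [Ring B] [AddCommGroup L] [Module Bᵐᵒᵖ L] [Module S L]
    [SMulCommClass S Bᵐᵒᵖ L] (s : S) : L →ₗ[Bᵐᵒᵖ] L where
  toFun l := s • l
  map_add' := smul_add s
  map_smul' b l := smul_comm s b l

/-- The tensor product `L ⊗_B M`, which is an `S ⊗ Aᵐᵒᵖ`-module when `L` is an
`S`-`B`-bimodule. -/
def BaseObj (_S L : Type u) [AddCommGroup L] [Module Bᵐᵒᵖ L] (M : ModuleCat.{u} (B ⊗[k] Aᵐᵒᵖ)) :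
    Type u :=
  (tensorFunctor (k := k) (A := A) L).obj M

variable {M N : ModuleCat.{u} (B ⊗[k] Aᵐᵒᵖ)}

instance : AddCommGroup (BaseObj S L M) :=
  inferInstanceAs (AddCommGroup ((tensorFunctor (k := k) (A := A) L).obj M))

instance : Module Aᵐᵒᵖ (BaseObj S L M) :=
  inferInstanceAs (Module Aᵐᵒᵖ ((tensorFunctor (k := k) (A := A) L).obj M))

/-- Here `k` acts through `A`; the field `commutes'` of `actS` checks that acting through `S` gives
the same. -/
instance : Module k (BaseObj S L M) := Module.compHom _ (algebraMap k Aᵐᵒᵖ)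

instance : IsScalarTower k Aᵐᵒᵖ (BaseObj S L M) where
  smul_assoc c a x := by
    rw [Algebra.smul_def, mul_smul]
    rfl

variable (S) in
/-- The element `l ⊗ m` of `L ⊗_B M`, as an element of an `S ⊗ Aᵐᵒᵖ`-module. -/
def bmk (m : M) (l : L) : BaseObj S L M := tmk m l

theorem bmk_induction {p : BaseObj S L M → Prop}
    (h : ∀ m l, p (bmk S m l)) (hadd : ∀ x y, p x → p y → p (x + y)) (x) : p x :=
  tmk_induction h hadd x

theorem bmk_add_left (m m' : M) (l : L) : bmk S (m + m') l = bmk S m l + bmk S m' l :=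
  tmk_add_left m m' l

theorem bmk_add_right (m : M) (l l' : L) : bmk S m (l + l') = bmk S m l + bmk S m l' :=
  tmk_add_right m l l'

theorem bmk_zero_left (l : L) : bmk S (0 : M) l = 0 := tmk_zero_left l

theorem bmk_zero_smul_left (m : M) (l : L) : bmk S ((0 : B ⊗[k] Aᵐᵒᵖ) • m) l = 0 :=
  (congrArg (fun m => bmk S m l) (zero_smul (B ⊗[k] Aᵐᵒᵖ) m)).trans (bmk_zero_left l)

theorem bmk_balanced (b : B) (m : M) (l : L) :
    bmk S ((b ⊗ₜ[k] (1 : Aᵐᵒᵖ)) • m) l = bmk S m (op b • l) :=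
  tmk_balanced b m l

theorem smul_bmk (a : Aᵐᵒᵖ) (m : M) (l : L) :
    a • bmk S m l = bmk S (((1 : B) ⊗ₜ[k] a) • m) l := rfl

theorem algebraMap_tmul_one (c : k) :
    (algebraMap k B c) ⊗ₜ[k] (1 : Aᵐᵒᵖ) = (1 : B) ⊗ₜ[k] algebraMap k Aᵐᵒᵖ c := by
  rw [Algebra.algebraMap_eq_smul_one, Algebra.algebraMap_eq_smul_one, TensorProduct.smul_tmul]

variable [CommRing S] [Module S L] [SMulCommClass S Bᵐᵒᵖ L]

/-- The action of `s : S` on `L ⊗_B M`. -/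
def actSAux (M : ModuleCat.{u} (B ⊗[k] Aᵐᵒᵖ)) (s : S) : BaseObj S L M →+ BaseObj S L M :=
  tensorMapLAux M (smulL B L s)

theorem actSAux_bmk (s : S) (m : M) (l : L) : actSAux M s (bmk S m l) = bmk S m (s • l) := rfl

theorem actSAux_smul (s : S) (a : Aᵐᵒᵖ) (x : BaseObj S L M) :
    actSAux M s (a • x) = a • actSAux M s x :=
  tensorMapLAux_smul M (smulL B L s) a x

variable [Algebra k S] [Module k L] [IsScalarTower k Bᵐᵒᵖ L] [IsScalarTower k S L]

variable (S L) in
/-- The action of `S` on `L ⊗_B M`. -/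
def actS (M : ModuleCat.{u} (B ⊗[k] Aᵐᵒᵖ)) : S →ₐ[k] Module.End k (BaseObj S L M) where
  toFun s := { actSAux M s with map_smul' := fun c x => actSAux_smul s (algebraMap k Aᵐᵒᵖ c) x }
  map_one' := by
    ext x
    change actSAux M 1 x = x
    induction x using bmk_induction with
    | h m l => rw [actSAux_bmk, one_smul]
    | hadd x y hx hy => rw [map_add, hx, hy]
  map_mul' s t := by
    ext x
    change actSAux M (s * t) x = actSAux M s (actSAux M t x)
    induction x using bmk_induction with
    | h m l => simp only [actSAux_bmk, mul_smul]
    | hadd x y hx hy => simp only [map_add, hx, hy]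
  map_zero' := by
    ext x
    change actSAux M 0 x = 0
    induction x using bmk_induction with
    | h m l => rw [actSAux_bmk, zero_smul]; exact tmk_zero_right m
    | hadd x y hx hy => rw [map_add, hx, hy, add_zero]
  map_add' s t := by
    ext x
    change actSAux M (s + t) x = actSAux M s x + actSAux M t x
    induction x using bmk_induction with
    | h m l => simp only [actSAux_bmk, add_smul, bmk_add_right]
    | hadd x y hx hy => simp only [map_add, hx, hy]; abel
  commutes' c := by
    ext x
    change actSAux M (algebraMap k S c) x = algebraMap k Aᵐᵒᵖ c • x
    induction x using bmk_induction with
    | h m l =>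
      rw [actSAux_bmk, algebraMap_smul, ← algebraMap_smul Bᵐᵒᵖ c l, smul_bmk, ← algebraMap_tmul_one,
        bmk_balanced]
      rfl
    | hadd x y hx hy => rw [map_add, hx, hy, smul_add]

variable (S L) in
/-- The action of `S ⊗ Aᵐᵒᵖ` on `L ⊗_B M`. -/
def baseHom (M : ModuleCat.{u} (B ⊗[k] Aᵐᵒᵖ)) :
    S ⊗[k] Aᵐᵒᵖ →ₐ[k] Module.End k (BaseObj S L M) :=
  Algebra.TensorProduct.lift (actS S L M) (Algebra.lsmul k k (BaseObj S L M)) (by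
    intro s a
    ext x
    exact actSAux_smul s a x)

instance : Module (S ⊗[k] Aᵐᵒᵖ) (BaseObj S L M) := Module.compHom _ (baseHom S L M).toRingHom

theorem tmul_smul_bmk (s : S) (a : Aᵐᵒᵖ) (m : M) (l : L) :
    (s ⊗ₜ[k] a) • bmk S m l = bmk S (((1 : B) ⊗ₜ[k] a) • m) (s • l) := by
  change baseHom S L M (s ⊗ₜ[k] a) (bmk S m l) = _
  rfl

variable (S L) in
/-- The functor `M ↦ L ⊗_B M` for an `S`-`B`-bimodule `L`, on morphisms. -/
def baseMap (f : M ⟶ N) : BaseObj S L M →ₗ[S ⊗[k] Aᵐᵒᵖ] BaseObj S L N where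
  toFun x := (tensorFunctor (k := k) (A := A) L).map f x
  map_add' x y := map_add ((tensorFunctor (k := k) (A := A) L).map f).hom x y
  map_smul' r x := by
    let F : BaseObj S L M →+ BaseObj S L N :=
      ((tensorFunctor (k := k) (A := A) L).map f).hom.toAddMonoidHom
    change F (r • x) = r • F x
    induction r using TensorProduct.induction_on with
    | zero =>
      exact ((congrArg F (zero_smul (S ⊗[k] Aᵐᵒᵖ) x)).trans (map_zero F)).trans
        (zero_smul (S ⊗[k] Aᵐᵒᵖ) (F x)).symm
    | add r r' hr hr' => rw [add_smul, add_smul, map_add, hr, hr']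
    | tmul s a =>
      induction x using bmk_induction with
      | h m l =>
        have h : ∀ (m : M) (l : L), F (bmk S m l) = bmk S (f m) l := fun _ _ => rfl
        rw [tmul_smul_bmk, h, h, tmul_smul_bmk]
        congr 1
        exact f.hom.map_smul _ _
      | hadd x y hx hy => rw [smul_add, map_add, hx, hy, map_add, smul_add]

theorem baseMap_bmk (f : M ⟶ N) (m : M) (l : L) : baseMap S L f (bmk S m l) = bmk S (f m) l := rfl

variable (S L) in
/-- The complex of `S ⊗ Aᵐᵒᵖ`-modules `L ⊗_B P`, for an `S`-`B`-bimodule `L`. -/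
def baseComplex (P : ChainComplex (ModuleCat.{u} (B ⊗[k] Aᵐᵒᵖ)) ℤ) :
    ChainComplex (ModuleCat.{u} (S ⊗[k] Aᵐᵒᵖ)) ℤ where
  X i := ModuleCat.of _ (BaseObj S L (P.X i))
  d i j := ModuleCat.ofHom (baseMap S L (P.d i j))
  shape i j h := by
    ext x
    change ((tensorComplex L P).d i j) x = 0
    rw [(tensorComplex L P).shape i j h]
    rfl
  d_comp_d' i j l _ _ := by
    ext x
    change ((tensorComplex L P).d i j ≫ (tensorComplex L P).d j l) x = 0
    rw [(tensorComplex L P).d_comp_d]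
    rfl

/-! ### Finiteness, projectivity and minimality of `L ⊗_B P`. -/

section Projective

/-- The dual basis lemma: the coordinates and the generators exhibit `X` as a retract of a free
module of finite rank. -/
theorem projective_finite_of_dualBasis {R X : Type*} [Ring R] [AddCommGroup X] [Module R X]
    {ι : Type*} [Fintype ι] (x : ι → X) (f : ι → X →ₗ[R] R) (h : ∀ y, ∑ i, f i y • x i = y) :
    Module.Finite R X ∧ Module.Projective R X := by
  classical
  have h1 : (Fintype.linearCombination R x) ∘ₗ (LinearMap.pi f) = LinearMap.id := by
    ext y
    simpa [Fintype.linearCombination_apply] using h y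
  exact ⟨.of_surjective (Fintype.linearCombination R x) fun y => ⟨_, LinearMap.congr_fun h1 y⟩,
    .of_split _ _ h1⟩

theorem exists_dualBasis (R X : Type*) [Ring R] [AddCommGroup X] [Module R X]
    [Module.Finite R X] [Module.Projective R X] :
    ∃ (n : ℕ) (x : Fin n → X) (f : Fin n → X →ₗ[R] R), ∀ y, ∑ i, f i y • x i = y := by
  obtain ⟨n, p, hp⟩ := Module.Finite.exists_fin' R X
  obtain ⟨s, hs⟩ := Module.projective_lifting_property p LinearMap.id hp
  refine ⟨n, fun i => p (Pi.single i 1), fun i => LinearMap.proj i ∘ₗ s, fun y => ?_⟩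
  have := LinearMap.congr_fun hs y
  rw [LinearMap.comp_apply, LinearMap.id_apply, ← Finset.univ_sum_single (s y), map_sum] at this
  refine (Finset.sum_congr rfl fun i _ => ?_).trans this
  change s y i • p (Pi.single i 1) = _
  rw [← map_smul, ← Pi.single_smul, smul_eq_mul, mul_one]

variable (S L)

/-- Dual bases of `M` and of `L` give a dual basis of `L ⊗_B M`. -/
theorem exists_baseObj_dualBasis (M : ModuleCat.{u} (B ⊗[k] Aᵐᵒᵖ)) {n c : ℕ} (x : Fin n → M)
    (f : Fin n → M →ₗ[B ⊗[k] Aᵐᵒᵖ] B ⊗[k] Aᵐᵒᵖ) (hf : ∀ y, ∑ i, f i y • x i = y)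
    (e : Fin c → L) (g : Fin c → L →ₗ[S] S) (hg : ∀ y, ∑ i, g i y • e i = y) :
    ∃ G : Fin n × Fin c → BaseObj S L M →ₗ[S ⊗[k] Aᵐᵒᵖ] S ⊗[k] Aᵐᵒᵖ,
      (∀ y, ∑ ij, G ij y • bmk S (x ij.1) (e ij.2) = y) ∧
      ∀ ij m l b a, f ij.1 m = b ⊗ₜ a → G ij (bmk S m l) = g ij.2 (op b • l) ⊗ₜ a := by
  -- the coordinate functions of `l b ⊗ a` for `b ⊗ a` in `B ⊗ Aᵐᵒᵖ`
  let act : L →ₗ[k] B →ₗ[k] L := LinearMap.mk₂ k (fun l b => op b • l)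
    (fun l l' b => smul_add _ l l') (fun r l b => (smul_comm r (op b) l).symm)
    (fun l b b' => by rw [MulOpposite.op_add, add_smul]) (fun r l b => by rw [MulOpposite.op_smul, smul_assoc])
  let θ (j : Fin c) (l : L) : B ⊗[k] Aᵐᵒᵖ →ₗ[k] S ⊗[k] Aᵐᵒᵖ :=
    TensorProduct.map ((g j).restrictScalars k ∘ₗ act l) LinearMap.id
  have hθ (j l b a) : θ j l (b ⊗ₜ a) = g j (op b • l) ⊗ₜ a := rfl
  have hθadd (j l l' r) : θ j (l + l') r = θ j l r + θ j l' r := by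
    simp only [θ, map_add, LinearMap.comp_add, TensorProduct.map_add_left, LinearMap.add_apply]
  let φ (i : Fin n) (j : Fin c) : M →+ L →+ S ⊗[k] Aᵐᵒᵖ := AddMonoidHom.mk'
    (fun m => AddMonoidHom.mk' (fun l => θ j l (f i m)) fun l l' => hθadd _ _ _ _)
    (fun m m' => by ext l; simp)
  let G (i : Fin n) (j : Fin c) : BaseObj S L M →+ S ⊗[k] Aᵐᵒᵖ := tensorLift (φ i j) (by
    intro b m l
    change θ j l (f i _) = θ j _ (f i m)
    rw [map_smul, smul_eq_mul]
    induction f i m using TensorProduct.induction_on with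
    | zero => simp
    | add r r' h h' => rw [mul_add, map_add, h, h', map_add]
    | tmul b' a =>
      rw [Algebra.TensorProduct.tmul_mul_tmul, hθ, hθ, one_mul, smul_smul, MulOpposite.op_mul])
  have hG (i j m l) : G i j (bmk S m l) = θ j l (f i m) := rfl
  let G' (i : Fin n) (j : Fin c) : BaseObj S L M →ₗ[S ⊗[k] Aᵐᵒᵖ] S ⊗[k] Aᵐᵒᵖ :=
    { G i j with
      map_smul' := fun r y => by
        change G i j (r • y) = r * G i j y
        induction r using TensorProduct.induction_on with
        | zero =>
          exact ((congrArg (G i j) (zero_smul (S ⊗[k] Aᵐᵒᵖ) y)).trans (map_zero _)).trans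
            (zero_mul _).symm
        | add r r' hr hr' => rw [add_smul, add_mul, map_add, hr, hr']
        | tmul s a =>
          induction y using bmk_induction with
          | hadd y y' h h' => rw [smul_add, map_add, h, h', map_add, mul_add]
          | h m l =>
            rw [tmul_smul_bmk, hG, hG, map_smul, smul_eq_mul]
            induction f i m using TensorProduct.induction_on with
            | zero => simp
            | add r r' h h' => rw [mul_add, map_add, h, h', map_add, mul_add]
            | tmul b' a' =>
              rw [Algebra.TensorProduct.tmul_mul_tmul, hθ, hθ, one_mul,
                Algebra.TensorProduct.tmul_mul_tmul, ← smul_comm s, map_smul, smul_eq_mul] }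
  refine ⟨fun ij => G' ij.1 ij.2, fun y => ?_, fun ij m l b a h => ?_⟩
  swap
  · change θ ij.2 l (f ij.1 m) = _
    rw [h, hθ]
  induction y using bmk_induction with
  | hadd y y' h h' => simp only [map_add, add_smul, Finset.sum_add_distrib, h, h']
  | h m l =>
    -- Both sides are additive in `r`. For `r = b ⊗ a` the factor `b` moves over to `l`, and the
    -- dual basis of `L` expands `l b`.
    have key (r : B ⊗[k] Aᵐᵒᵖ) (m : M) : ∑ j, θ j l r • bmk S m (e j) = bmk S (r • m) l := by
      induction r using TensorProduct.induction_on with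
      | zero =>
        rw [bmk_zero_smul_left]
        refine Finset.sum_eq_zero fun j _ => ?_
        rw [map_zero]
        exact zero_smul (S ⊗[k] Aᵐᵒᵖ) (bmk S m (e j))
      | add r r' h h' => simp only [map_add, add_smul, Finset.sum_add_distrib, h, h', bmk_add_left]
      | tmul b a =>
        have h1 : (b ⊗ₜ[k] a) = (b ⊗ₜ[k] (1 : Aᵐᵒᵖ)) * ((1 : B) ⊗ₜ[k] a) := by simp
        rw [show bmk S ((b ⊗ₜ[k] a) • m) l = bmk S (((1 : B) ⊗ₜ[k] a) • m) (op b • l) by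
          rw [h1, mul_smul, bmk_balanced], ← hg (op b • l)]
        refine (Finset.sum_congr rfl fun j _ => (congrArg (· • bmk S m (e j)) (hθ j l b a)).trans
          (tmul_smul_bmk _ _ _ _)).trans ?_
        exact (map_sum (tmkHom (L := L) (((1 : B) ⊗ₜ[k] a) • m)) (fun j => g j (op b • l) • e j) _).symm
    rw [Fintype.sum_prod_type]
    calc ∑ i, ∑ j, G' i j (bmk S m l) • bmk S (x i) (e j) = ∑ i, bmk S (f i m • x i) l :=
          Finset.sum_congr rfl fun i _ => key (f i m) (x i)
      _ = bmk S (∑ i, f i m • x i) l :=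
          (map_sum (AddMonoidHom.mk' (fun m : M => bmk S m l) fun m m' => bmk_add_left m m' l)
            _ _).symm
      _ = bmk S m l := by rw [hf]

theorem baseObj_finite_projective (M : ModuleCat.{u} (B ⊗[k] Aᵐᵒᵖ))
    [Module.Finite (B ⊗[k] Aᵐᵒᵖ) M] [Module.Projective (B ⊗[k] Aᵐᵒᵖ) M]
    [Module.Finite S L] [Module.Projective S L] :
    Module.Finite (S ⊗[k] Aᵐᵒᵖ) (BaseObj S L M) ∧
      Module.Projective (S ⊗[k] Aᵐᵒᵖ) (BaseObj S L M) := by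
  obtain ⟨n, x, f, hf⟩ := exists_dualBasis (B ⊗[k] Aᵐᵒᵖ) M
  obtain ⟨c, e, g, hg⟩ := exists_dualBasis S L
  obtain ⟨G, hG, -⟩ := exists_baseObj_dualBasis S L M x f hf e g hg
  exact projective_finite_of_dualBasis _ G hG

/-- Dual bases of `L` and of the terms of `P` multiply. Minimality survives because the coefficients
from `B` can be absorbed by `L`, leaving the radical element of `A` outside. -/
theorem baseComplex_isMinimalFamily {P : ChainComplex (ModuleCat.{u} (B ⊗[k] Aᵐᵒᵖ)) ℤ}
    (hP : IsMinimalFamily k B A P) [Module.Finite S L] [Module.Projective S L] :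
    IsMinimalFamily k S A (baseComplex S L P) where
  bounded := by
    obtain ⟨m, n, h⟩ := hP.bounded
    refine ⟨m, n, fun i hi => ?_⟩
    have := ModuleCat.subsingleton_of_isZero (h i hi)
    have : Subsingleton ((baseComplex S L P).X i) :=
      show Subsingleton (BaseObj S L (P.X i)) from subsingleton_of_forall_eq 0 fun x => by
      induction x using bmk_induction with
      | h m l => rw [Subsingleton.elim m 0]; exact tmk_zero_left l
      | hadd x y hx hy => rw [hx, hy, add_zero]
    exact ModuleCat.isZero_of_subsingleton _
  finite i := by
    have := hP.finite i
    have := hP.projective i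
    exact (baseObj_finite_projective S L (P.X i)).1
  projective i := by
    have := hP.finite i
    have := hP.projective i
    exact (baseObj_finite_projective S L (P.X i)).2
  minimal i j x := by
    let J : Submodule (S ⊗[k] Aᵐᵒᵖ) (BaseObj S L (P.X j)) := Submodule.span _
      {y | ∃ s ∈ {s | ∃ r ∈ Ring.jacobson A, s = (1 : S) ⊗ₜ[k] op r},
        ∃ m : BaseObj S L (P.X j), y = s • m}
    change baseMap S L (P.d i j) x ∈ J
    induction x using bmk_induction with
    | hadd x y hx hy => rw [map_add]; exact J.add_mem hx hy
    | h m l =>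
      rw [baseMap_bmk]
      have h1 := hP.minimal i j m
      generalize (P.d i j) m = y at h1 ⊢
      induction h1 using Submodule.closure_induction with
      | zero => rw [bmk_zero_left]; exact J.zero_mem
      | add x y _ _ hx hy => rw [bmk_add_left]; exact J.add_mem hx hy
      | smul_mem q x hx =>
        obtain ⟨_, ⟨r, hr, rfl⟩, m', rfl⟩ := hx
        induction q using TensorProduct.induction_on with
        | zero => rw [bmk_zero_smul_left]; exact J.zero_mem
        | add q q' hq hq' => rw [add_smul, bmk_add_left]; exact J.add_mem hq hq'
        | tmul b a =>
          -- The factor `b` commutes past the radical element and is passed to `l`.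
          have h2 : bmk S ((b ⊗ₜ[k] a) • ((1 : B) ⊗ₜ[k] op r) • m') l =
              ((1 : S) ⊗ₜ[k] a) • ((1 : S) ⊗ₜ[k] op r) • bmk S m' (op b • l) := by
            rw [tmul_smul_bmk, tmul_smul_bmk, one_smul, one_smul, ← bmk_balanced, smul_smul,
              smul_smul, smul_smul]
            simp
          rw [h2]
          exact J.smul_mem _ (Submodule.subset_span ⟨_, ⟨r, hr, rfl⟩, _, rfl⟩)

end Projective

end BaseFamily

end

section

/-! ### Fibres at points -/

section Fiber

variable {k A S : Type u} [Field k] [Ring A] [Algebra k A] [CommRing S] [Algebra k S]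

/-- The field `k` as a right module over an algebra, through a point. -/
def PointModule (_x : S →+* k) : Type u := k

instance (x : S →+* k) : AddCommGroup (PointModule x) := inferInstanceAs (AddCommGroup k)

instance (x : S →+* k) : Module Sᵐᵒᵖ (PointModule x) :=
  Module.compHom k (x.fromOpposite fun _ _ => Commute.all _ _)

/-- The subgroup of a module generated by the multiples of functions vanishing at a point. -/
def vanishing (x : S →+* k) (M : Type u) [AddCommGroup M] [Module (S ⊗[k] Aᵐᵒᵖ) M] :
    AddSubgroup M :=
  AddSubgroup.closure {y | ∃ (s : S) (m : M), x s = 0 ∧ y = (s ⊗ₜ[k] (1 : Aᵐᵒᵖ)) • m}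

/-- The maps `u i` exhibit `D` as the fibre at `x` of the complex `Q`. -/
structure IsFiberMap (x : S →+* k) (Q : ChainComplex (ModuleCat.{u} (S ⊗[k] Aᵐᵒᵖ)) ℤ)
    (D : ChainComplex (ModuleCat.{u} Aᵐᵒᵖ) ℤ) (u : ∀ i, Q.X i →+ D.X i) : Prop where
  map_smul : ∀ i (s : S) (a : Aᵐᵒᵖ) (m : Q.X i), u i ((s ⊗ₜ[k] a) • m) = (x s • a) • u i m
  comm : ∀ i j (m : Q.X i), u j (Q.d i j m) = D.d i j (u i m)
  surj : ∀ i, Function.Surjective (u i)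
  ker_le : ∀ i (m : Q.X i), u i m = 0 → m ∈ vanishing (A := A) x (Q.X i)

/-- The complex `D` is the fibre at `x` of the complex `Q`. -/
def IsFiber (x : S →+* k) (Q : ChainComplex (ModuleCat.{u} (S ⊗[k] Aᵐᵒᵖ)) ℤ)
    (D : ChainComplex (ModuleCat.{u} Aᵐᵒᵖ) ℤ) : Prop :=
  ∃ u, IsFiberMap x Q D u

variable {x : S →+* k} {Q : ChainComplex (ModuleCat.{u} (S ⊗[k] Aᵐᵒᵖ)) ℤ}
  {D D' : ChainComplex (ModuleCat.{u} Aᵐᵒᵖ) ℤ}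

/-- Together with `ker_le` this makes the kernel of `u i` exactly `vanishing x (Q.X i)`, so the term
`D.X i` is the corresponding quotient. This is what allows fibres that are constructed in different
ways to be compared. -/
theorem IsFiberMap.vanishing_le {u : ∀ i, Q.X i →+ D.X i} (h : IsFiberMap x Q D u) (i : ℤ)
    {m : Q.X i} (hm : m ∈ vanishing (A := A) x (Q.X i)) : u i m = 0 := by
  induction hm using AddSubgroup.closure_induction with
  | mem y hy =>
    obtain ⟨s, m, hs, rfl⟩ := hy
    rw [h.map_smul, hs, zero_smul, zero_smul]
  | zero => exact map_zero _
  | add y z _ _ hy hz => rw [map_add, hy, hz, add_zero]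
  | neg y _ hy => rw [map_neg, hy, neg_zero]

theorem IsFiberMap.map_one_smul {u : ∀ i, Q.X i →+ D.X i} (h : IsFiberMap x Q D u) (i : ℤ)
    (a : Aᵐᵒᵖ) (m : Q.X i) : u i (((1 : S) ⊗ₜ[k] a) • m) = a • u i m := by
  rw [h.map_smul, map_one, one_smul]

/-- The comparison map between two fibres. -/
def IsFiberMap.lift {u : ∀ i, Q.X i →+ D.X i} {u' : ∀ i, Q.X i →+ D'.X i}
    (h : IsFiberMap x Q D u) (h' : IsFiberMap x Q D' u') (i : ℤ) : D.X i →ₗ[Aᵐᵒᵖ] D'.X i where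
  __ := (u i).liftOfSurjective (h.surj i)
    ⟨u' i, fun m hm => h'.vanishing_le i (h.ker_le i m hm)⟩
  map_smul' a y := by
    obtain ⟨m, rfl⟩ := h.surj i y
    let v := (u i).liftOfSurjective (h.surj i)
      ⟨u' i, fun m hm => h'.vanishing_le i (h.ker_le i m hm)⟩
    have hv : ∀ m, v (u i m) = u' i m := (u i).liftOfRightInverse_comp_apply _ _ _
    change v (a • u i m) = a • v (u i m)
    rw [← h.map_one_smul, hv, hv, h'.map_one_smul]

theorem IsFiberMap.lift_apply {u : ∀ i, Q.X i →+ D.X i} {u' : ∀ i, Q.X i →+ D'.X i}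
    (h : IsFiberMap x Q D u) (h' : IsFiberMap x Q D' u') (i : ℤ) (m : Q.X i) :
    h.lift h' i (u i m) = u' i m :=
  (u i).liftOfRightInverse_comp_apply _ (Function.rightInverse_surjInv (h.surj i)) _ m

/-- Fibres are unique up to isomorphism. -/
theorem IsFiber.unique (h : IsFiber x Q D) (h' : IsFiber x Q D') : Nonempty (D ≅ D') := by
  obtain ⟨u, h⟩ := h
  obtain ⟨u', h'⟩ := h'
  refine ⟨HomologicalComplex.Hom.isoOfComponents (fun i => LinearEquiv.toModuleIso
    (.ofLinearMap (h.lift h' i) (h'.lift h i) (LinearMap.ext fun y => ?_)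
      (LinearMap.ext fun y => ?_))) fun i j _ => ?_⟩
  · obtain ⟨m, rfl⟩ := h'.surj i y
    simp [IsFiberMap.lift_apply]
  · obtain ⟨m, rfl⟩ := h.surj i y
    simp [IsFiberMap.lift_apply]
  · ext y
    obtain ⟨m, rfl⟩ := h.surj i y
    change D'.d i j (h.lift h' i (u i m)) = h.lift h' j (D.d i j (u i m))
    rw [h.lift_apply, ← h.comm, ← h'.comm, h.lift_apply]

theorem IsFiber.of_iso (h : IsFiber x Q D) (e : D ≅ D') : IsFiber x Q D' := by
  obtain ⟨u, h⟩ := h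
  have hinv (i : ℤ) (y : D.X i) : e.inv.f i (e.hom.f i y) = y :=
    congrArg (fun f : D ⟶ D => f.f i y) e.hom_inv_id
  have hhom (i : ℤ) (y : D'.X i) : e.hom.f i (e.inv.f i y) = y :=
    congrArg (fun f : D' ⟶ D' => f.f i y) e.inv_hom_id
  refine ⟨fun i => (e.hom.f i).hom.toAddMonoidHom.comp (u i), fun i s a m => ?_,
    fun i j m => ?_, fun i y => ?_, fun i m hm => h.ker_le i m ?_⟩
  · exact (congrArg (e.hom.f i) (h.map_smul i s a m)).trans ((e.hom.f i).hom.map_smul _ _)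
  · change e.hom.f j (u j _) = D'.d i j (e.hom.f i (u i m))
    rw [h.comm]
    exact congrArg (fun f : D.X i ⟶ D'.X j => f (u i m)) (e.hom.comm i j).symm
  · obtain ⟨m, hm⟩ := h.surj i (e.inv.f i y)
    exact ⟨m, (congrArg (e.hom.f i) hm).trans (hhom i y)⟩
  · rw [← hinv i (u i m)]
    exact (congrArg (e.inv.f i) hm).trans (map_zero _)

/-- As `S` is commutative, `s ⊗ 1` is central in `S ⊗ Aᵐᵒᵖ`, so this subgroup is a submodule. -/
theorem vanishing_smul (M : Type u) [AddCommGroup M] [Module (S ⊗[k] Aᵐᵒᵖ) M]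
    {m : M} (r : S ⊗[k] Aᵐᵒᵖ) (hm : m ∈ vanishing (A := A) x M) :
    r • m ∈ vanishing (A := A) x M := by
  induction hm using AddSubgroup.closure_induction with
  | mem y hy =>
    obtain ⟨s, m, hs, rfl⟩ := hy
    refine AddSubgroup.subset_closure ⟨s, r • m, hs, ?_⟩
    rw [smul_smul, smul_smul]
    congr 1
    induction r using TensorProduct.induction_on with
    | zero => simp
    | add r r' h h' => rw [add_mul, mul_add, h, h']
    | tmul t a => simp [mul_comm]
  | zero => rw [smul_zero]; exact zero_mem _
  | add y z _ _ hy hz => rw [smul_add]; exact add_mem hy hz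
  | neg y _ hy => rw [smul_neg]; exact neg_mem hy

/-- The tensor product with the residue field is a fibre. -/
theorem isFiber_tensorComplex (hx : ∀ c, x (algebraMap k S c) = c)
    (Q : ChainComplex (ModuleCat.{u} (S ⊗[k] Aᵐᵒᵖ)) ℤ) :
    IsFiber x Q (tensorComplex (PointModule x) Q) := by
  let e : PointModule x := (1 : k)
  have hop (s : S) (c : PointModule x) : op s • c = (show PointModule x from x s * (show k from c)) := rfl
  -- A scalar in the residue field can be moved to the side of `A`, so every pure tensor has the
  -- form `m ⊗ 1`.
  have hmk {i : ℤ} (m : Q.X i) (c : k) :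
      tmk m (show PointModule x from c) = tmk (((1 : S) ⊗ₜ[k] algebraMap k Aᵐᵒᵖ c) • m) e := by
    rw [← algebraMap_tmul_one, tmk_balanced]
    congr 1
    rw [hop, hx]
    exact (mul_one c).symm
  let u (i : ℤ) : Q.X i →+ (tensorComplex (PointModule x) Q).X i :=
    AddMonoidHom.mk' (fun m => tmk m e) fun m m' => tmk_add_left m m' e
  refine ⟨u, fun i s a m => ?_, fun i j m => rfl, fun i y => ?_, fun i m hm => ?_⟩
  · change tmk _ e = (x s • a) • tmk m e
    have h1 : (s ⊗ₜ[k] a) = (s ⊗ₜ[k] (1 : Aᵐᵒᵖ)) * ((1 : S) ⊗ₜ[k] a) := by simp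
    have h2 : op s • e = (show PointModule x from x s) := by rw [hop]; exact mul_one (x s)
    rw [h1, mul_smul, tmk_balanced, h2, hmk, smul_tmk, smul_smul]
    congr 2
    simp [Algebra.smul_def]
  · induction y using tmk_induction with
    | h m c => exact ⟨_, (hmk m c).symm⟩
    | hadd y z hy hz =>
      obtain ⟨m, rfl⟩ := hy
      obtain ⟨m', rfl⟩ := hz
      exact ⟨m + m', map_add _ _ _⟩
  · let K := vanishing (A := A) x (Q.X i)
    have hK {m m' : Q.X i} (h : m - m' ∈ K) :
        QuotientAddGroup.mk' K m = QuotientAddGroup.mk' K m' := by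
      rw [← sub_eq_zero, ← map_sub]
      exact (QuotientAddGroup.eq_zero_iff _).2 h
    -- The map `m ⊗ c ↦ c m` from the tensor product to `Q_i / K` composes with `u i` to the
    -- quotient map; hence the kernel of `u i` lies in `K`.
    let φ₀ (m : Q.X i) : k →+ Q.X i ⧸ K := AddMonoidHom.mk'
      (fun c => QuotientAddGroup.mk' K (((1 : S) ⊗ₜ[k] algebraMap k Aᵐᵒᵖ c) • m))
      fun c c' => by rw [map_add, TensorProduct.tmul_add, add_smul, map_add]
    let φ : Q.X i →+ PointModule x →+ Q.X i ⧸ K := AddMonoidHom.mk' (fun m => φ₀ m)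
      fun m m' => AddMonoidHom.ext fun c => by
        change QuotientAddGroup.mk' K _ = QuotientAddGroup.mk' K _ + QuotientAddGroup.mk' K _
        rw [smul_add, map_add]
    have hφ (m : Q.X i) (c : k) : φ m c =
      QuotientAddGroup.mk' K (((1 : S) ⊗ₜ[k] algebraMap k Aᵐᵒᵖ c) • m) := rfl
    let ψ := tensorLift φ (by
      intro s m c
      change φ _ (show k from c) = φ m (x s * (show k from c) : k)
      generalize (show k from c) = c
      rw [hφ, hφ]
      apply hK
      rw [mul_comm, map_mul, ← one_mul (1 : S), ← Algebra.TensorProduct.tmul_mul_tmul, mul_smul,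
        one_mul, ← smul_sub, ← algebraMap_tmul_one (x s), ← sub_smul, ← TensorProduct.sub_tmul]
      refine vanishing_smul _ _ (AddSubgroup.subset_closure ⟨_, m, ?_, rfl⟩)
      rw [map_sub, hx, sub_self])
    have h1 : ψ (tmk m e) = 0 := (congrArg ψ hm).trans (map_zero ψ)
    have h2 : φ m (1 : k) = 0 := h1
    rw [hφ, map_one, ← Algebra.TensorProduct.one_def, one_smul] at h2
    exact (QuotientAddGroup.eq_zero_iff _).1 h2

variable {B L Lx : Type u} [Ring B] [Algebra k B] [AddCommGroup L] [Module Bᵐᵒᵖ L] [Module k L]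
  [IsScalarTower k Bᵐᵒᵖ L] [Module S L] [IsScalarTower k S L] [SMulCommClass S Bᵐᵒᵖ L]
  [AddCommGroup Lx] [Module Bᵐᵒᵖ Lx] [Module k Lx] [IsScalarTower k Bᵐᵒᵖ Lx]

/-- The fibre of `L ⊗_B P` is `L(x) ⊗_B P`, where `L(x)` is the fibre of `L`. -/
theorem isFiber_baseComplex (q : L →+ Lx) (hqs : ∀ (s : S) l, q (s • l) = x s • q l)
    (hqb : ∀ (b : Bᵐᵒᵖ) l, q (b • l) = b • q l) (hq : Function.Surjective q)
    (hker : ∀ l, q l = 0 → l ∈ AddSubgroup.closure {y | ∃ (s : S) (l : L), x s = 0 ∧ y = s • l})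
    (P : ChainComplex (ModuleCat.{u} (B ⊗[k] Aᵐᵒᵖ)) ℤ) :
    IsFiber x (baseComplex S L P) (tensorComplex Lx P) := by
  let qB : L →ₗ[Bᵐᵒᵖ] Lx := { q with map_smul' := hqb }
  let u (i : ℤ) : BaseObj S L (P.X i) →+ (tensorFunctor (k := k) (A := A) Lx).obj (P.X i) := tensorMapLAux (P.X i) qB
  have hu (i : ℤ) (m : P.X i) (l : L) : u i (bmk S m l) = tmk m (q l) := rfl
  refine ⟨u, fun i s a (z : BaseObj S L (P.X i)) => ?_, fun i j z => ?_, fun i y => ?_,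
    fun i z hz => ?_⟩
  · change u i ((s ⊗ₜ[k] a) • z) = (x s • a) • u i z
    induction z using bmk_induction with
    | h m l =>
      rw [tmul_smul_bmk, hu, hu, hqs, ← algebraMap_smul Bᵐᵒᵖ (x s) (q l)]
      refine (tmk_balanced (algebraMap k B (x s)) _ (q l)).symm.trans ?_
      rw [algebraMap_tmul_one, smul_smul, smul_tmk]
      congr 2
      simp [Algebra.smul_def]
    | hadd z z' hz hz' => rw [smul_add, map_add, hz, hz', map_add, smul_add]
  · let d : (tensorFunctor (k := k) (A := A) Lx).obj (P.X i) →+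
        (tensorFunctor (k := k) (A := A) Lx).obj (P.X j) :=
      ((tensorFunctor (k := k) (A := A) Lx).map (P.d i j)).hom.toAddMonoidHom
    have h1 (z : BaseObj S L (P.X i)) : u j (baseMap S L (P.d i j) z) = d (u i z) := by
      induction z using bmk_induction with
      | h m l => rfl
      | hadd z z' hz hz' => rw [map_add, map_add, hz, hz', map_add, map_add]
    exact h1 z
  · induction y using tmk_induction with
    | h m l =>
      obtain ⟨l, rfl⟩ := hq l
      exact ⟨bmk S m l, rfl⟩
    | hadd y z hy hz =>
      obtain ⟨m, rfl⟩ := hy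
      obtain ⟨m', rfl⟩ := hz
      exact ⟨m + m', map_add _ _ _⟩
  · let K := vanishing (A := A) x (BaseObj S L (P.X i))
    let β (m : P.X i) : L →+ BaseObj S L (P.X i) ⧸ K :=
      (QuotientAddGroup.mk' K).comp (tmkHom m)
    have hβ (m : P.X i) (l : L) : β m l = QuotientAddGroup.mk' K (bmk S m l) := rfl
    have hβk (m : P.X i) (l : L) (hl : q l = 0) : β m l = 0 := by
      have h1 := hker l hl
      clear hl
      induction h1 using AddSubgroup.closure_induction with
      | mem y hy =>
        obtain ⟨s, l, hs, rfl⟩ := hy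
        rw [hβ]
        refine (QuotientAddGroup.eq_zero_iff _).2 (AddSubgroup.subset_closure
          ⟨s, bmk S m l, hs, ?_⟩)
        rw [tmul_smul_bmk, ← Algebra.TensorProduct.one_def, one_smul]
      | zero => exact map_zero _
      | add y z _ _ hy hz => rw [map_add, hy, hz, add_zero]
      | neg y _ hy => rw [map_neg, hy, neg_zero]
    -- Since `l ↦ m ⊗ l` modulo `K` kills the kernel of `q`, it descends to `Lx`. The resulting map
    -- on `Lx ⊗_B P_i` composes with `u i` to the quotient map, which bounds the kernel.
    let γ (m : P.X i) : Lx →+ BaseObj S L (P.X i) ⧸ K := q.liftOfSurjective hq ⟨β m, hβk m⟩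
    have hγ (m : P.X i) (l : L) : γ m (q l) = QuotientAddGroup.mk' K (bmk S m l) :=
      q.liftOfRightInverse_comp_apply _ (Function.rightInverse_surjInv hq) ⟨β m, hβk m⟩ l
    let φ : P.X i →+ Lx →+ BaseObj S L (P.X i) ⧸ K := AddMonoidHom.mk' γ fun m m' =>
      AddMonoidHom.ext fun v => by
        obtain ⟨l, rfl⟩ := hq v
        rw [AddMonoidHom.add_apply, hγ, hγ, hγ, bmk_add_left, map_add]
    let ψ := tensorLift φ (by
      intro b m v
      obtain ⟨l, rfl⟩ := hq v
      change γ _ _ = γ _ _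
      rw [← hqb, hγ, hγ, bmk_balanced])
    have h1 (z : BaseObj S L (P.X i)) : ψ (u i z) = QuotientAddGroup.mk' K z := by
      induction z using bmk_induction with
      | h m l => exact hγ m l
      | hadd z z' hz hz' => rw [map_add, map_add, hz, hz', map_add]
    exact (QuotientAddGroup.eq_zero_iff _).1
      ((h1 z).symm.trans ((congrArg ψ hz).trans (map_zero ψ)))

end Fiber

end

section

/-! ### Points of varieties -/

namespace Variety

variable {k : Type u} [Field k] {V : Variety k}

theorem Point.eval_algebraMap (x : V.Point) {U : V.X.Opens} (hx : x.pt ∈ U) (c : k) :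
    x.eval hx (algebraMap k Γ(V.X, U) c) = c := by
  have h : ((Scheme.ΓSpecIso (.of k)).inv ≫ V.s.appLE ⊤ U le_top) ≫
      (x.1.appLE U ⊤ (x.le_preimage hx) ≫ (Scheme.ΓSpecIso (.of k)).hom) = 𝟙 _ := by
    have e := Scheme.Hom.appLE_comp_appLE x.1 V.s ⊤ U ⊤ le_top (x.le_preimage hx)
    have : ∀ (g : Spec (.of k) ⟶ Spec (.of k)) (hg : g = 𝟙 _) (e),
        (Scheme.ΓSpecIso (.of k)).inv ≫ g.appLE ⊤ ⊤ e ≫ (Scheme.ΓSpecIso (.of k)).hom = 𝟙 _ := by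
      rintro g rfl e
      have h1 : (𝟙 (Spec (CommRingCat.of k)) : _ ⟶ _).appLE ⊤ ⊤ e = 𝟙 _ := by
        simp only [Scheme.Hom.appLE, Scheme.Hom.id_app]
        exact (Category.id_comp _).trans ((Spec (CommRingCat.of k)).presheaf.map_id _)
      rw [h1]
      exact (congrArg _ (Category.id_comp _)).trans (Iso.inv_hom_id _)
    refine Eq.trans ?_ (this _ x.2 le_top)
    exact congrArg (fun φ => (Scheme.ΓSpecIso (.of k)).inv ≫ φ ≫ (Scheme.ΓSpecIso (.of k)).hom) e
  exact congrArg (fun φ => φ.hom c) h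

/-- Evaluation at a point as a homomorphism of algebras. -/
def Point.evalₐ (x : V.Point) {U : V.X.Opens} (hx : x.pt ∈ U) : Γ(V.X, U) →ₐ[k] k :=
  { x.eval hx with commutes' := x.eval_algebraMap hx }

theorem Point.eval_map (x : V.Point) {U W : V.X.Opens} (i : W ⟶ U) (hx : x.pt ∈ W)
    (f : Γ(V.X, U)) :
    x.eval hx (V.X.presheaf.map i.op f) = x.eval (i.le hx) f := by
  have h : V.X.presheaf.map i.op ≫ x.1.appLE W ⊤ (x.le_preimage hx) =
    x.1.appLE U ⊤ (x.le_preimage (i.le hx)) := Scheme.Hom.map_appLE _ _ _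
  exact congrArg (fun φ => (Scheme.ΓSpecIso (.of k)).hom (φ.hom f)) h

/-- In the one-point scheme `Spec k` the nonvanishing locus of the pulled back function is
everything or empty. This translates values at points into the topology of `X`. -/
theorem Point.eval_ne_zero_iff (x : V.Point) {U : V.X.Opens} (hx : x.pt ∈ U) (f : Γ(V.X, U)) :
    x.eval hx f ≠ 0 ↔ x.pt ∈ V.X.basicOpen f := by
  constructor
  · intro h
    have h1 : IsUnit (x.1.appLE U ⊤ (x.le_preimage hx) f) := by
      have : IsUnit ((Scheme.ΓSpecIso (.of k)).hom (x.1.appLE U ⊤ (x.le_preimage hx) f)) :=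
        isUnit_iff_ne_zero.2 h
      have h2 := this.map (Scheme.ΓSpecIso (.of k)).inv.hom
      rwa [← CommRingCat.comp_apply, Iso.hom_inv_id] at h2
    have h2 := Scheme.basicOpen_of_isUnit (X := Spec (.of k)) h1
    rw [Scheme.basicOpen_appLE] at h2
    have : IsLocalRing.closedPoint k ∈ (⊤ ⊓ x.1 ⁻¹ᵁ V.X.basicOpen f : (Spec (.of k)).Opens) := by
      rw [h2]; trivial
    exact this.2
  · intro h
    have h1 := (RingedSpace.isUnit_res_basicOpen V.X.toRingedSpace f).map (x.eval h)
    have h2 := x.eval_map (homOfLE (V.X.basicOpen_le f)) h f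
    intro h0
    have : x.eval h (V.X.presheaf.map (homOfLE (V.X.basicOpen_le f)).op f) = 0 := by
      rw [h2]; exact h0
    exact h1.ne_zero this

/-- The point is `Spec φ` followed by the inclusion of `U`; linearity of `φ` over `k` says that it
is a section of the structure morphism. -/
theorem exists_point_eval {U : V.X.Opens} (hU : IsAffineOpen U) (φ : Γ(V.X, U) →ₐ[k] k) :
    ∃ (x : V.Point) (hx : x.pt ∈ U), ∀ f, x.eval hx f = φ f := by
  let g : Spec (.of k) ⟶ V.X := Spec.map (CommRingCat.ofHom φ.toRingHom) ≫ hU.fromSpec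
  have hs : hU.fromSpec ≫ V.s = Spec.map ((Scheme.ΓSpecIso (.of k)).inv ≫
      V.s.appLE ⊤ U le_top) := by
    have := IsAffineOpen.SpecMap_appLE_fromSpec V.s (isAffineOpen_top (Spec (.of k))) hU le_top
    rw [← this, IsAffineOpen.fromSpec_top, Scheme.isoSpec_Spec_inv, Spec.map_comp]
  have hg : g ≫ V.s = 𝟙 _ := by
    rw [Category.assoc, hs, ← Spec.map_comp, ← Spec.map_id]
    congr 1
    ext c
    exact φ.commutes c
  let x : V.Point := ⟨g, hg⟩
  have hx : x.pt ∈ U := by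
    have : hU.fromSpec (Spec.map (CommRingCat.ofHom φ.toRingHom) (IsLocalRing.closedPoint k)) ∈
      (U : Set V.X) := by
      rw [← hU.range_fromSpec]; exact ⟨_, rfl⟩
    exact this
  refine ⟨x, hx, fun f => ?_⟩
  have h : g.appLE U ⊤ (x.le_preimage hx) ≫ (Scheme.ΓSpecIso (.of k)).hom =
      CommRingCat.ofHom φ.toRingHom := by
    have h1 : hU.fromSpec.appLE U ⊤ hU.fromSpec_preimage_self.ge = (Scheme.ΓSpecIso _).inv := by
      rw [Scheme.Hom.appLE, hU.fromSpec_app_self, Category.assoc, ← Functor.map_comp]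
      exact (congrArg _ ((Spec Γ(V.X, U)).presheaf.map_id _)).trans (Category.comp_id _)
    have h2 := Scheme.Hom.appLE_comp_appLE (Spec.map (CommRingCat.ofHom φ.toRingHom)) hU.fromSpec
      U ⊤ ⊤ hU.fromSpec_preimage_self.ge le_top
    rw [← h2, h1, Category.assoc]
    have h3 : (Spec.map (CommRingCat.ofHom φ.toRingHom)).appLE ⊤ ⊤ le_top =
      (Spec.map (CommRingCat.ofHom φ.toRingHom)).appTop := by
      rw [Scheme.Hom.appTop, Scheme.Hom.app_eq_appLE]; rfl
    rw [h3, Scheme.ΓSpecIso_naturality]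
    exact Iso.inv_hom_id_assoc _ _
  exact congrArg (fun φ => φ.hom f) h

theorem finiteType_sections {U : V.X.Opens} (hU : IsAffineOpen U) :
    Algebra.FiniteType k Γ(V.X, U) := by
  have := V.locallyOfFiniteType
  have h := Scheme.Hom.finiteType_appLE V.s (isAffineOpen_top (Spec (.of k))) hU le_top
  have h2 := h.comp (RingHom.FiniteType.of_surjective (Scheme.ΓSpecIso (.of k)).inv.hom
    (ConcreteCategory.bijective_of_isIso (Scheme.ΓSpecIso (.of k)).inv).2)
  exact h2

end Variety

/-! ### Sections of quasi-coherent modules -/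

section Quasicoherent

variable {X : Scheme.{u}} (M : X.Modules)

/-- A compatibility needed to turn the action of `Γ(X, U)` on a module pulled back to `Spec Γ(X, U)`
into its action through restriction of functions on `X`. -/
theorem fromSpec_appIso_inv {U : X.Opens} (hU : IsAffineOpen U) (W : (Spec Γ(X, U)).Opens)
    (hW : hU.fromSpec ''ᵁ W ≤ U) (r : Γ(X, U)) :
    (hU.fromSpec.appIso W).inv ((Spec Γ(X, U)).presheaf.map W.leTop.op
      ((Scheme.ΓSpecIso Γ(X, U)).inv r)) = X.presheaf.map (homOfLE hW).op r := by
  have h : hU.fromSpec.appLE U W (by rw [hU.fromSpec_preimage_self]; exact le_top) =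
      (Scheme.ΓSpecIso Γ(X, U)).inv ≫ (Spec Γ(X, U)).presheaf.map W.leTop.op := by
    rw [Scheme.Hom.appLE, hU.fromSpec_app_self, Category.assoc, ← Functor.map_comp]
    rfl
  have h2 := Scheme.Hom.appLE_appIso_inv hU.fromSpec (U := U) (V := W)
    (by rw [hU.fromSpec_preimage_self]; exact le_top)
  rw [h] at h2
  exact congrArg (fun φ => φ.hom r) h2

theorem presheaf_map_map {U₁ U₂ U₃ : X.Opens} (h : U₂ ≤ U₁) (h' : U₃ ≤ U₂) (m : Γ(M, U₁)) :
    M.presheaf.map (homOfLE h').op (M.presheaf.map (homOfLE h).op m) =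
      M.presheaf.map (homOfLE (h'.trans h)).op m := by
  rw [← ConcreteCategory.comp_apply, ← Functor.map_comp]
  rfl

theorem presheaf_map_self {U₁ : X.Opens} (h : U₁ ≤ U₁) (m : Γ(M, U₁)) :
    M.presheaf.map (homOfLE h).op m = m :=
  congrArg (fun φ => φ m) (M.presheaf.map_id (Opposite.op U₁))

theorem presheaf_map_smul {U₁ U₂ : X.Opens} (h : U₂ ≤ U₁) (r : Γ(X, U₁)) (m : Γ(M, U₁)) :
    M.presheaf.map (homOfLE h).op (r • m) =
      X.presheaf.map (homOfLE h).op r • M.presheaf.map (homOfLE h).op m :=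
  M.val.map_smul (homOfLE h).op r m

theorem sheaf_map_map {U₁ U₂ U₃ : X.Opens} (h : U₂ ≤ U₁) (h' : U₃ ≤ U₂) (m : Γ(X, U₁)) :
    X.presheaf.map (homOfLE h').op (X.presheaf.map (homOfLE h).op m) =
      X.presheaf.map (homOfLE (h'.trans h)).op m := by
  rw [← ConcreteCategory.comp_apply, ← Functor.map_comp]
  rfl

theorem restrict_fromSpec_smul {U : X.Opens} (hU : IsAffineOpen U) (W : (Spec Γ(X, U)).Opens)
    (hW : hU.fromSpec ''ᵁ W ≤ U) (r : Γ(X, U)) (m : Γ(M, hU.fromSpec ''ᵁ W)) :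
    (show Γ(M, hU.fromSpec ''ᵁ W) from (r • (show Γ(M.restrict hU.fromSpec, W) from m))) =
      X.presheaf.map (homOfLE hW).op r • m := by
  rw [← fromSpec_appIso_inv hU W hW r]
  rfl

variable [M.IsQuasicoherent] {U : X.Opens} (hU : IsAffineOpen U) (f : Γ(X, U))

-- The surjective half of `Γ(D(f), M) = Γ(U, M)_f`: pulled back to `Spec Γ(X, U)`, a quasi-coherent
-- module is the sheaf of its global sections, for which this localization property is known.
include hU in
theorem exists_pow_smul_eq_map (t : Γ(M, X.basicOpen f)) :
    ∃ (n : ℕ) (s : Γ(M, U)), X.presheaf.map (homOfLE (X.basicOpen_le f)).op (f ^ n) • t =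
      M.presheaf.map (homOfLE (X.basicOpen_le f)).op s := by
  have h1 : IsIso (M.restrict hU.fromSpec).fromTildeΓ := inferInstance
  have h2 := (isIso_fromTildeΓ_iff_isLocalizing _).1 h1 f
  have e : hU.fromSpec ''ᵁ PrimeSpectrum.basicOpen f = X.basicOpen f :=
    hU.fromSpec_image_basicOpen f
  have e' : hU.fromSpec ''ᵁ (⊤ : (Spec Γ(X, U)).Opens) = U := by
    rw [Scheme.Hom.image_top_eq_opensRange, hU.opensRange_fromSpec]
  obtain ⟨⟨s, ⟨_, n, rfl⟩⟩, hs⟩ := h2.surj (M.presheaf.map (homOfLE e.le).op t)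
  let s' : Γ(M, hU.fromSpec ''ᵁ (⊤ : (Spec Γ(X, U)).Opens)) := s
  have hs' : X.presheaf.map (homOfLE (e.le.trans (X.basicOpen_le f))).op (f ^ n) •
      M.presheaf.map (homOfLE e.le).op t =
      M.presheaf.map (homOfLE (e.le.trans ((X.basicOpen_le f).trans e'.ge))).op s' :=
    (restrict_fromSpec_smul M hU (PrimeSpectrum.basicOpen f) _ _ _).symm.trans hs
  refine ⟨n, M.presheaf.map (homOfLE e'.ge).op s', ?_⟩
  have h3 := congrArg (M.presheaf.map (homOfLE e.ge).op) hs'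
  rw [presheaf_map_smul, presheaf_map_map, presheaf_map_map, presheaf_map_self,
    sheaf_map_map] at h3
  rw [presheaf_map_map, h3]

-- The injective half of the same localization property.
include hU in
theorem exists_pow_smul_eq_zero (s : Γ(M, U))
    (h : M.presheaf.map (homOfLE (X.basicOpen_le f)).op s = 0) :
    ∃ n : ℕ, f ^ n • s = 0 := by
  have h1 : IsIso (M.restrict hU.fromSpec).fromTildeΓ := inferInstance
  have h2 := (isIso_fromTildeΓ_iff_isLocalizing _).1 h1 f
  have e : hU.fromSpec ''ᵁ PrimeSpectrum.basicOpen f = X.basicOpen f :=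
    hU.fromSpec_image_basicOpen f
  have e' : hU.fromSpec ''ᵁ (⊤ : (Spec Γ(X, U)).Opens) = U := by
    rw [Scheme.Hom.image_top_eq_opensRange, hU.opensRange_fromSpec]
  let s' : Γ(M, hU.fromSpec ''ᵁ (⊤ : (Spec Γ(X, U)).Opens)) := M.presheaf.map (homOfLE e'.le).op s
  have h3 : M.presheaf.map (homOfLE (e.le.trans ((X.basicOpen_le f).trans e'.ge))).op s' =
      M.presheaf.map (homOfLE (e.le.trans ((X.basicOpen_le f).trans e'.ge))).op 0 := by
    rw [presheaf_map_map, map_zero, ← presheaf_map_map M (X.basicOpen_le f) e.le, h, map_zero]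
  obtain ⟨⟨_, n, rfl⟩, hn⟩ := h2.exists_of_eq
    (x₁ := (show Γ(M.restrict hU.fromSpec, ⊤) from s')) (x₂ := 0) h3
  refine ⟨n, ?_⟩
  have h4 : X.presheaf.map (homOfLE e'.le).op (f ^ n) • s' = 0 :=
    (restrict_fromSpec_smul M hU ⊤ _ _ _).symm.trans (hn.trans (smul_zero _))
  have h5 := congrArg (M.presheaf.map (homOfLE e'.ge).op) h4
  rw [presheaf_map_smul, presheaf_map_map, presheaf_map_self, sheaf_map_map, map_zero] at h5
  rw [← h5]
  exact congrArg (· • s) (congrArg (fun φ => φ.hom (f ^ n)) (X.presheaf.map_id _)).symm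

end Quasicoherent

end

/-! ### Fibres and localization. -/

section

/-- Fibres do not change when functions are inverted which do not vanish at the point. -/
theorem IsFiber.of_localization {k A S S' : Type u} [Field k] [Ring A] [Algebra k A] [CommRing S]
    [Algebra k S] [CommRing S'] [Algebra k S'] {Q : ChainComplex (ModuleCat.{u} (S ⊗[k] Aᵐᵒᵖ)) ℤ}
    {Q' : ChainComplex (ModuleCat.{u} (S' ⊗[k] Aᵐᵒᵖ)) ℤ} {D : ChainComplex (ModuleCat.{u} Aᵐᵒᵖ) ℤ}
    {x : S →+* k} {x' : S' →+* k} (hD : IsFiber x' Q' D) (ρ : S →+* S') (f : S) (hf : x f ≠ 0)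
    (hx : ∀ c, x (algebraMap k S c) = c)
    (hρ : ∀ s, x' (ρ s) = x s) (hsurj : ∀ r : S', ∃ (n : ℕ) (s : S), r * ρ (f ^ n) = ρ s)
    (res : ∀ i, Q.X i →+ Q'.X i)
    (hres : ∀ i (s : S) (a : Aᵐᵒᵖ) (m : Q.X i),
      res i ((s ⊗ₜ[k] a) • m) = (ρ s ⊗ₜ[k] a) • res i m)
    (hd : ∀ i j (m : Q.X i), res j (Q.d i j m) = Q'.d i j (res i m))
    (hpow : ∀ i (t : Q'.X i), ∃ (n : ℕ) (s : Q.X i),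
      (ρ (f ^ n) ⊗ₜ[k] (1 : Aᵐᵒᵖ)) • t = res i s)
    (hzero : ∀ i (s : Q.X i), res i s = 0 → ∃ n : ℕ, ((f ^ n : S) ⊗ₜ[k] (1 : Aᵐᵒᵖ)) • s = 0) :
    IsFiber x Q D := by
  obtain ⟨u, hu⟩ := hD
  have hmul (s t : S) : (s ⊗ₜ[k] (1 : Aᵐᵒᵖ)) * (t ⊗ₜ[k] (1 : Aᵐᵒᵖ)) = (s * t) ⊗ₜ[k] 1 := by simp
  have hmul' (s t : S') : (s ⊗ₜ[k] (1 : Aᵐᵒᵖ)) * (t ⊗ₜ[k] (1 : Aᵐᵒᵖ)) = (s * t) ⊗ₜ[k] 1 := by simp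
  -- Multiplication by `f ^ n` is invertible modulo functions vanishing at `x`: with `c =
  -- f(x)^{-n}`, the function `1 - c f ^ n` vanishes there.
  have hcancel (i) (s : Q.X i) (n : ℕ)
      (h : ((f ^ n : S) ⊗ₜ[k] (1 : Aᵐᵒᵖ)) • s ∈ vanishing (A := A) x (Q.X i)) :
      s ∈ vanishing (A := A) x (Q.X i) := by
    let c : S := algebraMap k _ ((x f ^ n)⁻¹)
    have hc : x (1 - c * f ^ n) = 0 := by
      rw [map_sub, map_mul, map_one, hx, map_pow, inv_mul_cancel₀ (pow_ne_zero _ hf), sub_self]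
    have h1 : s = ((1 - c * f ^ n) ⊗ₜ[k] (1 : Aᵐᵒᵖ)) • s +
        (c ⊗ₜ[k] (1 : Aᵐᵒᵖ)) • (((f ^ n : S) ⊗ₜ[k] (1 : Aᵐᵒᵖ)) • s) := by
      rw [smul_smul, ← add_smul, hmul, ← TensorProduct.add_tmul, sub_add_cancel]
      exact (one_smul (S ⊗[k] Aᵐᵒᵖ) s).symm
    rw [h1]
    exact add_mem (AddSubgroup.subset_closure ⟨_, _, hc, rfl⟩) (vanishing_smul _ _ h)
  -- Clearing denominators, an element that vanishes at `x'` comes from one that vanishes at `x`, up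
  -- to a power of `f`.
  have hvan (i) (t : Q'.X i) (ht : t ∈ vanishing (A := A) x' (Q'.X i)) :
      ∃ (n : ℕ) (s : Q.X i), s ∈ vanishing (A := A) x (Q.X i) ∧
        (ρ (f ^ n) ⊗ₜ[k] (1 : Aᵐᵒᵖ)) • t = res i s := by
    induction ht using AddSubgroup.closure_induction with
    | mem y hy =>
      obtain ⟨r, m, hr, rfl⟩ := hy
      obtain ⟨n, s, hs⟩ := hpow i m
      obtain ⟨l, r', hr'⟩ := hsurj r
      refine ⟨l + n, (r' ⊗ₜ[k] (1 : Aᵐᵒᵖ)) • s, AddSubgroup.subset_closure ⟨r', s, ?_, rfl⟩, ?_⟩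
      · rw [← hρ, ← hr', map_mul, hr, zero_mul]
      · rw [hres, ← hs, smul_smul, smul_smul, hmul', hmul', ← hr', pow_add, map_mul]
        congr 2
        ring
    | zero => exact ⟨0, 0, zero_mem _, by rw [map_zero, smul_zero]⟩
    | add y z _ _ hy hz =>
      obtain ⟨n, s, hs, h⟩ := hy
      obtain ⟨n', s', hs', h'⟩ := hz
      refine ⟨n + n', ((f ^ n' : S) ⊗ₜ[k] (1 : Aᵐᵒᵖ)) • s + ((f ^ n : S) ⊗ₜ[k] (1 : Aᵐᵒᵖ)) • s',
        add_mem (vanishing_smul _ _ hs) (vanishing_smul _ _ hs'), ?_⟩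
      rw [map_add, hres, hres, ← h, ← h', smul_smul, smul_smul, hmul', hmul', smul_add,
        ← map_mul, ← map_mul, ← pow_add, ← pow_add, add_comm n']
    | neg y _ hy =>
      obtain ⟨n, s, hs, h⟩ := hy
      exact ⟨n, -s, neg_mem hs, by rw [map_neg, ← h, smul_neg]⟩
  refine ⟨fun i => (u i).comp (res i), fun i r a m => ?_, fun i j m => ?_, fun i y => ?_,
    fun i m hm => ?_⟩
  · change u i (res i _) = _ • u i (res i m)
    rw [hres, hu.map_smul, hρ]
  · change u j (res j _) = D.d i j (u i (res i m))
    rw [hd, hu.comm]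
  · obtain ⟨t, rfl⟩ := hu.surj i y
    obtain ⟨n, s, hs⟩ := hpow i t
    refine ⟨((algebraMap k S ((x f ^ n)⁻¹)) ⊗ₜ[k] (1 : Aᵐᵒᵖ)) • s, ?_⟩
    change u i (res i _) = _
    rw [hres, ← hs, smul_smul, hmul', ← map_mul, hu.map_smul, hρ, map_mul, hx, map_pow,
      inv_mul_cancel₀ (pow_ne_zero _ hf), one_smul, one_smul]
  · obtain ⟨n, s, hs, h⟩ := hvan i _ (hu.ker_le i (res i m) hm)
    have h1 : res i (((f ^ n : S) ⊗ₜ[k] (1 : Aᵐᵒᵖ)) • m - s) = 0 := by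
      rw [map_sub, hres, h, sub_self]
    obtain ⟨l, hl⟩ := hzero i _ h1
    refine hcancel i m (l + n) ?_
    rw [smul_sub, sub_eq_zero, smul_smul, hmul, ← pow_add] at hl
    rw [hl]
    exact vanishing_smul _ _ hs

/-! ### Fibres of families over varieties -/

section VarietyFiber

variable {k A : Type u} [Field k] [Ring A] [Algebra k A] {V : Variety k}

namespace ModuleComplex

variable (P : ModuleComplex k A V)

theorem tmul_smul_sec {U : V.X.Opens} {i : ℤ} (r : Γ(V.X, U)) (a : Aᵐᵒᵖ) (m : P.Sec U i) :
    (r ⊗ₜ[k] a) • m = r • P.actSec U i a m := by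
  exact congrArg (fun φ : Module.End k (P.Sec U i) => φ m)
    (Algebra.TensorProduct.lift_tmul (Algebra.lsmul k k (P.Sec U i)) (P.actSecHom U i)
      (fun f a => by ext m; exact ((P.actSec U i a).map_smul f m).symm) r a)

theorem tmul_one_smul_sec {U : V.X.Opens} {i : ℤ} (r : Γ(V.X, U)) (m : P.Sec U i) :
    (r ⊗ₜ[k] (1 : Aᵐᵒᵖ)) • m = r • m := by
  rw [tmul_smul_sec]
  exact congrArg (r • ·) (congrArg (fun φ => φ m) (map_one (P.actSecHom U i)))

/-- Restriction of sections. -/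
def resSec {U W : V.X.Opens} (h : W ≤ U) (i : ℤ) : P.Sec U i →+ P.Sec W i :=
  ((P.K.X i).presheaf.map (homOfLE h).op).hom

variable {U W : V.X.Opens} (h : W ≤ U)

theorem resSec_smul (i : ℤ) (r : Γ(V.X, U)) (m : P.Sec U i) :
    P.resSec h i (r • m) = V.X.presheaf.map (homOfLE h).op r • P.resSec h i m :=
  presheaf_map_smul _ h r m

theorem resSec_act (i : ℤ) (a : Aᵐᵒᵖ) (m : P.Sec U i) :
    P.resSec h i (P.actSec U i a m) = P.actSec W i a (P.resSec h i m) :=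
  congrArg (fun φ => φ m) (((P.act a).f i).mapPresheaf.naturality (homOfLE h).op).symm

theorem resSec_d (i j : ℤ) (m : P.Sec U i) :
    P.resSec h j (P.dSecHom U i j m) = P.dSecHom W i j (P.resSec h i m) :=
  congrArg (fun φ => φ m) ((P.K.d i j).mapPresheaf.naturality (homOfLE h).op).symm

end ModuleComplex

variable (P : VarietyFamily k A V) (x : V.Point)

/-- By quasi-coherence the sections over `D(f)` are the localization at `f` of those over `U`, and
`f` does not vanish at `x`. -/
theorem VarietyFamily.isFiber_of_basicOpen {U : V.X.Opens} (hU : IsAffineOpen U) (f : Γ(V.X, U))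
    {W : V.X.Opens} (hW : W = V.X.basicOpen f) (hxW : x.pt ∈ W) (hxU : x.pt ∈ U)
    {D : ChainComplex (ModuleCat.{u} Aᵐᵒᵖ) ℤ}
    (hD : IsFiber (x.eval hxW) (P.sections W) D) : IsFiber (x.eval hxU) (P.sections U) D := by
  subst hW
  have hle : V.X.basicOpen f ≤ U := V.X.basicOpen_le f
  have hqc (i : ℤ) : (P.K.X i).IsQuasicoherent := P.quasicoherent i
  have := hU.isLocalization_basicOpen f
  refine hD.of_localization (V.X.presheaf.map (homOfLE hle).op).hom f
    ((x.eval_ne_zero_iff hxU f).2 hxW) (x.eval_algebraMap hxU)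
    (fun r => x.eval_map (homOfLE hle) hxW r) (fun r => ?_)
    (fun i => P.resSec hle i) (fun i r a m => ?_) (fun i j m => P.resSec_d hle i j m)
    (fun i t => ?_) (fun i s h => ?_)
  · obtain ⟨⟨r', ⟨_, l, rfl⟩⟩, hr'⟩ := IsLocalization.surj (Submonoid.powers f) r
    exact ⟨l, r', hr'⟩
  · refine (congrArg (P.resSec hle i) (P.tmul_smul_sec r a m)).trans ?_
    refine (P.resSec_smul hle i r _).trans ?_
    exact (congrArg _ (P.resSec_act hle i a m)).trans (P.tmul_smul_sec _ a _).symm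
  · obtain ⟨n, s, h⟩ := exists_pow_smul_eq_map (P.K.X i) hU f t
    exact ⟨n, s, (P.tmul_one_smul_sec _ _).trans h⟩
  · obtain ⟨n, h⟩ := exists_pow_smul_eq_zero (P.K.X i) hU f s h
    exact ⟨n, (P.tmul_one_smul_sec _ _).trans h⟩

/-- The fibre of a family can be computed on any affine neighbourhood. -/
theorem VarietyFamily.isFiber_fiber {U : V.X.Opens} (hU : IsAffineOpen U) (hxU : x.pt ∈ U) :
    IsFiber (x.eval hxU) (P.sections U) (P.fiber x) := by
  have hC : IsAffineOpen (P.chart x) := (P.exists_chart x.pt).choose_spec.1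
  -- A neighbourhood of `x` which is basic open both in `U` and in the chart mediates between the
  -- two.
  obtain ⟨f, g, hfg, hx⟩ := exists_basicOpen_le_affine_inter hU hC x.pt ⟨hxU, P.mem_chart x⟩
  have hxW : x.pt ∈ V.X.basicOpen f := hx
  have h1 : IsFiber (x.eval hxW) (P.sections (V.X.basicOpen f))
      (tensorComplex (PointModule (x.eval hxW)) (P.sections (V.X.basicOpen f))) :=
    isFiber_tensorComplex (x.eval_algebraMap hxW) _
  have h2 := P.isFiber_of_basicOpen x hC g hfg hxW (P.mem_chart x) h1
  have h3 : IsFiber (x.eval (P.mem_chart x)) (P.sections (P.chart x)) (P.fiber x) :=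
    isFiber_tensorComplex (x.eval_algebraMap (P.mem_chart x)) _
  obtain ⟨e⟩ := h2.unique h3
  exact (P.isFiber_of_basicOpen x hU f rfl hxW hxU h1).of_iso e

end VarietyFiber

end

section

/-! ### Families over affine varieties -/

theorem localizedModule_map_smul {R M : Type u} [CommRing R] [AddCommGroup M] [Module R M]
    (S : Submonoid R) (r : R) (f : M →ₗ[R] M) (hf : f = r • LinearMap.id) (m : LocalizedModule S M) :
    LocalizedModule.map S f m = (algebraMap R (Localization S) r) • m := by
  subst hf
  induction m using LocalizedModule.induction_on with | h m s =>
  simp [LocalizedModule.smul'_mk]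

theorem tilde_map_smul {R : CommRingCat.{u}} {M : ModuleCat.{u} R} (r : R) (f : M ⟶ M)
    (hf : ∀ m, f m = r • m) (U : (Spec R).Opens) (m : Γ(tilde M, U)) :
    (tilde.map f).app U m = r • m := by
  have hf' : f.hom = r • LinearMap.id := LinearMap.ext hf
  refine Subtype.ext (funext fun y => ?_)
  let p : PrimeSpectrum R := y.1
  exact localizedModule_map_smul p.asIdeal.primeCompl r f.hom hf' (m.1 y)

theorem tilde_functor_additive (R : CommRingCat.{u}) : (tilde.functor R).Additive := inferInstance

theorem tilde_toOpen_bijective {R : CommRingCat.{u}} (M : ModuleCat.{u} R) :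
    Function.Bijective (tilde.toOpen M ⊤) :=
  ConcreteCategory.bijective_of_isIso (tilde.toOpen M ⊤)

theorem presheaf_map_leTop (X : Scheme.{u}) (r : Γ(X, ⊤)) :
    X.presheaf.map (TopologicalSpace.Opens.leTop (⊤ : X.Opens)).op r = r :=
  congrArg (fun φ => φ.hom r) (X.presheaf.map_id (Opposite.op ⊤))

theorem tilde_toOpen_smul {R : CommRingCat.{u}} (M : ModuleCat.{u} R) (r : R) (m : M) :
    (show Γ(tilde M, ⊤) from tilde.toOpen M ⊤ (r • m)) =
      (Scheme.ΓSpecIso R).inv r • (show Γ(tilde M, ⊤) from tilde.toOpen M ⊤ m) := by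
  refine ((tilde.toOpen M ⊤).hom.map_smul r m).trans ?_
  exact congrArg (fun z : Γ(Spec R, ⊤) => z • (show Γ(tilde M, ⊤) from tilde.toOpen M ⊤ m))
    (presheaf_map_leTop (Spec R) ((Scheme.ΓSpecIso R).inv r))

/-- Transport along semilinear isomorphisms. It is applied to `S ≃ Γ(Spec S, ⊤)`, tensored with
`Aᵐᵒᵖ`, and to `k ⊗ Aᵐᵒᵖ ≃ Aᵐᵒᵖ`. -/
theorem IsMinimalOver.of_ringEquiv {R R' : Type u} [Ring R] [Ring R'] (ψ : R ≃+* R') {J : Set R}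
    {J' : Set R'} (hJ : ∀ r ∈ J, ψ r ∈ J') {C : ChainComplex (ModuleCat.{u} R) ℤ}
    {C' : ChainComplex (ModuleCat.{u} R') ℤ} (e : ∀ i, C.X i ≃+ C'.X i)
    (he : ∀ i r (m : C.X i), e i (r • m) = ψ r • e i m)
    (hd : ∀ i j (m : C.X i), e j (C.d i j m) = C'.d i j (e i m)) (hC : IsMinimalOver J C) :
    IsMinimalOver J' C' := by
  have h1 : RingHomInvPair (ψ : R →+* R') (ψ.symm : R' →+* R) := RingHomInvPair.of_ringEquiv ψ
  have h2 : RingHomInvPair (ψ.symm : R' →+* R) (ψ : R →+* R') :=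
    RingHomInvPair.of_ringEquiv ψ.symm
  let E (i) : C.X i ≃ₛₗ[(ψ : R →+* R')] C'.X i := { e i with map_smul' := he i }
  refine ⟨?_, fun i => ?_, fun i => ?_, fun i j x => ?_⟩
  · obtain ⟨m, n, h⟩ := hC.bounded
    refine ⟨m, n, fun i hi => ?_⟩
    have := ModuleCat.subsingleton_of_isZero (h i hi)
    have : Subsingleton (C'.X i) := (e i).symm.toEquiv.subsingleton
    exact ModuleCat.isZero_of_subsingleton _
  · have := hC.finite i
    exact Module.Finite.of_surjective (E i).toLinearMap (e i).surjective
  · have := hC.projective i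
    exact Module.Projective.of_equiv (E i)
  · obtain ⟨y, rfl⟩ := (e i).surjective x
    rw [← hd]
    have h3 := hC.minimal i j y
    generalize C.d i j y = z at h3
    induction h3 using Submodule.span_induction with
    | mem z hz =>
      obtain ⟨s, hs, m, rfl⟩ := hz
      exact Submodule.subset_span ⟨ψ s, hJ s hs, e j m, he j s m⟩
    | zero => rw [map_zero]; exact zero_mem _
    | add z w _ _ hz hw => rw [map_add]; exact add_mem hz hw
    | smul r z _ hz => rw [he]; exact Submodule.smul_mem _ _ hz

section Affine

variable {k A : Type u} [Field k] [Ring A] [Algebra k A]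

/-- The spectrum of a reduced finitely generated algebra as a variety. -/
def affineVariety (k S : Type u) [Field k] [CommRing S] [Algebra k S] [Algebra.FiniteType k S]
    [_root_.IsReduced S] : Variety k where
  X := Spec (.of S)
  s := Spec.map (CommRingCat.ofHom (algebraMap k S))
  reduced := inferInstance
  separated := inferInstance
  locallyOfFiniteType := (HasRingHomProperty.Spec_iff (P := @LocallyOfFiniteType)).2
    ((RingHom.finiteType_algebraMap).2 inferInstance)
  quasiCompact := inferInstance

variable {S : Type u} [CommRing S] [Algebra k S]

/-- The functor from bimodules to quasi-coherent sheaves. -/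
def tildeFunctor (k A S : Type u) [Field k] [Ring A] [Algebra k A] [CommRing S] [Algebra k S] :
    ModuleCat.{u} (S ⊗[k] Aᵐᵒᵖ) ⥤ (Spec (.of S)).Modules :=
  ModuleCat.restrictScalars (Algebra.TensorProduct.includeLeft : S →ₐ[k] S ⊗[k] Aᵐᵒᵖ).toRingHom ⋙
    tilde.functor (.of S)

instance : (tildeFunctor k A S).Additive := by
  have h := tilde_functor_additive (.of S)
  exact ⟨fun {M N f g} => (congrArg (tilde.functor (.of S)).map (Functor.map_add _)).trans h.map_add⟩

/-- The `S`-module underlying a bimodule. -/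
abbrev toLeft (M : ModuleCat.{u} (S ⊗[k] Aᵐᵒᵖ)) : ModuleCat.{u} S :=
  (ModuleCat.restrictScalars
    (Algebra.TensorProduct.includeLeft : S →ₐ[k] S ⊗[k] Aᵐᵒᵖ).toRingHom).obj M

/-- The action of `a ∈ A` on the underlying `S`-module of a bimodule. -/
def rightMul (M : ModuleCat.{u} (S ⊗[k] Aᵐᵒᵖ)) (a : Aᵐᵒᵖ) : toLeft M ⟶ toLeft M :=
  ModuleCat.ofHom (X := toLeft M) (Y := toLeft M)
    { toFun := fun m => (((1 : S) ⊗ₜ[k] a) • (show M from m) : M)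
      map_add' := fun m n => smul_add ((1 : S) ⊗ₜ[k] a) (show M from m) (show M from n)
      map_smul' := fun s m => by
        change ((1 : S) ⊗ₜ[k] a) • (s ⊗ₜ[k] (1 : Aᵐᵒᵖ)) • (show M from m) =
          (s ⊗ₜ[k] (1 : Aᵐᵒᵖ)) • ((1 : S) ⊗ₜ[k] a) • (show M from m)
        rw [smul_smul, smul_smul]
        simp }

theorem rightMul_hom {M N : ModuleCat.{u} (S ⊗[k] Aᵐᵒᵖ)} (f : M ⟶ N) (a : Aᵐᵒᵖ) :
    (ModuleCat.restrictScalars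
      (Algebra.TensorProduct.includeLeft : S →ₐ[k] S ⊗[k] Aᵐᵒᵖ).toRingHom).map f ≫ rightMul N a =
    rightMul M a ≫ (ModuleCat.restrictScalars
      (Algebra.TensorProduct.includeLeft : S →ₐ[k] S ⊗[k] Aᵐᵒᵖ).toRingHom).map f := by
  ext m
  exact (f.hom.map_smul ((1 : S) ⊗ₜ[k] a) m).symm

variable (Q : ChainComplex (ModuleCat.{u} (S ⊗[k] Aᵐᵒᵖ)) ℤ)

/-- The action of `a ∈ A` on the complex of sheaves given by a complex of bimodules. -/
def tildeAct (a : Aᵐᵒᵖ) : End (((tildeFunctor k A S).mapHomologicalComplex _).obj Q) :=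
  { f := fun i => (tilde.functor (.of S)).map (rightMul (Q.X i) a)
    comm' := fun i j _ => by
      have h := congrArg (tilde.functor (.of S)).map (rightMul_hom (Q.d i j) a)
      rw [Functor.map_comp, Functor.map_comp] at h
      exact h.symm }

/-- The action of `A` on the complex of sheaves given by a complex of bimodules. -/
def tildeActHom : Aᵐᵒᵖ →+* End (((tildeFunctor k A S).mapHomologicalComplex _).obj Q) where
  toFun := tildeAct Q
  map_one' := by
    refine HomologicalComplex.hom_ext _ _ fun i => ?_
    refine Eq.trans (congrArg (tilde.functor (.of S)).map ?_) ((tilde.functor (.of S)).map_id _)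
    ext m
    exact one_smul (S ⊗[k] Aᵐᵒᵖ) (show Q.X i from m)
  map_mul' := fun a b => by
    refine HomologicalComplex.hom_ext _ _ fun i => ?_
    refine Eq.trans (congrArg (tilde.functor (.of S)).map ?_)
      ((tilde.functor (.of S)).map_comp _ _)
    ext m
    refine Eq.trans ?_ (mul_smul ((1 : S) ⊗ₜ[k] a) ((1 : S) ⊗ₜ[k] b) (show Q.X i from m))
    refine congrArg (fun z : S ⊗[k] Aᵐᵒᵖ => z • (show Q.X i from m)) ?_
    rw [Algebra.TensorProduct.tmul_mul_tmul, one_mul]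
  map_zero' := by
    have h := tilde_functor_additive (.of S)
    refine HomologicalComplex.hom_ext _ _ fun i => ?_
    refine Eq.trans (congrArg (tilde.functor (.of S)).map ?_) ((tilde.functor (.of S)).map_zero _ _)
    ext m
    refine Eq.trans (congrArg (fun z : S ⊗[k] Aᵐᵒᵖ => z • (show Q.X i from m)) ?_)
      (zero_smul (S ⊗[k] Aᵐᵒᵖ) (show Q.X i from m))
    exact TensorProduct.tmul_zero _ _
  map_add' := fun a b => by
    have h := tilde_functor_additive (.of S)
    refine HomologicalComplex.hom_ext _ _ fun i => ?_
    refine Eq.trans (congrArg (tilde.functor (.of S)).map ?_) h.map_add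
    ext m
    refine Eq.trans (congrArg (fun z : S ⊗[k] Aᵐᵒᵖ => z • (show Q.X i from m)) ?_)
      (add_smul ((1 : S) ⊗ₜ[k] a) ((1 : S) ⊗ₜ[k] b) (show Q.X i from m))
    exact TensorProduct.tmul_add _ _ _

variable [Algebra.FiniteType k S] [_root_.IsReduced S]

theorem algebraMap_affineVariety (U : (affineVariety k S).X.Opens) (c : k) :
    algebraMap k Γ((affineVariety k S).X, U) c =
      ((Spec (.of S)).presheaf.map U.leTop.op)
        ((Scheme.ΓSpecIso (.of S)).inv (algebraMap k S c)) := by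
  have h := Scheme.ΓSpecIso_inv_naturality (CommRingCat.ofHom (algebraMap k S))
  have h2 := congrArg (· ≫ (Spec (.of S)).presheaf.map U.leTop.op) h
  exact (congrArg (fun φ => φ.hom c) h2).symm

/-- The complex of sheaves on an affine variety given by a complex of bimodules. -/
def tildeComplex : ModuleComplex k A (affineVariety k S) where
  K := ((tildeFunctor k A S).mapHomologicalComplex _).obj Q
  act := tildeActHom Q
  act_algebraMap c i U m := by
    refine (tilde_map_smul (R := .of S) (algebraMap k S c) (rightMul (Q.X i) _)
      (fun m => ?_) U m).trans ?_
    · change ((1 : S) ⊗ₜ[k] algebraMap k Aᵐᵒᵖ c) • (show Q.X i from m) =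
        (algebraMap k S c ⊗ₜ[k] (1 : Aᵐᵒᵖ)) • (show Q.X i from m)
      rw [Algebra.algebraMap_eq_smul_one, Algebra.algebraMap_eq_smul_one, TensorProduct.smul_tmul]
    · rw [algebraMap_affineVariety]
      rfl

/-- Elements of bimodules as global sections of the associated sheaves. -/
def tildeTop (i : ℤ) : Q.X i ≃+ (tildeComplex Q).Sec ⊤ i :=
  AddEquiv.ofBijective (tilde.toOpen (R := .of S) (toLeft (Q.X i)) ⊤).hom.toAddMonoidHom
    (tilde_toOpen_bijective (R := .of S) (toLeft (Q.X i)))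

/-- The global functions on an affine variety. -/
def affineTop : S ≃ₐ[k] Γ((affineVariety k S).X, ⊤) :=
  AlgEquiv.ofRingEquiv (f := (Scheme.ΓSpecIso (.of S)).symm.commRingCatIsoToRingEquiv) fun c => by
    rw [algebraMap_affineVariety]
    exact (presheaf_map_leTop (Spec (.of S)) _).symm

theorem tildeTop_smul (i : ℤ) (s : S) (a : Aᵐᵒᵖ) (m : Q.X i) :
    tildeTop Q i ((s ⊗ₜ[k] a) • m) = (affineTop (k := k) s ⊗ₜ[k] a) • tildeTop Q i m := by
  have h1 : (s ⊗ₜ[k] a) • m = (s ⊗ₜ[k] (1 : Aᵐᵒᵖ)) • ((1 : S) ⊗ₜ[k] a) • m := by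
    rw [smul_smul, Algebra.TensorProduct.tmul_mul_tmul, one_mul, mul_one]
  have h2 : tildeTop Q i (((1 : S) ⊗ₜ[k] a) • m) =
      (tildeComplex Q).actSec ⊤ i a (tildeTop Q i m) :=
    (congrArg (fun φ => φ.hom m) (tilde.toOpen_map_app (R := .of S) (rightMul (Q.X i) a) ⊤)).symm
  have h3 (n : Q.X i) : tildeTop Q i ((s ⊗ₜ[k] (1 : Aᵐᵒᵖ)) • n) =
      affineTop (k := k) s • tildeTop Q i n :=
    tilde_toOpen_smul (R := .of S) (toLeft (Q.X i)) s n
  rw [h1, h3, h2]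
  exact ((tildeComplex Q).tmul_smul_sec _ _ _).symm

theorem tildeTop_d (i j : ℤ) (m : Q.X i) :
    tildeTop Q j (Q.d i j m) = (tildeComplex Q).dSec ⊤ i j (tildeTop Q i m) :=
  (congrArg (fun φ => φ.hom m) (tilde.toOpen_map_app (R := .of S)
    ((ModuleCat.restrictScalars (Algebra.TensorProduct.includeLeft :
      S →ₐ[k] S ⊗[k] Aᵐᵒᵖ).toRingHom).map (Q.d i j)) ⊤)).symm

variable {Q}

/-- The family over an affine variety given by a minimal family of complexes. -/
def tildeFamily (hQ : IsMinimalFamily k S A Q) : VarietyFamily k A (affineVariety k S) where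
  toModuleComplex := tildeComplex Q
  bounded := by
    obtain ⟨m, n, h⟩ := hQ.bounded
    exact ⟨m, n, fun i hi => (tildeFunctor k A S).map_isZero (h i hi)⟩
  quasicoherent i := inferInstanceAs
    (tilde (R := .of S) (toLeft (Q.X i))).IsQuasicoherent
  exists_chart x := by
    have : IsAffine (affineVariety k S).X := inferInstanceAs (IsAffine (Spec (.of S)))
    refine ⟨⊤, isAffineOpen_top _, trivial, ?_⟩
    refine IsMinimalOver.of_ringEquiv
      (Algebra.TensorProduct.congr (affineTop (k := k) (S := S))
        (AlgEquiv.refl : Aᵐᵒᵖ ≃ₐ[k] Aᵐᵒᵖ)).toRingEquiv ?_ (tildeTop Q) ?_ (tildeTop_d Q) hQ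
    · rintro _ ⟨r, hr, rfl⟩
      refine ⟨r, hr, ?_⟩
      change Algebra.TensorProduct.congr _ _ _ = _
      simp
    · intro i r m
      let e : Q.X i →+ ((tildeComplex Q).sections ⊤).X i := (tildeTop Q i).toAddMonoidHom
      change e _ = _ • e m
      induction r using TensorProduct.induction_on with
      | zero => rw [zero_smul, map_zero, map_zero, zero_smul]
      | add r r' h h' => rw [add_smul, map_add, map_add, add_smul, h, h']
      | tmul s a => exact tildeTop_smul Q i s a m

/-- The point of the algebra given by a point of its spectrum. -/
def affinePoint (x : (affineVariety k S).Point) : S →ₐ[k] k :=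
  (x.evalₐ (U := ⊤) trivial).comp (affineTop (k := k) (S := S)).toAlgHom

/-- Global sections over `Spec S` give back `Q`, up to the isomorphism `S ≃ Γ(Spec S, ⊤)`; this is
the comparison for a localization with `f = 1`. -/
theorem isFiber_tildeFamily (hQ : IsMinimalFamily k S A Q) (x : (affineVariety k S).Point) :
    IsFiber (affinePoint x).toRingHom Q ((tildeFamily hQ).fiber x) := by
  have : IsAffine (affineVariety k S).X := inferInstanceAs (IsAffine (Spec (.of S)))
  have h := (tildeFamily hQ).isFiber_fiber x (isAffineOpen_top _) trivial
  have hp : ∀ s, x.eval (U := ⊤) trivial (affineTop (k := k) s) = affinePoint x s := fun s => rfl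
  refine h.of_localization (affineTop (k := k) (S := S)).toRingHom 1 ?_ (affinePoint x).commutes hp
    (fun r => ?_) (fun i => (tildeTop Q i).toAddMonoidHom) (tildeTop_smul Q) (tildeTop_d Q)
    (fun i t => ?_) fun i s h => ⟨0, ?_⟩
  · rw [map_one]; exact one_ne_zero
  · refine ⟨0, (affineTop (k := k)).symm r, ?_⟩
    rw [pow_zero, map_one, mul_one]
    exact ((affineTop (k := k)).apply_symm_apply r).symm
  · refine ⟨0, (tildeTop Q i).symm t, ?_⟩
    rw [pow_zero, map_one]
    refine (one_smul (Γ((affineVariety k S).X, ⊤) ⊗[k] Aᵐᵒᵖ) t).trans ?_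
    exact ((tildeTop Q i).apply_symm_apply t).symm
  · rw [(tildeTop Q i).map_eq_zero_iff.1 h, smul_zero]

end Affine

end

section

/-! ### Complexes given by matrices -/

open Matrix

/-- Matrices which describe a bounded complex of modules: idempotents, differentials and the
action of `A`. -/
structure MatData (A S : Type u) where
  I : ℤ → Type
  [fintype : ∀ i, Fintype (I i)]
  finite : Finite (Σ i, I i)
  e : ∀ i, Matrix (I i) (I i) S
  d : ∀ i j, Matrix (I j) (I i) S
  a : ∀ i, Aᵐᵒᵖ → Matrix (I i) (I i) S

attribute [instance] MatData.fintype MatData.finite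

namespace MatData

variable {A S T : Type u}

/-- The image of a family of matrices under a map. -/
abbrev map (X : MatData A S) (φ : S → T) : MatData A T where
  I := X.I
  finite := X.finite
  e i := (X.e i).map φ
  d i j := (X.d i j).map φ
  a i a := (X.a i a).map φ

/-- The matrices `g` and `h` are mutually inverse isomorphisms. -/
structure Inter [CommRing S] (X X' : MatData A S) (g : ∀ i, Matrix (X'.I i) (X.I i) S)
    (h : ∀ i, Matrix (X.I i) (X'.I i) S) : Prop where
  gh : ∀ i, g i * h i = X'.e i
  hg : ∀ i, h i * g i = X.e i
  gd : ∀ i j, g j * X.d i j = X'.d i j * g i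
  ga : ∀ i a, g i * X.a i a = X'.a i a * g i

end MatData

variable {k A : Type u} [Field k] [Ring A] [Algebra k A]

/-- The maps `σ` and `π` exhibit the complex `C` as the one described by the matrices `X`. -/
structure IsRep (C : ChainComplex (ModuleCat.{u} Aᵐᵒᵖ) ℤ) (X : MatData A k)
    (σ : ∀ i, C.X i →+ (X.I i → k)) (π : ∀ i, (X.I i → k) →+ C.X i) : Prop where
  left : ∀ i x, π i (σ i x) = x
  right : ∀ i v, σ i (π i v) = X.e i *ᵥ v
  lin : ∀ i (c : k) x, σ i (algebraMap k Aᵐᵒᵖ c • x) = c • σ i x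
  d : ∀ i j v, σ j (C.d i j (π i v)) = X.d i j *ᵥ v
  act : ∀ i a v, σ i (a • π i v) = X.a i a *ᵥ v

/-- The complex `C` is described by the matrices `X`. -/
def RepBy (C : ChainComplex (ModuleCat.{u} Aᵐᵒᵖ) ℤ) (X : MatData A k) : Prop :=
  ∃ σ π, IsRep C X σ π

variable {C C' : ChainComplex (ModuleCat.{u} Aᵐᵒᵖ) ℤ} {X X' : MatData A k}

theorem IsRep.lin' {σ : ∀ i, C.X i →+ (X.I i → k)} {π : ∀ i, (X.I i → k) →+ C.X i}
    (h : IsRep C X σ π) (i : ℤ) (c : k) (v : X.I i → k) :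
    π i (c • v) = algebraMap k Aᵐᵒᵖ c • π i v := by
  rw [← h.left i (π i (c • v)), h.right, mulVec_smul, ← h.right, ← h.lin, h.left]

/-- An isomorphism of complexes gives an isomorphism of matrices. -/
theorem RepBy.exists_inter (hC : RepBy C X) (hC' : RepBy C' X') (e : C ≅ C') :
    ∃ g h, X.Inter X' g h := by
  classical
  obtain ⟨σ, π, hC⟩ := hC
  obtain ⟨σ', π', hC'⟩ := hC'
  have hinv (i : ℤ) (y : C.X i) : e.inv.f i (e.hom.f i y) = y :=
    congrArg (fun f : C ⟶ C => f.f i y) e.hom_inv_id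
  have hhom (i : ℤ) (y : C'.X i) : e.hom.f i (e.inv.f i y) = y :=
    congrArg (fun f : C' ⟶ C' => f.f i y) e.inv_hom_id
  have hA (i : ℤ) (a : Aᵐᵒᵖ) (y : C.X i) : e.hom.f i (a • y) = a • e.hom.f i y :=
    (e.hom.f i).hom.map_smul a y
  have hA' (i : ℤ) (a : Aᵐᵒᵖ) (y : C'.X i) : e.inv.f i (a • y) = a • e.inv.f i y :=
    (e.inv.f i).hom.map_smul a y
  have hd (i j : ℤ) (y : C.X i) : C'.d i j (e.hom.f i y) = e.hom.f j (C.d i j y) :=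
    congrArg (fun f : C.X i ⟶ C'.X j => f y) (e.hom.comm i j)
  let G (i : ℤ) : (X.I i → k) →ₗ[k] (X'.I i → k) :=
    { toFun := fun v => σ' i (e.hom.f i (π i v))
      map_add' := fun v w => by rw [map_add, map_add, map_add]
      map_smul' := fun c v => by rw [hC.lin', hA, hC'.lin]; rfl }
  let H (i : ℤ) : (X'.I i → k) →ₗ[k] (X.I i → k) :=
    { toFun := fun v => σ i (e.inv.f i (π' i v))
      map_add' := fun v w => by rw [map_add, map_add, map_add]
      map_smul' := fun c v => by rw [hC'.lin', hA', hC.lin]; rfl }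
  refine ⟨fun i => LinearMap.toMatrix' (G i), fun i => LinearMap.toMatrix' (H i), ?_, ?_, ?_, ?_⟩
  · intro i
    refine Matrix.toLin'.injective (LinearMap.ext fun v => ?_)
    rw [toLin'_mul, toLin'_toMatrix', toLin'_toMatrix', LinearMap.comp_apply, toLin'_apply]
    change σ' i (e.hom.f i (π i (σ i (e.inv.f i (π' i v))))) = _
    rw [hC.left, hhom, hC'.right]
  · intro i
    refine Matrix.toLin'.injective (LinearMap.ext fun v => ?_)
    rw [toLin'_mul, toLin'_toMatrix', toLin'_toMatrix', LinearMap.comp_apply, toLin'_apply]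
    change σ i (e.inv.f i (π' i (σ' i (e.hom.f i (π i v))))) = _
    rw [hC'.left, hinv, hC.right]
  · intro i j
    refine Matrix.toLin'.injective (LinearMap.ext fun v => ?_)
    rw [toLin'_mul, toLin'_mul, toLin'_toMatrix', toLin'_toMatrix', LinearMap.comp_apply,
      LinearMap.comp_apply, toLin'_apply, toLin'_apply]
    change σ' j (e.hom.f j (π j _)) = X'.d i j *ᵥ (σ' i (e.hom.f i (π i v)))
    rw [← hC.d, ← hC'.d, hC.left, hC'.left, hd]
  · intro i a
    refine Matrix.toLin'.injective (LinearMap.ext fun v => ?_)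
    rw [toLin'_mul, toLin'_mul, toLin'_toMatrix', LinearMap.comp_apply,
      LinearMap.comp_apply, toLin'_apply, toLin'_apply]
    change σ' i (e.hom.f i (π i _)) = X'.a i a *ᵥ (σ' i (e.hom.f i (π i v)))
    rw [← hC.act, ← hC'.act, hC.left, hC'.left, hA]

/-- An isomorphism of matrices gives an isomorphism of complexes. -/
theorem RepBy.nonempty_iso (hC : RepBy C X) (hC' : RepBy C' X')
    {g : ∀ i, Matrix (X'.I i) (X.I i) k} {h : ∀ i, Matrix (X.I i) (X'.I i) k}
    (hgh : X.Inter X' g h) : Nonempty (C ≅ C') := by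
  obtain ⟨σ, π, hC⟩ := hC
  obtain ⟨σ', π', hC'⟩ := hC'
  -- Both sides are `g h g`; idempotency of the matrices `e` plays no role.
  have hge (i) : g i * X.e i = X'.e i * g i := by
    rw [← hgh.hg, ← Matrix.mul_assoc, hgh.gh]
  have hhe (i) : h i * X'.e i = X.e i * h i := by
    rw [← hgh.gh, ← Matrix.mul_assoc, hgh.hg]
  have hee (i) (x : C.X i) : X.e i *ᵥ σ i x = σ i x := by rw [← hC.right, hC.left]
  have hee' (i) (x : C'.X i) : X'.e i *ᵥ σ' i x = σ' i x := by rw [← hC'.right, hC'.left]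
  let φ (i : ℤ) : C.X i →+ C'.X i :=
    (π' i).comp ((Matrix.mulVecLin (g i)).toAddMonoidHom.comp (σ i))
  let ψ (i : ℤ) : C'.X i →+ C.X i :=
    (π i).comp ((Matrix.mulVecLin (h i)).toAddMonoidHom.comp (σ' i))
  have hφ (i x) : φ i x = π' i (g i *ᵥ σ i x) := rfl
  have hψ (i x) : ψ i x = π i (h i *ᵥ σ' i x) := rfl
  have hσφ (i x) : σ' i (φ i x) = g i *ᵥ σ i x := by
    rw [hφ, hC'.right, mulVec_mulVec, ← hge, ← mulVec_mulVec, hee]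
  have hσψ (i x) : σ i (ψ i x) = h i *ᵥ σ' i x := by
    rw [hψ, hC.right, mulVec_mulVec, ← hhe, ← mulVec_mulVec, hee']
  have hA (i : ℤ) (a : Aᵐᵒᵖ) (x : C.X i) : φ i (a • x) = a • φ i x := by
    have h1 : σ i (a • x) = X.a i a *ᵥ σ i x := by rw [← hC.act, hC.left]
    rw [← hC'.left i (a • φ i x), hφ, h1, mulVec_mulVec, hgh.ga, ← mulVec_mulVec, ← hC'.act, ← hφ]
  have hd (i j : ℤ) (x : C.X i) : C'.d i j (φ i x) = φ j (C.d i j x) := by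
    have h1 : σ j (C.d i j x) = X.d i j *ᵥ σ i x := by rw [← hC.d, hC.left]
    rw [← hC'.left j (C'.d i j _), hφ j, h1, mulVec_mulVec, hgh.gd, ← mulVec_mulVec, ← hC'.d,
      ← hφ]
  have hφψ (i x) : φ i (ψ i x) = x := by
    rw [hφ, hσψ, mulVec_mulVec, hgh.gh, hee', hC'.left]
  have hψφ (i x) : ψ i (φ i x) = x := by
    rw [hψ, hσφ, mulVec_mulVec, hgh.hg, hee, hC.left]
  refine ⟨HomologicalComplex.Hom.isoOfComponents (fun i => LinearEquiv.toModuleIso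
    { φ i with
      map_smul' := hA i
      invFun := ψ i
      left_inv := hψφ i
      right_inv := hφψ i }) fun i j _ => ?_⟩
  ext x
  exact hd i j x

theorem RepBy.of_iso (hC : RepBy C X) (e : C ≅ C') : RepBy C' X := by
  obtain ⟨σ, π, hC⟩ := hC
  have hinv (i : ℤ) (y : C.X i) : e.inv.f i (e.hom.f i y) = y :=
    congrArg (fun f : C ⟶ C => f.f i y) e.hom_inv_id
  have hhom (i : ℤ) (y : C'.X i) : e.hom.f i (e.inv.f i y) = y :=
    congrArg (fun f : C' ⟶ C' => f.f i y) e.inv_hom_id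
  have hA' (i : ℤ) (a : Aᵐᵒᵖ) (y : C'.X i) : e.inv.f i (a • y) = a • e.inv.f i y :=
    (e.inv.f i).hom.map_smul a y
  have hd (i j : ℤ) (y : C.X i) : C'.d i j (e.hom.f i y) = e.hom.f j (C.d i j y) :=
    congrArg (fun f : C.X i ⟶ C'.X j => f y) (e.hom.comm i j)
  refine ⟨fun i => (σ i).comp (e.inv.f i).hom.toAddMonoidHom,
    fun i => (e.hom.f i).hom.toAddMonoidHom.comp (π i), fun i x => ?_, fun i v => ?_,
    fun i c x => ?_, fun i j v => ?_, fun i a v => ?_⟩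
  · change e.hom.f i (π i (σ i (e.inv.f i x))) = x
    rw [hC.left, hhom]
  · change σ i (e.inv.f i (e.hom.f i (π i v))) = _
    rw [hinv, hC.right]
  · change σ i (e.inv.f i _) = c • σ i (e.inv.f i x)
    rw [hA', hC.lin]
  · change σ j (e.inv.f j (C'.d i j (e.hom.f i (π i v)))) = _
    rw [hd, hinv, hC.d]
  · change σ i (e.inv.f i (a • e.hom.f i (π i v))) = _
    rw [hA', hinv, hC.act]

/-- Block diagonal matrices. -/
abbrev MatData.sum {A S : Type u} [Zero S] (X X' : MatData A S) : MatData A S where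
  I i := X.I i ⊕ X'.I i
  finite := Finite.of_equiv _ (Equiv.sigmaSumDistrib X.I X'.I).symm
  e i := fromBlocks (X.e i) 0 0 (X'.e i)
  d i j := fromBlocks (X.d i j) 0 0 (X'.d i j)
  a i a := fromBlocks (X.a i a) 0 0 (X'.a i a)

theorem RepBy.sum (hC : RepBy C X) (hC' : RepBy C' X') : RepBy (C ⊞ C') (X.sum X') := by
  obtain ⟨σ, π, hC⟩ := hC
  obtain ⟨σ', π', hC'⟩ := hC'
  let p : C ⊞ C' ⟶ C := biprod.fst
  let p' : C ⊞ C' ⟶ C' := biprod.snd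
  let q : C ⟶ C ⊞ C' := biprod.inl
  let q' : C' ⟶ C ⊞ C' := biprod.inr
  have hpq (i) (x : C.X i) : p.f i (q.f i x) = x :=
    congrArg (fun f : C ⟶ C => f.f i x) (biprod.inl_fst (X := C) (Y := C'))
  have hpq' (i) (x : C'.X i) : p'.f i (q'.f i x) = x :=
    congrArg (fun f : C' ⟶ C' => f.f i x) (biprod.inr_snd (X := C) (Y := C'))
  have hp'q (i) (x : C.X i) : p'.f i (q.f i x) = 0 :=
    congrArg (fun f : C ⟶ C' => f.f i x) (biprod.inl_snd (X := C) (Y := C'))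
  have hpq'0 (i) (x : C'.X i) : p.f i (q'.f i x) = 0 :=
    congrArg (fun f : C' ⟶ C => f.f i x) (biprod.inr_fst (X := C) (Y := C'))
  have htot (i) (x : (C ⊞ C').X i) : q.f i (p.f i x) + q'.f i (p'.f i x) = x :=
    congrArg (fun f : C ⊞ C' ⟶ C ⊞ C' => f.f i x) (biprod.total (X := C) (Y := C'))
  have hpA (i) (a : Aᵐᵒᵖ) (x : (C ⊞ C').X i) : p.f i (a • x) = a • p.f i x :=
    (p.f i).hom.map_smul a x
  have hpA' (i) (a : Aᵐᵒᵖ) (x : (C ⊞ C').X i) : p'.f i (a • x) = a • p'.f i x :=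
    (p'.f i).hom.map_smul a x
  have hpd (i j : ℤ) (y : (C ⊞ C').X i) : p.f j ((C ⊞ C').d i j y) = C.d i j (p.f i y) :=
    (congrArg (fun f : (C ⊞ C').X i ⟶ C.X j => f y) (p.comm i j)).symm
  have hpd' (i j : ℤ) (y : (C ⊞ C').X i) : p'.f j ((C ⊞ C').d i j y) = C'.d i j (p'.f i y) :=
    (congrArg (fun f : (C ⊞ C').X i ⟶ C'.X j => f y) (p'.comm i j)).symm
  let sg (i : ℤ) : (C ⊞ C').X i →+ ((X.I i ⊕ X'.I i) → k) := AddMonoidHom.mk'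
    (fun x => Sum.elim (σ i (p.f i x)) (σ' i (p'.f i x))) fun x y => by
      ext (j | j) <;> simp [map_add]
  let pr (i : ℤ) : ((X.I i ⊕ X'.I i) → k) →+ (C ⊞ C').X i := AddMonoidHom.mk'
    (fun v => q.f i (π i (v ∘ Sum.inl)) + q'.f i (π' i (v ∘ Sum.inr))) fun v w => by
      have h1 : (v + w) ∘ Sum.inl = v ∘ Sum.inl + w ∘ Sum.inl := rfl
      have h2 : (v + w) ∘ Sum.inr = v ∘ Sum.inr + w ∘ Sum.inr := rfl
      rw [h1, h2, map_add, map_add, map_add, map_add]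
      abel
  have hsg (i x) : sg i x = Sum.elim (σ i (p.f i x)) (σ' i (p'.f i x)) := rfl
  have hpr (i v) : p.f i (pr i v) = π i (v ∘ Sum.inl) := by
    change p.f i (q.f i _ + q'.f i _) = _
    rw [map_add, hpq, hpq'0, add_zero]
  have hppr (i v) : p'.f i (pr i v) = π' i (v ∘ Sum.inr) := by
    change p'.f i (q.f i _ + q'.f i _) = _
    rw [map_add, hpq', hp'q, zero_add]
  refine ⟨sg, pr, fun i x => ?_, fun i v => ?_, fun i c x => ?_, fun i j v => ?_, fun i a v => ?_⟩
  · change q.f i (π i (σ i (p.f i x))) + q'.f i (π' i (σ' i (p'.f i x))) = x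
    rw [hC.left, hC'.left, htot]
  · rw [hsg, hpr, hppr, hC.right, hC'.right, fromBlocks_mulVec]
    simp
  · rw [hsg, hsg, hpA, hpA', hC.lin, hC'.lin]
    ext (j | j) <;> rfl
  · rw [hsg, hpd, hpd', hpr, hppr, hC.d, hC'.d, fromBlocks_mulVec]
    simp
  · rw [hsg, hpA, hpA', hpr, hppr, hC.act, hC'.act, fromBlocks_mulVec]
    simp

end

section

open Matrix

/-! ### Matrices for a minimal family. -/

section

variable {k A S : Type u} [Field k] [Ring A] [Algebra k A] [Module.Finite k A] [CommRing S]
  [Algebra k S]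

/-- A dual basis over `S ⊗ Aᵐᵒᵖ` times a `k`-basis of `A` is a dual basis over `S`. Zero modules get
an empty index set, so that a bounded complex has finitely many indices altogether. -/
theorem exists_dualBasis_left (M : Type u) [AddCommGroup M] [Module (S ⊗[k] Aᵐᵒᵖ) M]
    [Module.Finite (S ⊗[k] Aᵐᵒᵖ) M] [Module.Projective (S ⊗[k] Aᵐᵒᵖ) M] :
    ∃ (I : Type) (_ : Fintype I) (_ : Subsingleton M → IsEmpty I) (b : I → M) (c : I → M →+ S),
      (∀ i s m, c i ((s ⊗ₜ[k] (1 : Aᵐᵒᵖ)) • m) = s * c i m) ∧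
      ∀ m, ∑ i, (c i m ⊗ₜ[k] (1 : Aᵐᵒᵖ)) • b i = m := by
  rcases subsingleton_or_nontrivial M with hM | hM
  · exact ⟨Fin 0, inferInstance, fun _ => inferInstance, Fin.elim0, fun i => i.elim0,
      fun i => i.elim0, fun m => Subsingleton.elim _ _⟩
  obtain ⟨n, x, f, hf⟩ := exists_dualBasis (S ⊗[k] Aᵐᵒᵖ) M
  have : Module.Finite k Aᵐᵒᵖ := Module.Finite.equiv (MulOpposite.opLinearEquiv k)
  let β := Module.finBasis k Aᵐᵒᵖ
  let γ := Algebra.TensorProduct.basis S β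
  refine ⟨Fin n × Fin (Module.finrank k Aᵐᵒᵖ), inferInstance,
    fun h => (not_subsingleton M h).elim, fun ij => ((1 : S) ⊗ₜ[k] β ij.2) • x ij.1,
    fun ij => (γ.coord ij.2).toAddMonoidHom.comp (f ij.1).toAddMonoidHom, fun ij s m => ?_,
    fun m => ?_⟩
  · change γ.coord ij.2 (f ij.1 _) = s * γ.coord ij.2 (f ij.1 m)
    refine Eq.trans (congrArg (γ.coord ij.2) ?_) ((γ.coord ij.2).map_smul s (f ij.1 m))
    exact (map_smul _ _ _).trans (Algebra.smul_def s (f ij.1 m)).symm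
  · change ∑ ij : Fin n × Fin (Module.finrank k Aᵐᵒᵖ),
      (γ.coord ij.2 (f ij.1 m) ⊗ₜ[k] (1 : Aᵐᵒᵖ)) • ((1 : S) ⊗ₜ[k] β ij.2) • x ij.1 = m
    rw [Fintype.sum_prod_type]
    refine (Finset.sum_congr rfl fun i _ => ?_).trans (hf m)
    simp only [smul_smul, ← Finset.sum_smul]
    congr 1
    refine Eq.trans ?_ (γ.sum_repr (f i m))
    refine Finset.sum_congr rfl fun j _ => ?_
    rw [Algebra.TensorProduct.tmul_mul_tmul, mul_one, one_mul, Algebra.TensorProduct.basis_apply,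
      TensorProduct.smul_tmul', smul_eq_mul, mul_one]
    rfl

/-- A minimal family is described by matrices. -/
theorem exists_matData {Q : ChainComplex (ModuleCat.{u} (S ⊗[k] Aᵐᵒᵖ)) ℤ}
    (hQ : IsMinimalFamily k S A Q) :
    ∃ X : MatData A S, ∀ (x : S →ₐ[k] k) (D : ChainComplex (ModuleCat.{u} Aᵐᵒᵖ) ℤ),
      IsFiber x.toRingHom Q D → RepBy D (X.map x) := by
  have hf (i) : Module.Finite (S ⊗[k] Aᵐᵒᵖ) (Q.X i) := hQ.finite i
  have hp (i) : Module.Projective (S ⊗[k] Aᵐᵒᵖ) (Q.X i) := hQ.projective i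
  choose I hI hI' b c hc hbc using fun i => exists_dualBasis_left (k := k) (A := A) (S := S) (Q.X i)
  have hfin : Finite (Σ i, I i) := by
    obtain ⟨m, n, h⟩ := hQ.bounded
    refine Finite.of_injective (β := Σ i : Set.Icc m n, I i)
      (fun p => ⟨⟨p.1, ?_⟩, p.2⟩) fun p q hpq => ?_
    · by_contra hp
      have : IsEmpty (I p.1) := hI' _ (ModuleCat.subsingleton_of_isZero (h p.1 (by
        rw [Set.mem_Icc, not_and_or, not_le, not_le] at hp
        exact hp)))
      exact this.elim p.2
    · obtain ⟨i, a⟩ := p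
      obtain ⟨j, a'⟩ := q
      simp only [Sigma.mk.injEq, Subtype.mk.injEq] at hpq ⊢
      exact hpq
  refine ⟨{ I := I, finite := hfin, e := fun i => .of fun p q => c i p (b i q),
            d := fun i j => .of fun p q => c j p (Q.d i j (b i q)),
            a := fun i a => .of fun p q => c i p (((1 : S) ⊗ₜ[k] a) • b i q) }, fun x D => ?_⟩
  rintro ⟨u, hu⟩
  -- Coordinates are `S`-linear, so their values at `x` depend only on the image in the fibre.
  have hvan (i p) (m : Q.X i) (hm : m ∈ vanishing (A := A) x.toRingHom (Q.X i)) :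
      x (c i p m) = 0 := by
    induction hm using AddSubgroup.closure_induction with
    | mem y hy =>
      obtain ⟨s, m, hs, rfl⟩ := hy
      rw [hc, map_mul, show x s = 0 from hs, zero_mul]
    | zero => rw [map_zero, map_zero]
    | add y z _ _ hy hz => rw [map_add, map_add, hy, hz, add_zero]
    | neg y _ hy => rw [map_neg, map_neg, hy, neg_zero]
  let σ₀ (i) : Q.X i →+ (I i → k) := AddMonoidHom.mk' (fun m p => x (c i p m)) fun m n => by
    ext p
    simp
  let σ (i) : D.X i →+ (I i → k) := (u i).liftOfSurjective (hu.surj i)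
    ⟨σ₀ i, fun m hm => funext fun p => hvan i p m (hu.ker_le i m hm)⟩
  have hσ (i) (m : Q.X i) : σ i (u i m) = fun p => x (c i p m) :=
    (u i).liftOfRightInverse_comp_apply _ (Function.rightInverse_surjInv (hu.surj i)) _ m
  let π (i) : (I i → k) →+ D.X i := AddMonoidHom.mk'
    (fun v => ∑ p, algebraMap k Aᵐᵒᵖ (v p) • u i (b i p)) fun v w => by
      simp only [Pi.add_apply, map_add, add_smul, Finset.sum_add_distrib]
  have hπ (i v) : π i v = u i (∑ p, ((1 : S) ⊗ₜ[k] algebraMap k Aᵐᵒᵖ (v p)) • b i p) := by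
    rw [map_sum]
    exact Finset.sum_congr rfl fun p _ => (hu.map_one_smul i _ _).symm
  have hc' (i p) (r : k) (m : Q.X i) :
      x (c i p (((1 : S) ⊗ₜ[k] algebraMap k Aᵐᵒᵖ r) • m)) = r * x (c i p m) := by
    rw [← algebraMap_tmul_one, hc, map_mul, AlgHom.commutes]
    rfl
  have hcomm (i) (a : Aᵐᵒᵖ) (r : k) (m : Q.X i) :
      ((1 : S) ⊗ₜ[k] a) • ((1 : S) ⊗ₜ[k] algebraMap k Aᵐᵒᵖ r) • m =
      ((1 : S) ⊗ₜ[k] algebraMap k Aᵐᵒᵖ r) • ((1 : S) ⊗ₜ[k] a) • m := by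
    rw [smul_smul, smul_smul, Algebra.TensorProduct.tmul_mul_tmul,
      Algebra.TensorProduct.tmul_mul_tmul, Algebra.commutes]
  refine ⟨σ, π, fun i y => ?_, fun i v => ?_, fun i r y => ?_, fun i j v => ?_, fun i a v => ?_⟩
  · obtain ⟨m, rfl⟩ := hu.surj i y
    rw [hσ]
    refine Eq.trans ?_ (congrArg (u i) (hbc i m))
    rw [map_sum]
    refine Finset.sum_congr rfl fun p _ => ?_
    rw [hu.map_smul, Algebra.algebraMap_eq_smul_one]
    rfl
  · rw [hπ, hσ]
    ext p
    simp only [map_sum, hc', mulVec, dotProduct]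
    exact Finset.sum_congr rfl fun q _ => mul_comm _ _
  · obtain ⟨m, rfl⟩ := hu.surj i y
    rw [← hu.map_one_smul, hσ, hσ]
    ext p
    exact hc' i p r m
  · rw [hπ, ← hu.comm, hσ]
    ext p
    simp only [map_sum, map_smul, hc', mulVec, dotProduct]
    exact Finset.sum_congr rfl fun q _ => mul_comm _ _
  · rw [hπ, ← hu.map_one_smul, hσ]
    ext p
    simp only [map_sum, Finset.smul_sum, hcomm, hc', mulVec, dotProduct]
    exact Finset.sum_congr rfl fun q _ => mul_comm _ _

end

/-! ### The ring of isomorphisms -/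

section InterRing

variable {k A : Type u} [Field k] {R S : Type u} [CommRing R] [Algebra k R] [CommRing S]
  [Algebra k S] (X : MatData A R) (X' : MatData A S)

/-- The coefficients of a pair of mutually inverse isomorphisms. -/
def InterVar : Type := (Σ i, X'.I i × X.I i) ⊕ (Σ i, X.I i × X'.I i)

instance : Finite (InterVar X X') := by
  have h (Y : MatData A R) (Y' : MatData A S) :
      Finite (Σ i, Y'.I i × Y.I i) := by
    refine Finite.of_injective (β := (Σ i, Y'.I i) × (Σ i, Y.I i))
      (fun p => (⟨p.1, p.2.1⟩, ⟨p.1, p.2.2⟩)) ?_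
    rintro ⟨i, a, b⟩ ⟨j, a', b'⟩ h
    simp only [Prod.mk.injEq, Sigma.mk.injEq] at h
    obtain ⟨⟨rfl, h1⟩, _, h2⟩ := h
    simp_all
  have h' : Finite (Σ i, X.I i × X'.I i) :=
    Finite.of_injective (β := Σ i, X'.I i × X.I i) (fun p => ⟨p.1, p.2.2, p.2.1⟩) (by
      rintro ⟨i, a, b⟩ ⟨j, a', b'⟩ h
      simp only [Sigma.mk.injEq] at h
      obtain ⟨rfl, h1⟩ := h
      simp_all)
  have := h X X'
  exact inferInstanceAs (Finite (_ ⊕ _))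

/-- The polynomial ring in the coefficients of a pair of isomorphisms. -/
abbrev InterPoly (k : Type u) [Field k] [Algebra k R] [Algebra k S] : Type u :=
  MvPolynomial (InterVar X X') (R ⊗[k] S)

variable (k)

/-- The generic isomorphism. -/
def genIso (i : ℤ) : Matrix (X'.I i) (X.I i) (InterPoly X X' k) :=
  .of fun a b => MvPolynomial.X (Sum.inl ⟨i, a, b⟩)

/-- The generic inverse isomorphism. -/
def genInv (i : ℤ) : Matrix (X.I i) (X'.I i) (InterPoly X X' k) :=
  .of fun a b => MvPolynomial.X (Sum.inr ⟨i, a, b⟩)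

/-- The functions of the first family in the polynomial ring. -/
def interLeft : R →ₐ[k] InterPoly X X' k :=
  (IsScalarTower.toAlgHom k (R ⊗[k] S) _).comp Algebra.TensorProduct.includeLeft

/-- The functions of the second family in the polynomial ring. -/
def interRight : S →ₐ[k] InterPoly X X' k :=
  (IsScalarTower.toAlgHom k (R ⊗[k] S) _).comp Algebra.TensorProduct.includeRight

/-- The relations between the coefficients of a pair of mutually inverse isomorphisms. -/
def interRel : Set (InterPoly X X' k) :=
  {p | ∃ i a b, p = (genIso k X X' i * genInv k X X' i - (X'.map (interRight k X X')).e i) a b} ∪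
  {p | ∃ i a b, p = (genInv k X X' i * genIso k X X' i - (X.map (interLeft k X X')).e i) a b} ∪
  {p | ∃ i j a b, p = (genIso k X X' j * (X.map (interLeft k X X')).d i j -
    (X'.map (interRight k X X')).d i j * genIso k X X' i) a b} ∪
  {p | ∃ i r a b, p = (genIso k X X' i * (X.map (interLeft k X X')).a i r -
    (X'.map (interRight k X X')).a i r * genIso k X X' i) a b}

/-- The ring whose points are the isomorphisms between members of two families. -/
abbrev InterRing : Type u := InterPoly X X' k ⧸ Ideal.span (interRel k X X')

variable {X X'}

theorem inter_of_forall (w : InterPoly X X' k →ₐ[k] k) (hw : ∀ p ∈ interRel k X X', w p = 0) :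
    (X.map (w.comp (interLeft k X X'))).Inter (X'.map (w.comp (interRight k X X')))
      (fun i => (genIso k X X' i).map w) fun i => (genInv k X X' i).map w := by
  have hsub {m n : Type} (M N : Matrix m n (InterPoly X X' k)) (h : ∀ a b, w ((M - N) a b) = 0) :
      M.map w = N.map w := by
    ext a b
    have := h a b
    rw [Matrix.sub_apply, map_sub, sub_eq_zero] at this
    exact this
  have hmap {m n l : Type} [Fintype n] (M : Matrix m n (InterPoly X X' k))
      (N : Matrix n l (InterPoly X X' k)) : (M * N).map w = M.map w * N.map w := Matrix.map_mul
  refine ⟨fun i => ?_, fun i => ?_, fun i j => ?_, fun i r => ?_⟩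
  · rw [← hmap]
    exact hsub _ _ fun a b => hw _ (.inl (.inl (.inl ⟨i, a, b, rfl⟩)))
  · rw [← hmap]
    exact hsub _ _ fun a b => hw _ (.inl (.inl (.inr ⟨i, a, b, rfl⟩)))
  · refine Eq.trans (hmap _ _).symm (Eq.trans ?_ (hmap _ _))
    exact hsub _ _ fun a b => hw _ (.inl (.inr ⟨i, j, a, b, rfl⟩))
  · refine Eq.trans (hmap _ _).symm (Eq.trans ?_ (hmap _ _))
    exact hsub _ _ fun a b => hw _ (.inr ⟨i, r, a, b, rfl⟩)

variable (X X')

/-- The functions of the second family in the ring of isomorphisms. -/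
def interFun : S →ₐ[k] InterRing k X X' := (Ideal.Quotient.mkₐ k _).comp (interRight k X X')

variable {X X'}

/-- With `exists_point_of_inter`, the points of `InterRing` over a pair `(x, s)` are the
isomorphisms between the specialized matrices. -/
theorem exists_inter_of_point (w : InterRing k X X' →ₐ[k] k) (x : R →ₐ[k] k)
    (hx : ∀ r, w (algebraMap R _ r) = x r) (s : S →ₐ[k] k) (hs : ∀ r, w (interFun k X X' r) = s r) :
    ∃ g h, (X.map x).Inter (X'.map s) g h := by
  have h := inter_of_forall k (w.comp (Ideal.Quotient.mkₐ k _)) (X := X) (X' := X') fun p hp => by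
    change w (Ideal.Quotient.mk _ p) = 0
    rw [Ideal.Quotient.eq_zero_iff_mem.2 (Ideal.subset_span hp), map_zero]
  have h1 : (w.comp (Ideal.Quotient.mkₐ k _)).comp (interLeft k X X') = x := AlgHom.ext hx
  have h2 : (w.comp (Ideal.Quotient.mkₐ k _)).comp (interRight k X X') = s := AlgHom.ext hs
  rw [h1, h2] at h
  exact ⟨_, _, h⟩

theorem exists_point_of_inter (x : R →ₐ[k] k) (s : S →ₐ[k] k)
    {g : ∀ i, Matrix (X'.I i) (X.I i) k} {h : ∀ i, Matrix (X.I i) (X'.I i) k}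
    (hgh : (X.map x).Inter (X'.map s) g h) :
    ∃ w : InterRing k X X' →ₐ[k] k, (∀ r, w (algebraMap R _ r) = x r) ∧
      ∀ r, w (interFun k X X' r) = s r := by
  let xs : R ⊗[k] S →ₐ[k] k := Algebra.TensorProduct.lift x s fun _ _ => Commute.all _ _
  let v : InterVar X X' → k := Sum.elim (fun p => g p.1 p.2.1 p.2.2) fun p => h p.1 p.2.1 p.2.2
  let w₀ : InterPoly X X' k →ₐ[k] k :=
    { MvPolynomial.eval₂Hom xs.toRingHom v with
      commutes' := fun c => by
        change MvPolynomial.eval₂Hom xs.toRingHom v (MvPolynomial.C (algebraMap k _ c)) = _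
        rw [MvPolynomial.coe_eval₂Hom, MvPolynomial.eval₂_C]
        exact xs.commutes c }
  have hC (r) : w₀ (MvPolynomial.C r) = xs r := MvPolynomial.eval₂_C _ _ _
  have hXv (p) : w₀ (MvPolynomial.X p) = v p := MvPolynomial.eval₂_X _ _ _
  have hl (r) : w₀ (interLeft k X X' r) = x r := by
    refine (hC _).trans ?_
    change xs (r ⊗ₜ 1) = _
    simp [xs]
  have hr (r) : w₀ (interRight k X X' r) = s r := by
    refine (hC _).trans ?_
    change xs (1 ⊗ₜ r) = _
    simp [xs]
  have hG (i) : (genIso k X X' i).map w₀ = g i := by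
    ext a b
    exact hXv _
  have hH (i) : (genInv k X X' i).map w₀ = h i := by
    ext a b
    exact hXv _
  have hL {m n : Type} (M : Matrix m n R) : (M.map (interLeft k X X')).map w₀ = M.map x := by
    ext a b
    exact hl _
  have hR {m n : Type} (M : Matrix m n S) : (M.map (interRight k X X')).map w₀ = M.map s := by
    ext a b
    exact hr _
  have hsub {m n : Type} (M N : Matrix m n (InterPoly X X' k)) (h : M.map w₀ = N.map w₀) (a b) :
      w₀ ((M - N) a b) = 0 := by
    rw [Matrix.sub_apply, map_sub, sub_eq_zero]
    exact congrFun (congrFun h a) b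
  have hmap {m n l : Type} [Fintype n] (M : Matrix m n (InterPoly X X' k))
      (N : Matrix n l (InterPoly X X' k)) : (M * N).map w₀ = M.map w₀ * N.map w₀ := Matrix.map_mul
  have hrel : Ideal.span (interRel k X X') ≤ RingHom.ker w₀ := by
    rw [Ideal.span_le]
    rintro p (((⟨i, a, b, rfl⟩ | ⟨i, a, b, rfl⟩) | ⟨i, j, a, b, rfl⟩) | ⟨i, r, a, b, rfl⟩)
    · exact hsub _ _ (by rw [hmap, hG, hH, hgh.gh, hR]) a b
    · exact hsub _ _ (by rw [hmap, hG, hH, hgh.hg, hL]) a b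
    · exact hsub _ _ (by rw [hmap, hmap, hG, hG, hL, hR]; exact hgh.gd i j) a b
    · exact hsub _ _ (by rw [hmap, hmap, hG, hL, hR]; exact hgh.ga i r) a b
  exact ⟨Ideal.Quotient.liftₐ _ w₀ hrel, hl, hr⟩

/-- There are finitely many variables. The relations, indexed in part by all of `Aᵐᵒᵖ`, may be
infinite in number without harm. -/
instance [Algebra.FiniteType k S] : Algebra.FiniteType R (InterRing k X X') := by
  have h1 : Algebra.FiniteType R (R ⊗[k] S) := inferInstance
  have h2 : Algebra.FiniteType (R ⊗[k] S) (InterPoly X X' k) := inferInstance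
  have h3 : Algebra.FiniteType R (InterPoly X X' k) := h1.trans h2
  exact h3.of_surjective (Ideal.Quotient.mkₐ R _) (Ideal.Quotient.mkₐ_surjective R _)

end InterRing

end

section

/-! ### Chains of closed subsets and chains of primes -/

section Chains

variable {k : Type u} [Field k] {V : Variety k}

theorem dim_mono {S T : Set V.Point} (h : S ⊆ T) : Variety.dim S ≤ Variety.dim T :=
  (Topology.IsEmbedding.inclusion
    (Set.image_mono (f := Variety.Point.pt) h)).isInducing.topologicalKrullDim_le

/-- `Spec R` is closed in `U`, and the primes `q j` define a descending chain of its irreducible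
closed subsets meeting `f ≠ 0`. By the Nullstellensatz closedness, irreducibility and strictness are
already visible on `k`-points, so the chain lives inside `S`. -/
theorem le_dim_of_chain [IsAlgClosed k] {U : V.X.Opens} (hU : IsAffineOpen U) {R : Type u}
    [CommRing R] [Algebra k R]
    [Algebra.FiniteType k R] (π : Γ(V.X, U) →ₐ[k] R) (hπ : Function.Surjective π) (f : R)
    (q : LTSeries (PrimeSpectrum R)) (hf : ∀ j, f ∉ (q j).asIdeal) (S : Set V.Point)
    (hS : ∀ (x : V.Point) (hx : x.pt ∈ U) (φ : R →ₐ[k] k), (∀ r, φ (π r) = x.eval hx r) →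
      φ f ≠ 0 → (∀ r ∈ (q 0).asIdeal, φ r = 0) → x ∈ S) :
    (q.length : WithBot ℕ∞) ≤ Variety.dim S := by
  let Good (x : V.Point) (I : Ideal R) : Prop := ∃ (hx : x.pt ∈ U) (φ : R →ₐ[k] k),
    (∀ r, φ (π r) = x.eval hx r) ∧ φ f ≠ 0 ∧ ∀ r ∈ I, φ r = 0
  let S₀ : Set V.Point := {x | Good x (q 0).asIdeal}
  have hS₀ : S₀ ⊆ S := fun x ⟨hx, φ, h1, h2, h3⟩ => hS x hx φ h1 h2 h3
  refine le_trans ?_ (dim_mono hS₀)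
  let T : Set V.X := Variety.Point.pt '' S₀
  let Y (I : Ideal R) : Set T := {t | ∃ x, x.pt = t.1 ∧ Good x I}
  -- a nonvanishing function gives a neighbourhood
  have hnhd (x : V.Point) (hx : x.pt ∈ U) (φ : R →ₐ[k] k) (h : ∀ r, φ (π r) = x.eval hx r) (g : R)
      (hg : φ g ≠ 0) : ∃ O : V.X.Opens, x.pt ∈ O ∧ ∀ (x' : V.Point) (hx' : x'.pt ∈ U)
        (φ' : R →ₐ[k] k), (∀ r, φ' (π r) = x'.eval hx' r) → x'.pt ∈ O → φ' g ≠ 0 := by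
    obtain ⟨g', rfl⟩ := hπ g
    refine ⟨V.X.basicOpen g', (x.eval_ne_zero_iff hx g').1 (by rwa [← h]), fun x' hx' φ' h' ho => ?_⟩
    rw [h']
    exact (x'.eval_ne_zero_iff hx' g').2 ho
  have hpt (φ : R →ₐ[k] k) : ∃ (x : V.Point) (hx : x.pt ∈ U), ∀ r, φ (π r) = x.eval hx r := by
    obtain ⟨x, hx, h⟩ := Variety.exists_point_eval hU (φ.comp π)
    exact ⟨x, hx, fun r => (h r).symm⟩
  -- open sets contain basic open sets
  have hopen (O : Set V.X) (hO : IsOpen O) (x : V.Point) (hx : x.pt ∈ U) (φ : R →ₐ[k] k)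
      (h : ∀ r, φ (π r) = x.eval hx r) (hxO : x.pt ∈ O) : ∃ g : R, φ g ≠ 0 ∧
        ∀ (x' : V.Point) (hx' : x'.pt ∈ U) (φ' : R →ₐ[k] k), (∀ r, φ' (π r) = x'.eval hx' r) →
          φ' g ≠ 0 → x'.pt ∈ O := by
    obtain ⟨g, hg, hxg⟩ := hU.exists_basicOpen_le (V := ⟨O, hO⟩) ⟨x.pt, hxO⟩ hx
    refine ⟨π g, ?_, fun x' hx' φ' h' hg' => hg ((x'.eval_ne_zero_iff hx' g).1 (by rwa [← h']))⟩
    rw [h]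
    exact (x.eval_ne_zero_iff hx g).2 hxg
  have hclosed (j) : IsClosed (Y (q j).asIdeal) := by
    rw [← isOpen_compl_iff, isOpen_iff_forall_mem_open]
    rintro ⟨_, x, ⟨hx, φ, h1, h2, h3⟩, rfl⟩ ht
    have : ∃ g ∈ (q j).asIdeal, φ g ≠ 0 := by
      by_contra! hg
      exact ht ⟨x, rfl, hx, φ, h1, h2, hg⟩
    obtain ⟨g, hgq, hg⟩ := this
    obtain ⟨O, hxO, hO⟩ := hnhd x hx φ h1 g hg
    refine ⟨Subtype.val ⁻¹' O, ?_, O.2.preimage continuous_subtype_val, hxO⟩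
    rintro ⟨t, ht⟩ htO ⟨x', rfl, hx', φ', h1', h2', h3'⟩
    exact hO x' hx' φ' h1' htO (h3' g hgq)
  have hle (j) : q 0 ≤ q j := q.monotone (Fin.zero_le _)
  have hirr (j) : IsIrreducible (Y (q j).asIdeal) := by
    constructor
    · obtain ⟨φ, h1, h2⟩ := exists_point (k := k) (q j).asIdeal (hf j)
      obtain ⟨x, hx, h⟩ := hpt φ
      have hg : Good x (q 0).asIdeal := ⟨hx, φ, h, h2, fun r hr => h1 (hle j hr)⟩
      exact ⟨⟨x.pt, x, hg, rfl⟩, x, rfl, hx, φ, h, h2, fun r hr => h1 hr⟩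
    · rintro _ _ ⟨O₁, hO₁, rfl⟩ ⟨O₂, hO₂, rfl⟩ ⟨⟨_, _⟩, ⟨x₁, rfl, hx₁, φ₁, h₁, hf₁, hq₁⟩, hm₁⟩
        ⟨⟨_, _⟩, ⟨x₂, rfl, hx₂, φ₂, h₂, hf₂, hq₂⟩, hm₂⟩
      obtain ⟨g₁, hg₁, hgO₁⟩ := hopen O₁ hO₁ x₁ hx₁ φ₁ h₁ hm₁
      obtain ⟨g₂, hg₂, hgO₂⟩ := hopen O₂ hO₂ x₂ hx₂ φ₂ h₂ hm₂
      -- Primality of `q j` yields a single point of its zero set in both open sets and in `f ≠ 0`.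
      have hp : f * (g₁ * g₂) ∉ (q j).asIdeal := fun hmem => by
        rcases (q j).2.mem_or_mem hmem with h | h
        · exact hf j h
        · rcases (q j).2.mem_or_mem h with h | h
          · exact hg₁ (hq₁ _ h)
          · exact hg₂ (hq₂ _ h)
      obtain ⟨φ, hφ1, hφ2⟩ := exists_point (k := k) (q j).asIdeal hp
      rw [map_mul, map_mul] at hφ2
      obtain ⟨x, hx, h⟩ := hpt φ
      have hff : φ f ≠ 0 := left_ne_zero_of_mul hφ2
      have hg : Good x (q 0).asIdeal := ⟨hx, φ, h, hff, fun r hr => hφ1 (hle j hr)⟩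
      exact ⟨⟨x.pt, x, hg, rfl⟩, ⟨x, rfl, hx, φ, h, hff, fun r hr => hφ1 hr⟩,
        hgO₁ x hx φ h (left_ne_zero_of_mul (right_ne_zero_of_mul hφ2)),
        hgO₂ x hx φ h (right_ne_zero_of_mul (right_ne_zero_of_mul hφ2))⟩
  let Z (j) : TopologicalSpace.IrreducibleCloseds T := ⟨Y (q j).asIdeal, hirr j, hclosed j⟩
  have hanti {i j} (hij : i < j) : Z j < Z i := by
    have hlt : q i < q j := q.strictMono hij
    refine lt_of_le_of_ne ?_ fun h => ?_
    · rintro t ⟨x, hxt, hx, φ, h1, h2, h3⟩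
      exact ⟨x, hxt, hx, φ, h1, h2, fun r hr => h3 r (hlt.le hr)⟩
    -- A function in `q j` but not in `q i` is nonzero at some good point of the larger set, which
    -- is therefore not in the smaller one.
    · obtain ⟨g, hgj, hgi⟩ := Set.not_subset.1 (not_le_of_gt hlt)
      have hp : f * g ∉ (q i).asIdeal := fun hmem =>
        ((q i).2.mem_or_mem hmem).elim (hf i) hgi
      obtain ⟨φ, hφ1, hφ2⟩ := exists_point (k := k) (q i).asIdeal hp
      rw [map_mul] at hφ2
      obtain ⟨x, hx, h'⟩ := hpt φ
      have hg : Good x (q 0).asIdeal :=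
        ⟨hx, φ, h', left_ne_zero_of_mul hφ2, fun r hr => hφ1 (hle i hr)⟩
      have hmem : (⟨x.pt, x, hg, rfl⟩ : T) ∈ (Z i : Set T) :=
        ⟨x, rfl, hx, φ, h', left_ne_zero_of_mul hφ2, fun r hr => hφ1 hr⟩
      rw [← h] at hmem
      obtain ⟨x', hxx', hx', φ', h1', -, h3'⟩ := hmem
      obtain ⟨O, hxO, hO⟩ := hnhd x hx φ h' g (right_ne_zero_of_mul hφ2)
      exact hO x' hx' φ' h1' (by rw [hxx']; exact hxO) (h3' g hgj)
  -- Larger primes give smaller sets, hence the reversal of the order.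
  let l : LTSeries (TopologicalSpace.IrreducibleCloseds T) := LTSeries.mk q.length
    (fun j => Z (Fin.rev j)) fun i j hij => hanti (Fin.rev_lt_rev.2 hij)
  exact Order.LTSeries.length_le_krullDim l

/-- The converse passage. A point of the smallest set of a chain lies in all of them, so one affine
chart around it meets every member, and the ideals of functions vanishing on the members are primes
in strictly decreasing order. -/
theorem exists_primes_of_le_dim (c : V.Point → V.X.Opens) (hc : ∀ x, IsAffineOpen (c x))
    (hxc : ∀ x, x.pt ∈ c x) (S : Set V.Point) (m : ℕ) (hm : (m : WithBot ℕ∞) ≤ Variety.dim S) :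
    ∃ (x₀ : V.Point) (q : LTSeries (PrimeSpectrum Γ(V.X, c x₀))), q.length = m ∧
      ∀ f ∉ (q 0).asIdeal, ∃ y ∈ S, ∃ hy : y.pt ∈ c x₀,
        (∀ r ∈ (q 0).asIdeal, y.eval hy r = 0) ∧ y.eval hy f ≠ 0 := by
  obtain ⟨l, hl⟩ := Order.le_krullDim_iff.1 hm
  obtain ⟨⟨_, x₀, hx₀, rfl⟩, ht₀⟩ := (l 0).isIrreducible'.1
  have hmem (j) : (⟨x₀.pt, x₀, hx₀, rfl⟩ : Variety.Point.pt '' S) ∈ (l j : Set _) :=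
    l.monotone (Fin.zero_le j) ht₀
  let U := c x₀
  let q (j) : Ideal Γ(V.X, U) :=
    { carrier := {r | ∀ y (hyS : y ∈ S) (hy : y.pt ∈ U),
        (⟨y.pt, y, hyS, rfl⟩ : Variety.Point.pt '' S) ∈ (l j : Set _) → y.eval hy r = 0}
      add_mem' := fun ha hb y hyS hy hl => by rw [map_add, ha y hyS hy hl, hb y hyS hy hl, add_zero]
      zero_mem' := fun y _ hy _ => map_zero _
      smul_mem' := fun a b hb y hyS hy hl => by
        rw [smul_eq_mul, map_mul, hb y hyS hy hl, mul_zero] }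
  have hq (j r) : r ∉ q j → ∃ y, ∃ hyS : y ∈ S, ∃ hy : y.pt ∈ U,
      (⟨y.pt, y, hyS, rfl⟩ : Variety.Point.pt '' S) ∈ (l j : Set _) ∧ y.eval hy r ≠ 0 := by
    intro h
    by_contra! hcon
    exact h hcon
  have hprime (j) : (q j).IsPrime := by
    refine ⟨fun h => ?_, fun {a b} hab => ?_⟩
    · have h1 : (1 : Γ(V.X, U)) ∈ q j := by rw [h]; trivial
      have := h1 x₀ hx₀ (hxc x₀) (hmem j)
      rw [map_one] at this
      exact one_ne_zero this
    · by_contra! hcon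
      obtain ⟨y, hyS, hy, hyl, hya⟩ := hq j a hcon.1
      obtain ⟨z, hzS, hz, hzl, hzb⟩ := hq j b hcon.2
      -- Irreducibility: two nonempty relatively open subsets `a ≠ 0` and `b ≠ 0` meet, and the
      -- product is nonzero at a common point.
      obtain ⟨⟨_, w, hwS, rfl⟩, hwl, hwa, hwb⟩ := (l j).isIrreducible'.2
        (Subtype.val ⁻¹' (V.X.basicOpen a : Set V.X)) (Subtype.val ⁻¹' (V.X.basicOpen b : Set V.X))
        ((V.X.basicOpen a).2.preimage continuous_subtype_val)
        ((V.X.basicOpen b).2.preimage continuous_subtype_val)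
        ⟨_, hyl, (y.eval_ne_zero_iff hy a).1 hya⟩ ⟨_, hzl, (z.eval_ne_zero_iff hz b).1 hzb⟩
      have hw : w.pt ∈ U := V.X.basicOpen_le a hwa
      have h0 := hab w hwS hw hwl
      rw [map_mul] at h0
      exact mul_ne_zero ((w.eval_ne_zero_iff hw a).2 hwa) ((w.eval_ne_zero_iff hw b).2 hwb) h0
  have hlt {i j} (hij : i < j) : (⟨q j, hprime j⟩ : PrimeSpectrum _) < ⟨q i, hprime i⟩ := by
    have hlij : l i < l j := l.strictMono hij
    refine lt_of_le_not_ge (fun r hr y hyS hy hyl => hr y hyS hy (hlij.le hyl)) fun hle => ?_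
    -- the open part of the larger set is not contained in the smaller one
    have h1 : ∃ t ∈ (l j : Set (Variety.Point.pt '' S)), t.1 ∈ U ∧ t ∉ (l i : Set _) := by
      by_contra! hcon
      have h2 : (l j : Set (Variety.Point.pt '' S)) ⊆ (Subtype.val ⁻¹' (U : Set V.X))ᶜ ∪ l i := by
        intro t ht
        by_cases htU : t.1 ∈ U
        · exact Or.inr (hcon t ht htU)
        · exact Or.inl htU
      rcases isPreirreducible_iff_isClosed_union_isClosed.1 (l j).isIrreducible'.2 _ _
        (U.2.preimage continuous_subtype_val).isClosed_compl (l i).isClosed' h2 with h3 | h3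
      · exact h3 (hmem j) (hxc x₀)
      · exact not_le_of_gt hlij h3
    obtain ⟨⟨_, y, hyS, rfl⟩, hyl, hyU, hyi⟩ := h1
    obtain ⟨O, hO, hOl⟩ := (l i).isClosed'.isOpen_compl
    have hyO : y.pt ∈ O := by
      have : (⟨y.pt, y, hyS, rfl⟩ : Variety.Point.pt '' S) ∈ Subtype.val ⁻¹' O := by
        rw [hOl]; exact hyi
      exact this
    obtain ⟨g, hg, hyg⟩ := (hc x₀).exists_basicOpen_le (V := ⟨O, hO⟩) ⟨y.pt, hyO⟩ hyU
    have hgi : g ∈ q i := by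
      intro z hzS hz hzl
      by_contra h0
      have hzO : (⟨z.pt, z, hzS, rfl⟩ : Variety.Point.pt '' S) ∈ Subtype.val ⁻¹' O :=
        hg ((z.eval_ne_zero_iff hz g).1 h0)
      rw [hOl] at hzO
      exact hzO hzl
    exact (y.eval_ne_zero_iff hyU g).2 hyg (hle hgi y hyS hyU hyl)
  -- After the reversal, the prime of index `0` belongs to the largest set of the chain; a function
  -- outside it is nonzero at a point of `S`.
  refine ⟨x₀, LTSeries.mk l.length (fun j => ⟨q (Fin.rev j), hprime _⟩)
    fun i j hij => hlt (Fin.rev_lt_rev.2 hij), hl, fun f hf => ?_⟩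
  obtain ⟨y, hyS, hy, hyl, hyf⟩ := hq _ f hf
  exact ⟨y, hyS, hy, fun r hr => hr y hyS hy hyl, hyf⟩

end Chains

end

section

/-! ### Parametrized lists of complexes -/

/-- A family of complexes, given by matrices over a finitely generated algebra `S`, with `n`
parameters which separate the points of `S`. -/
structure Param (k A : Type u) [Field k] [Ring A] [Algebra k A] where
  S : Type u
  [commRing : CommRing S]
  [algebra : Algebra k S]
  [finiteType : Algebra.FiniteType k S]
  n : ℕ
  l : Fin n → S
  sep : ∀ s s' : S →ₐ[k] k, (∀ j, s (l j) = s' (l j)) → s = s'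
  X : MatData A S

attribute [instance] Param.commRing Param.algebra Param.finiteType

variable {k A : Type u} [Field k] [Ring A] [Algebra k A]

/-- The complex `C` occurs in the family. -/
def Param.Realizes (p : Param k A) (C : ChainComplex (ModuleCat.{u} Aᵐᵒᵖ) ℤ) : Prop :=
  ∃ s : p.S →ₐ[k] k, RepBy C (p.X.map s)

theorem natCast_add_one_le_of_not_le {a : WithBot ℕ∞} {n : ℕ} (h : ¬ a ≤ (n : WithBot ℕ∞)) :
    ((n + 1 : ℕ) : WithBot ℕ∞) ≤ a := by
  induction a with
  | bot => exact (h bot_le).elim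
  | coe a =>
    rw [not_le] at h
    have h1 : ((n : ℕ∞) : WithBot ℕ∞) < a := h
    rw [WithBot.coe_lt_coe] at h1
    have h2 : (n : ℕ∞) + 1 ≤ a := (ENat.add_one_le_iff (ENat.natCast_ne_top n)).2 h1
    have h3 : (((n : ℕ∞) + 1 : ℕ∞) : WithBot ℕ∞) ≤ a := WithBot.coe_le_coe.2 h2
    exact_mod_cast h3

theorem le_of_add_natCast_le {a : WithBot ℕ∞} {n i : ℕ}
    (h : a + (i : WithBot ℕ∞) ≤ ((n + i : ℕ) : WithBot ℕ∞)) : a ≤ (n : WithBot ℕ∞) := by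
  induction a with
  | bot => exact bot_le
  | coe a =>
    have h1 : ((a + (i : ℕ∞) : ℕ∞) : WithBot ℕ∞) ≤ (((n : ℕ∞) + (i : ℕ∞) : ℕ∞) : WithBot ℕ∞) := by
      exact_mod_cast h
    rw [WithBot.coe_le_coe] at h1
    have h2 : a ≤ (n : ℕ∞) := (ENat.add_le_add_iff_right (ENat.natCast_ne_top i)).1 h1
    have h3 : (a : WithBot ℕ∞) ≤ ((n : ℕ∞) : WithBot ℕ∞) := WithBot.coe_le_coe.2 h2
    exact_mod_cast h3

-- These identities are not part of `MatData`; they follow from the matrices being `σ π`, `σ d π`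
-- and `σ a π` with `π σ = 1`.
open Matrix in
theorem RepBy.idem {C : ChainComplex (ModuleCat.{u} Aᵐᵒᵖ) ℤ} {X : MatData A k} (hC : RepBy C X) :
    (∀ i, X.e i * X.e i = X.e i) ∧ (∀ i j, X.e j * X.d i j = X.d i j) ∧
      (∀ i j, X.d i j * X.e i = X.d i j) ∧ (∀ i a, X.e i * X.a i a = X.a i a) ∧
      ∀ i a, X.a i a * X.e i = X.a i a := by
  classical
  obtain ⟨σ, π, hC⟩ := hC
  have hext {m n : Type} [Fintype m] [Fintype n] (M N : Matrix m n k) (h : ∀ v, M *ᵥ v = N *ᵥ v) :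
      M = N := Matrix.toLin'.injective (LinearMap.ext h)
  refine ⟨fun i => hext _ _ fun v => ?_, fun i j => hext _ _ fun v => ?_,
    fun i j => hext _ _ fun v => ?_, fun i a => hext _ _ fun v => ?_, fun i a => hext _ _ fun v => ?_⟩
  · rw [← mulVec_mulVec, ← hC.right, ← hC.right, hC.left]
  · rw [← mulVec_mulVec, ← hC.d, ← hC.right, hC.left]
  · rw [← mulVec_mulVec, ← hC.d, ← hC.d, ← hC.right, hC.left]
  · rw [← mulVec_mulVec, ← hC.act, ← hC.right, hC.left]
  · rw [← mulVec_mulVec, ← hC.act, ← hC.act, ← hC.right, hC.left]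

open Matrix in
/-- Complexes given by isomorphic matrices are isomorphic. -/
theorem RepBy.nonempty_iso_of_inter {C C' : ChainComplex (ModuleCat.{u} Aᵐᵒᵖ) ℤ}
    {X X' Y : MatData A k} (hC : RepBy C X) (hC' : RepBy C' X')
    (h : ∃ g h, X.Inter Y g h) (h' : ∃ g h, X'.Inter Y g h) : Nonempty (C ≅ C') := by
  obtain ⟨g₁, h₁, H₁⟩ := h
  obtain ⟨g₂, h₂, H₂⟩ := h'
  obtain ⟨hee, -, hde, -, hae⟩ := hC.idem
  obtain ⟨hee', hed', -, hea', -⟩ := hC'.idem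
  have hg {Z : MatData A k} {g h} (H : Z.Inter Y g h) (i) : g i * Z.e i = Y.e i * g i := by
    rw [← H.hg, ← Matrix.mul_assoc, H.gh]
  have hh {Z : MatData A k} {g h} (H : Z.Inter Y g h) (i) : h i * Y.e i = Z.e i * h i := by
    rw [← H.gh, ← Matrix.mul_assoc, H.hg]
  -- Nothing is assumed of `Y` itself, so the composite `h₂ g₁` is shown to commute with the
  -- structure using only the idempotent identities of `X` and `X'`.
  have key (i j : ℤ) (D : Matrix (X.I j) (X.I i) k) (DY : Matrix (Y.I j) (Y.I i) k)
      (D' : Matrix (X'.I j) (X'.I i) k) (h1 : g₁ j * D = DY * g₁ i) (h2 : g₂ j * D' = DY * g₂ i)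
      (h3 : D * X.e i = D) (h4 : X'.e j * D' = D') :
      h₂ j * g₁ j * D = D' * (h₂ i * g₁ i) := by
    calc h₂ j * g₁ j * D = h₂ j * (g₁ j * D) * X.e i := by
          rw [← Matrix.mul_assoc, Matrix.mul_assoc _ D, h3]
      _ = h₂ j * DY * (g₁ i * X.e i) := by rw [h1]; simp only [Matrix.mul_assoc]
      _ = h₂ j * (DY * g₂ i) * (h₂ i * g₁ i) := by
          rw [hg H₁, ← H₂.gh]; simp only [Matrix.mul_assoc]
      _ = h₂ j * g₂ j * D' * (h₂ i * g₁ i) := by rw [← h2]; simp only [Matrix.mul_assoc]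
      _ = D' * (h₂ i * g₁ i) := by rw [H₂.hg, h4]
  refine hC.nonempty_iso hC' (g := fun i => h₂ i * g₁ i) (h := fun i => h₁ i * g₂ i)
    ⟨fun i => ?_, fun i => ?_, fun i j => ?_, fun i a => ?_⟩
  · calc h₂ i * g₁ i * (h₁ i * g₂ i) = h₂ i * (g₁ i * h₁ i) * g₂ i := by
          simp only [Matrix.mul_assoc]
      _ = X'.e i := by rw [H₁.gh, hh H₂, Matrix.mul_assoc, H₂.hg, hee']
  · calc h₁ i * g₂ i * (h₂ i * g₁ i) = h₁ i * (g₂ i * h₂ i) * g₁ i := by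
          simp only [Matrix.mul_assoc]
      _ = X.e i := by rw [H₂.gh, hh H₁, Matrix.mul_assoc, H₁.hg, hee]
  · exact key i j _ _ _ (H₁.gd i j) (H₂.gd i j) (hde i j) (hed' i j)
  · exact key i i _ _ _ (H₁.ga i a) (H₂.ga i a) (hae i a) (hea' i a)

/-- If all members of a family over a variety occur in finitely many families with at most `N`
parameters, then the number of parameters of the family is at most `N`. -/
theorem VarietyFamily.par_le [IsAlgClosed k] [Module.Finite k A] {V : Variety k}
    (P : VarietyFamily k A V) {ι : Type u} [Finite ι] (p : ι → Param k A) {N : ℕ}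
    (hn : ∀ i, (p i).n ≤ N) (hcov : ∀ x, ∃ i, (p i).Realizes (P.fiber x)) :
    P.par ≤ (N : WithBot ℕ∞) := by
  refine sSup_le ?_
  rintro j ⟨i, hji⟩
  refine le_of_add_natCast_le (i := i) (hji.trans ?_)
  -- If `dim X_i > N + i`, then `X_i` carries a chain of length `N + i + 1`, visible as primes in
  -- one chart.
  by_contra hlt
  have hdim := natCast_add_one_le_of_not_le hlt
  have hc (x : V.Point) : IsAffineOpen (P.chart x) := (P.exists_chart x.pt).choose_spec.1
  obtain ⟨x₀, q, hq, hqS⟩ := exists_primes_of_le_dim P.chart hc P.mem_chart _ _ hdim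
  have hmin : IsMinimalFamily k Γ(V.X, P.chart x₀) A (P.sections (P.chart x₀)) :=
    (P.exists_chart x₀.pt).choose_spec.2.2
  let U := P.chart x₀
  have hU : IsAffineOpen U := hc x₀
  have hUfin : Algebra.FiniteType k Γ(V.X, U) := Variety.finiteType_sections hU
  obtain ⟨X, hX⟩ := exists_matData hmin
  let I : Ideal Γ(V.X, U) := (q 0).asIdeal
  have hI : I.IsPrime := (q 0).2
  -- `R` is the ring of functions on the largest member of the chain, so its dimension is at least
  -- `(i + 1) + N`.
  let R := Γ(V.X, U) ⧸ I
  let π : Γ(V.X, U) →ₐ[k] R := Ideal.Quotient.mkₐ k I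
  have hπ : Function.Surjective π := Ideal.Quotient.mkₐ_surjective k I
  have hRfin : Algebra.FiniteType k R := hUfin.of_surjective π hπ
  let Y : MatData A R := X.map π
  have hrep (x : R →ₐ[k] k) (y : V.Point) (hy : y.pt ∈ U) (h : ∀ r, x (π r) = y.eval hy r) :
      RepBy (P.fiber y) (Y.map x) := by
    refine hX (x.comp π) (P.fiber y) ?_
    have h1 : (x.comp π).toRingHom = y.eval hy := RingHom.ext h
    rw [h1]
    exact P.isFiber_fiber y hU hy
  have hdimR : (((i + 1) + N : ℕ) : WithBot ℕ∞) ≤ ringKrullDim R := by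
    let l : LTSeries (PrimeSpectrum.zeroLocus (I : Set Γ(V.X, U))) := LTSeries.mk q.length
      (fun j => ⟨q j, q.monotone (Fin.zero_le j)⟩) fun a b hab => q.strictMono hab
    rw [ringKrullDim_quotient, show i + 1 + N = N + i + 1 by ring, ← hq]
    exact Order.LTSeries.length_le_krullDim l
  -- The isomorphism varieties between the family over `Spec R` and the given families cover all
  -- points of `Spec R`. Their distinguished functions are the parameters of the given families, and
  -- `d = i + 1`.
  obtain ⟨f, hf, hmain⟩ := exists_chain_of_covering (k := k) (R := R)
    (fun a => InterRing k Y (p a).X) (fun a => (p a).n)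
    (fun a j => interFun k Y (p a).X ((p a).l j)) hn (fun x => by
      obtain ⟨y, hy, h⟩ := Variety.exists_point_eval hU (x.comp π)
      have h1 := hrep x y hy fun r => (h r).symm
      obtain ⟨a, s, hs⟩ := hcov y
      obtain ⟨g, h, hgh⟩ := h1.exists_inter hs (Iso.refl _)
      obtain ⟨w, hw, -⟩ := exists_point_of_inter k x s hgh
      exact ⟨a, w, hw⟩) hdimR
  obtain ⟨f', rfl⟩ := hπ f
  have hf' : f' ∉ I := fun h => hf (Ideal.Quotient.eq_zero_iff_mem.2 h)
  -- The generic statement holds where `f ≠ 0`, and such a point can be chosen inside `X_i`.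
  obtain ⟨y, hyi, hy, hyI, hyf⟩ := hqS f' hf'
  let x : R →ₐ[k] k := Ideal.Quotient.liftₐ I (y.evalₐ hy) hyI
  have hx (r) : x (π r) = y.eval hy r := rfl
  obtain ⟨a, w, hw, l, hl, hfl, hlift⟩ := hmain x (by rw [hx]; exact hyf)
  -- Equal parameter values mean the same point `s` of the given family. All fibres along this chain
  -- are thus isomorphic to that at `y`, so the isomorphism locus has dimension at least `i + 1`,
  -- contrary to `y ∈ X_i`.
  have hlow := le_dim_of_chain hU π hπ (π f') l hfl (P.isoLocus y) fun y' hy' φ hφ hφf hφl => by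
    obtain ⟨w', hw', hww⟩ := hlift φ hφf hφl
    have hs : w.comp (interFun k Y (p a).X) = w'.comp (interFun k Y (p a).X) :=
      (p a).sep _ _ fun j => (hww j).symm
    have h1 := exists_inter_of_point k w x hw (w.comp (interFun k Y (p a).X)) fun r => rfl
    have h2 := exists_inter_of_point k w' φ hw' (w'.comp (interFun k Y (p a).X)) fun r => rfl
    rw [← hs] at h2
    exact (hrep φ y' hy' hφ).nonempty_iso_of_inter (hrep x y hy hx) h2 h1
  have hle : ((i + 1 : ℕ) : WithBot ℕ∞) ≤ (i : WithBot ℕ∞) := by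
    rw [← hl]
    exact hlow.trans hyi
  have : i + 1 ≤ i := by exact_mod_cast hle
  omega

end

section

/-! ### Tensor products with finite-dimensional modules are minimal complexes -/

theorem lid_smul_baseObj {k B A : Type u} [Field k] [Ring B] [Algebra k B]
    [Ring A] [Algebra k A] {L : Type u} [AddCommGroup L] [Module k L] [Module Bᵐᵒᵖ L]
    [IsScalarTower k Bᵐᵒᵖ L] [SMulCommClass k Bᵐᵒᵖ L] (M : ModuleCat.{u} (B ⊗[k] Aᵐᵒᵖ))
    (r : k ⊗[k] Aᵐᵒᵖ) (z : BaseObj k L M) :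
    r • z = Algebra.TensorProduct.lid k Aᵐᵒᵖ r • z := by
  induction r using TensorProduct.induction_on with
  | zero => rw [map_zero]; exact (zero_smul (k ⊗[k] Aᵐᵒᵖ) z).trans (zero_smul Aᵐᵒᵖ z).symm
  | add r r' h h' => rw [add_smul, map_add, add_smul, h, h']
  | tmul c a =>
    rw [Algebra.TensorProduct.lid_tmul, smul_assoc]
    change actS k L M c (a • z) = _
    have h := (actS k L M).commutes c
    rw [Algebra.algebraMap_self_apply] at h
    rw [h]
    rfl

/-- The case `S = k` of base change, with `k ⊗ Aᵐᵒᵖ` identified with `Aᵐᵒᵖ`. -/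
theorem IsMinimalFamily.isMinimal_tensorComplex {k B A : Type u} [Field k] [Ring B] [Algebra k B]
    [Ring A] [Algebra k A] {P : ChainComplex (ModuleCat.{u} (B ⊗[k] Aᵐᵒᵖ)) ℤ}
    (hP : IsMinimalFamily k B A P) (L : Type u) [AddCommGroup L] [Module k L] [Module Bᵐᵒᵖ L]
    [IsScalarTower k Bᵐᵒᵖ L] [Module.Finite k L] : IsMinimal (tensorComplex L P) := by
  have hcomm : SMulCommClass k Bᵐᵒᵖ L := IsScalarTower.to_smulCommClass
  have h := baseComplex_isMinimalFamily k L hP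
  refine IsMinimalOver.of_ringEquiv (Algebra.TensorProduct.lid k Aᵐᵒᵖ).toRingEquiv ?_
    (C := baseComplex k L P) (C' := tensorComplex L P)
    (fun i => (AddEquiv.refl (BaseObj k L (P.X i)) : _)) ?_ (fun i j m => rfl) h
  · rintro _ ⟨r, hr, rfl⟩
    change ((Algebra.TensorProduct.lid k Aᵐᵒᵖ) ((1 : k) ⊗ₜ[k] op r) : Aᵐᵒᵖ).unop ∈
      Ring.jacobson A
    rw [Algebra.TensorProduct.lid_tmul, one_smul]
    exact hr
  · intro i r m
    exact lid_smul_baseObj (P.X i) r m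

/-! ### Retracts -/

section Retract

variable {R : Type u} [Ring R]

/-- The module `M` is a direct summand of `N`. -/
def IsRetract (R : Type u) [Ring R] (M N : Type u) [AddCommGroup M] [Module R M] [AddCommGroup N]
    [Module R N] : Prop :=
  ∃ (s : M →ₗ[R] N) (p : N →ₗ[R] M), p ∘ₗ s = LinearMap.id

theorem IsRetract.trans {M N L : Type u} [AddCommGroup M] [Module R M] [AddCommGroup N]
    [Module R N] [AddCommGroup L] [Module R L] (h : IsRetract R M N) (h' : IsRetract R N L) :
    IsRetract R M L := by
  obtain ⟨s, p, hsp⟩ := h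
  obtain ⟨s', p', hsp'⟩ := h'
  refine ⟨s' ∘ₗ s, p ∘ₗ p', LinearMap.ext fun x => ?_⟩
  change p (p' (s' (s x))) = x
  rw [show p' (s' (s x)) = s x from LinearMap.congr_fun hsp' _]
  exact LinearMap.congr_fun hsp _

theorem IsRetract.of_equiv {M N : Type u} [AddCommGroup M] [Module R M] [AddCommGroup N]
    [Module R N] (e : M ≃ₗ[R] N) : IsRetract R M N :=
  ⟨e, e.symm, LinearMap.ext fun x => e.symm_apply_apply x⟩

-- For idempotents, `u = 1 - e + e' (2 e - 1)` satisfies `u e = e' u`, so `e` and `e'` are conjugate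
-- where `det u ≠ 0`; and `u = 1` if `e = e'`. The determinants are polynomials in the entries of
-- `e'`, and finitely many of them generate the ideal of all. As the one of `e'` is nonzero at `e'`,
-- so is one of the finitely many.
open Matrix in
theorem exists_finite_cover_idempotent {k : Type u} [Field k] {n : ℕ}
    (E : Set (Matrix (Fin n) (Fin n) k)) (hE : ∀ e ∈ E, e * e = e) :
    ∃ F ⊆ E, F.Finite ∧ ∀ e' ∈ E, ∃ e ∈ F, (1 - e + e' * (2 * e - 1)).det ≠ 0 := by
  classical
  let p (e : Matrix (Fin n) (Fin n) k) : MvPolynomial (Fin n × Fin n) k :=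
    ((1 - e).map MvPolynomial.C + mvPolynomialX (Fin n) (Fin n) k *
      (2 * e - 1).map MvPolynomial.C).det
  have hp (e e' : Matrix (Fin n) (Fin n) k) :
      MvPolynomial.eval (fun ij => e' ij.1 ij.2) (p e) = (1 - e + e' * (2 * e - 1)).det := by
    rw [RingHom.map_det]
    congr 1
    rw [map_add, map_mul]
    congr 1
    · ext i j
      simp
    · congr 1
      · ext i j
        simp
      · ext i j
        simp
  obtain ⟨F, hF, hspan⟩ := (Submodule.fg_span_iff_fg_span_finset_subset
    (R := MvPolynomial (Fin n × Fin n) k) (p '' E)).1 (IsNoetherian.noetherian _)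
  obtain ⟨F', hF'E, hF'⟩ := Finset.subset_set_image_iff.1 hF
  refine ⟨F', hF'E, F'.finite_toSet, fun e' he' => ?_⟩
  by_contra! hcon
  have h1 : p e' ∈ Submodule.span (MvPolynomial (Fin n × Fin n) k) (F : Set _) :=
    hspan ▸ Submodule.subset_span ⟨e', he', rfl⟩
  have h2 : (F : Set (MvPolynomial (Fin n × Fin n) k)) ⊆
      RingHom.ker (MvPolynomial.eval (fun ij : Fin n × Fin n => e' ij.1 ij.2)) := by
    intro q hq
    rw [Finset.mem_coe, ← hF'] at hq
    obtain ⟨e, he, rfl⟩ := Finset.mem_image.1 hq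
    exact (hp e e').trans (hcon e he)
  have h3 : MvPolynomial.eval (fun ij => e' ij.1 ij.2) (p e') = 0 := Submodule.span_le.2 h2 h1
  rw [hp, mul_sub, mul_one, two_mul, mul_add, hE e' he', add_sub_cancel_right,
    sub_add_cancel, det_one] at h3
  exact one_ne_zero h3

/-- The comparison element is a polynomial in `f` and `g`, so it stays in `End_R N`, and the
statement on matrices over `k` restricts to `R`-linear idempotents. -/
theorem exists_finite_cover_endomorphism (k : Type u) [Field k] [Algebra k R] (N : Type u)
    [AddCommGroup N] [Module R N] [Module k N] [IsScalarTower k R N] [Module.Finite k N] :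
    ∃ F : Set (Module.End R N), F.Finite ∧ (∀ f ∈ F, f * f = f) ∧
      ∀ g : Module.End R N, g * g = g → ∃ f ∈ F, Function.Bijective (1 - f + g * (2 * f - 1) : Module.End R N) := by
  let β := Module.finBasis k N
  let ρ : Module.End R N →+* Module.End k N :=
    { toFun := fun f => f.restrictScalars k
      map_one' := rfl
      map_mul' := fun _ _ => rfl
      map_zero' := rfl
      map_add' := fun _ _ => rfl }
  have hρ : Function.Injective ρ := LinearMap.restrictScalars_injective k
  obtain ⟨μ, hμ⟩ : ∃ μ : Module.End k N →+* Matrix (Fin (Module.finrank k N))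
      (Fin (Module.finrank k N)) k, ∀ f, μ f = LinearMap.toMatrix β β f :=
    ⟨(LinearMap.toMatrixAlgEquiv β).toRingEquiv.toRingHom, fun f => rfl⟩
  have hμinj : Function.Injective μ := fun f g h => by
    rw [hμ, hμ] at h
    exact (LinearMap.toMatrix β β).injective h
  obtain ⟨F, hFE, hF, hcov⟩ := exists_finite_cover_idempotent
      ((fun f => μ (ρ f)) '' {f | f * f = f}) (by
    rintro _ ⟨f, hf, rfl⟩
    change μ (ρ f) * μ (ρ f) = μ (ρ f)
    rw [← map_mul, ← map_mul, hf])
  refine ⟨(fun f => μ (ρ f)) ⁻¹' F, hF.preimage (hμinj.comp hρ).injOn, fun f hf => ?_,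
    fun g hg => ?_⟩
  · obtain ⟨f', hf', h⟩ := hFE hf
    rwa [hρ (hμinj h)] at hf'
  · obtain ⟨e, heF, hdet⟩ := hcov _ ⟨g, hg, rfl⟩
    obtain ⟨f, hf, rfl⟩ := hFE heF
    refine ⟨f, heF, ?_⟩
    have h1 : 1 - μ (ρ f) + μ (ρ g) * (2 * μ (ρ f) - 1) = μ (ρ (1 - f + g * (2 * f - 1))) := by
      simp only [map_add, map_sub, map_mul, map_one, map_ofNat]
    change (1 - μ (ρ f) + μ (ρ g) * (2 * μ (ρ f) - 1)).det ≠ 0 at hdet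
    rw [h1, hμ] at hdet
    exact (LinearEquiv.ofIsUnitDet hdet.isUnit).bijective

/-- A finite-dimensional module has only finitely many direct summands, up to isomorphism. -/
theorem exists_finite_retracts (k : Type u) [Field k] [Algebra k R] (N : Type u) [AddCommGroup N]
    [Module R N] [Module k N] [IsScalarTower k R N] [Module.Finite k N] :
    ∃ T : Set (Submodule R N), T.Finite ∧ ∀ (M : Type u) [AddCommGroup M] [Module R M],
      IsRetract R M N → ∃ K ∈ T, Nonempty (M ≃ₗ[R] K) := by
  obtain ⟨F, hF, hidem, hcov⟩ := exists_finite_cover_endomorphism (R := R) k N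
  refine ⟨LinearMap.range '' F, hF.image _, fun M _ _ h => ?_⟩
  obtain ⟨s, p, hsp⟩ := h
  have hps (m) : p (s m) = m := LinearMap.congr_fun hsp m
  have hf' : (s ∘ₗ p : Module.End R N) * (s ∘ₗ p) = s ∘ₗ p :=
    LinearMap.ext fun x => congrArg s (hps (p x))
  obtain ⟨f, heF, hbij⟩ := hcov _ hf'
  have hf1 (x) : f (f x) = f x := LinearMap.congr_fun (hidem f heF) x
  set w : Module.End R N := 1 - f + (s ∘ₗ p : Module.End R N) * (2 * f - 1) with hw
  have hw1 (x) : w x = x - f x + s (p (f x + f x - x)) := by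
    rw [hw, two_mul]
    rfl
  -- The bijection `w` intertwines the idempotents `f` and `s p`, so it carries the image of `f`
  -- onto that of `s`, which is `M`.
  have hwf (x) : w (f x) = s (p (w x)) := by
    rw [hw1, hw1, map_add p, hps, hf1, sub_self, zero_add, add_sub_cancel_right, ← map_add p]
    congr 2
    abel
  let φ : LinearMap.range f →ₗ[R] M := p ∘ₗ w ∘ₗ (LinearMap.range f).subtype
  have hφ (x : LinearMap.range f) : φ x = p (w x) := rfl
  refine ⟨_, ⟨f, heF, rfl⟩, ⟨(LinearEquiv.ofBijective φ ⟨?_, fun m => ?_⟩).symm⟩⟩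
  · refine (injective_iff_map_eq_zero φ).2 ?_
    rintro ⟨_, x, rfl⟩ hx
    rw [hφ] at hx
    change p (w (f x)) = 0 at hx
    rw [hwf, hps] at hx
    refine Subtype.ext (hbij.1 ?_)
    change w (f x) = w 0
    rw [hwf, hx, map_zero, map_zero]
  · obtain ⟨y, hy⟩ := hbij.2 (s m)
    refine ⟨⟨f y, y, rfl⟩, ?_⟩
    rw [hφ]
    change p (w (f y)) = m
    rw [hwf, hps, hy, hps]

end Retract

end

section

/-! ### Minimal complexes of bounded rank -/

theorem retract_apply {R : Type u} [Ring R] {C D : ChainComplex (ModuleCat.{u} R) ℤ}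
    {s : D ⟶ C} {p : C ⟶ D} (h : s ≫ p = 𝟙 D) (i : ℤ) (x : D.X i) : p.f i (s.f i x) = x :=
  congrArg (fun f : D ⟶ D => f.f i x) h

theorem IsMinimalOver.of_retract {R : Type u} [Ring R] {J : Set R}
    {C D : ChainComplex (ModuleCat.{u} R) ℤ} (hC : IsMinimalOver J C) (s : D ⟶ C) (p : C ⟶ D)
    (h : s ≫ p = 𝟙 D) : IsMinimalOver J D where
  bounded := by
    obtain ⟨m, n, hz⟩ := hC.bounded
    refine ⟨m, n, fun i hi => ?_⟩
    have := ModuleCat.subsingleton_of_isZero (hz i hi)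
    have : Subsingleton (D.X i) := ⟨fun x y => by
      rw [← retract_apply h i x, ← retract_apply h i y, Subsingleton.elim (s.f i x) (s.f i y)]⟩
    exact ModuleCat.isZero_of_subsingleton _
  finite i := by
    have := hC.finite i
    exact Module.Finite.of_surjective (p.f i).hom fun x => ⟨_, retract_apply h i x⟩
  projective i := by
    have := hC.projective i
    exact Module.Projective.of_split (s.f i).hom (p.f i).hom
      (LinearMap.ext fun x => retract_apply h i x)
  minimal i j x := by
    have h1 := hC.minimal i j (s.f i x)
    have h2 : D.d i j x = p.f j (C.d i j (s.f i x)) := by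
      conv_lhs => rw [← retract_apply h i x]
      exact congrArg (fun f : C.X i ⟶ D.X j => f (s.f i x)) (p.comm i j)
    rw [h2]
    generalize C.d i j (s.f i x) = y at h1 ⊢
    induction h1 using Submodule.span_induction with
    | mem y hy =>
      obtain ⟨r, hr, m, rfl⟩ := hy
      exact Submodule.subset_span ⟨r, hr, p.f j m, (p.f j).hom.map_smul r m⟩
    | zero => rw [map_zero]; exact Submodule.zero_mem _
    | add y z _ _ hy hz => rw [map_add]; exact Submodule.add_mem _ hy hz
    | smul r y _ hy =>
      have h3 : p.f j (r • y) = r • p.f j y := (p.f j).hom.map_smul r y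
      rw [h3]
      exact Submodule.smul_mem _ _ hy

/-- The complex `C` is minimal, and its terms are direct summands of the free modules of the ranks
`b i`. -/
structure InClass {A : Type u} [Ring A] (b : ℤ →₀ ℕ) (C : ChainComplex (ModuleCat.{u} Aᵐᵒᵖ) ℤ) :
    Prop where
  isMinimal : IsMinimal C
  isRetract : ∀ i, IsRetract Aᵐᵒᵖ (C.X i) (Fin (b i) → A)

variable {A : Type u} [Ring A] {b : ℤ →₀ ℕ} {C D : ChainComplex (ModuleCat.{u} Aᵐᵒᵖ) ℤ}

theorem InClass.of_retract (hC : InClass b C) (s : D ⟶ C) (p : C ⟶ D) (h : s ≫ p = 𝟙 D) :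
    InClass b D where
  isMinimal := IsMinimalOver.of_retract hC.isMinimal s p h
  isRetract i := IsRetract.trans ⟨(s.f i).hom, (p.f i).hom, LinearMap.ext (retract_apply h i)⟩
    (hC.isRetract i)

theorem InClass.of_iso (hC : InClass b C) (e : C ≅ D) : InClass b D :=
  hC.of_retract e.inv e.hom e.inv_hom_id

theorem InClass.subsingleton (hC : InClass b C) {i : ℤ} (hi : i ∉ b.support) :
    Subsingleton (C.X i) := by
  obtain ⟨s, p, h⟩ := hC.isRetract i
  have h0 : b i = 0 := Finsupp.notMem_support_iff.1 hi
  have : IsEmpty (Fin (b i)) := by rw [h0]; infer_instance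
  exact ⟨fun x y => by
    rw [← LinearMap.id_apply (R := Aᵐᵒᵖ) x, ← LinearMap.id_apply (R := Aᵐᵒᵖ) y, ← h]
    exact congrArg p (Subsingleton.elim (s x) (s y))⟩

/-- There are only finitely many vector ranks of complexes in the class. -/
theorem exists_finite_ranks (k : Type u) [Field k] [Algebra k A] [Module.Finite k A]
    (b : ℤ →₀ ℕ) : ∃ T : Set (VectorRank A), T.Finite ∧
      ∀ C : ChainComplex (ModuleCat.{u} Aᵐᵒᵖ) ℤ, InClass b C → ∃ r ∈ T, HasVectorRank C r := by
  choose T hT hcov using fun i => exists_finite_retracts (R := Aᵐᵒᵖ) k (Fin (b i) → A)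
  let g (K : ∀ i : b.support, Submodule Aᵐᵒᵖ (Fin (b i) → A)) : VectorRank A := fun i =>
    if h : i ∈ b.support then ModuleCat.of Aᵐᵒᵖ (K ⟨i, h⟩) else ModuleCat.of Aᵐᵒᵖ PUnit
  refine ⟨g '' (Set.univ.pi fun i : b.support => T i), (Set.Finite.pi fun i : b.support => hT i).image _, ?_⟩
  · intro C hC
    choose K hK hKe using fun i => hcov i (C.X i) (hC.isRetract i)
    refine ⟨_, ⟨fun i => K i, fun i _ => hK i, rfl⟩, fun i => ?_⟩
    by_cases h : i ∈ b.support
    · obtain ⟨e⟩ := hKe i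
      refine ⟨?_⟩
      simp only [g, dif_pos h]
      exact e.toModuleIso
    · have := hC.subsingleton h
      refine ⟨?_⟩
      simp only [g, dif_neg h]
      exact (ModuleCat.isZero_of_subsingleton _).iso (ModuleCat.isZero_of_subsingleton _)

/-- The dimension over `k` of a right `A`-module. -/
def kdim (k : Type u) [Field k] [Algebra k A] (M : ModuleCat.{u} Aᵐᵒᵖ) : ℕ :=
  letI : Module k M := Module.compHom M (algebraMap k Aᵐᵒᵖ)
  Module.finrank k M

section kdim

variable (k : Type u) [Field k] [Algebra k A]

theorem finrank_le_kdim [Module.Finite k A] (M : ModuleCat.{u} Aᵐᵒᵖ) [Module.Finite Aᵐᵒᵖ M]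
    {L : Type u} [AddCommGroup L] [Module k L] (f : L →+ M) (hf : Function.Injective f)
    (hlin : ∀ (c : k) l, f (c • l) = algebraMap k Aᵐᵒᵖ c • f l) : Module.finrank k L ≤ kdim k M := by
  let _ : Module k M := Module.compHom M (algebraMap k Aᵐᵒᵖ)
  have : IsScalarTower k Aᵐᵒᵖ M := ⟨fun c a m => by
    rw [Algebra.smul_def, mul_smul]
    rfl⟩
  have : Module.Finite k M := Module.Finite.trans Aᵐᵒᵖ M
  exact LinearMap.finrank_le_finrank_of_injective (f := { f with map_smul' := hlin }) hf

theorem kdim_eq_of_iso {M N : ModuleCat.{u} Aᵐᵒᵖ} (e : M ≅ N) : kdim k M = kdim k N := by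
  let _ : Module k M := Module.compHom M (algebraMap k Aᵐᵒᵖ)
  let _ : Module k N := Module.compHom N (algebraMap k Aᵐᵒᵖ)
  exact LinearEquiv.finrank_eq { e.toLinearEquiv with
    map_smul' := fun c m => e.toLinearEquiv.map_smul (algebraMap k Aᵐᵒᵖ c) m }

theorem kdim_pos [Module.Finite k A] (M : ModuleCat.{u} Aᵐᵒᵖ) [Module.Finite Aᵐᵒᵖ M]
    (h : ¬ Subsingleton M) : 0 < kdim k M := by
  let _ : Module k M := Module.compHom M (algebraMap k Aᵐᵒᵖ)
  have : IsScalarTower k Aᵐᵒᵖ M := ⟨fun c a m => by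
    rw [Algebra.smul_def, mul_smul]
    rfl⟩
  have : Module.Finite k M := Module.Finite.trans Aᵐᵒᵖ M
  have : Nontrivial M := not_subsingleton_iff_nontrivial.1 h
  exact Module.finrank_pos

theorem kdim_prod [Module.Finite k A] (M N : ModuleCat.{u} Aᵐᵒᵖ) [Module.Finite Aᵐᵒᵖ M]
    [Module.Finite Aᵐᵒᵖ N] : kdim k (ModuleCat.of Aᵐᵒᵖ (M × N)) = kdim k M + kdim k N := by
  let _ : Module k M := Module.compHom M (algebraMap k Aᵐᵒᵖ)
  let _ : Module k N := Module.compHom N (algebraMap k Aᵐᵒᵖ)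
  have : IsScalarTower k Aᵐᵒᵖ M := ⟨fun c a m => by
    rw [Algebra.smul_def, mul_smul]
    rfl⟩
  have : IsScalarTower k Aᵐᵒᵖ N := ⟨fun c a m => by
    rw [Algebra.smul_def, mul_smul]
    rfl⟩
  have : Module.Finite k M := Module.Finite.trans Aᵐᵒᵖ M
  have : Module.Finite k N := Module.Finite.trans Aᵐᵒᵖ N
  exact Module.finrank_prod

theorem kdim_free [Module.Finite k A] (n : ℕ) :
    kdim k (ModuleCat.of Aᵐᵒᵖ (Fin n → A)) = n * Module.finrank k A := by
  -- `kdim` lets `k` act by right multiplication; centrality of `k` identifies this with the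
  -- coordinatewise action.
  have h : (Module.compHom (Fin n → A) (algebraMap k Aᵐᵒᵖ) : Module k (Fin n → A)) =
      Pi.module (Fin n) (fun _ => A) k := by
    refine Module.ext' _ _ fun c v => funext fun i => ?_
    change v i * algebraMap k A c = c • v i
    rw [Algebra.smul_def, Algebra.commutes]
  have h1 : kdim k (ModuleCat.of Aᵐᵒᵖ (Fin n → A)) = Module.finrank k (Fin n → A) :=
    congrArg (fun i : Module k (Fin n → A) => @Module.finrank k (Fin n → A) _ _ i) h
  rw [h1, Module.finrank_pi_fintype]
  simp

/-- The total dimension of a complex in the class. -/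
def tdim (b : ℤ →₀ ℕ) (C : ChainComplex (ModuleCat.{u} Aᵐᵒᵖ) ℤ) : ℕ :=
  ∑ i ∈ b.support, kdim k (C.X i)

theorem tdim_eq_of_iso (e : C ≅ D) : tdim k b C = tdim k b D :=
  Finset.sum_congr rfl fun i _ =>
    kdim_eq_of_iso k ((HomologicalComplex.eval (ModuleCat.{u} Aᵐᵒᵖ) _ i).mapIso e)

theorem tdim_biprod [Module.Finite k A] (hC : InClass b C) (hD : InClass b D) :
    tdim k b (C ⊞ D) = tdim k b C + tdim k b D := by
  rw [tdim, tdim, tdim, ← Finset.sum_add_distrib]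
  refine Finset.sum_congr rfl fun i _ => ?_
  have := hC.isMinimal.finite i
  have := hD.isMinimal.finite i
  rw [← kdim_prod]
  exact kdim_eq_of_iso k (((HomologicalComplex.eval (ModuleCat.{u} Aᵐᵒᵖ) _ i).mapBiprod C D).trans
    (ModuleCat.biprodIsoProd _ _))

theorem InClass.tdim_pos [Module.Finite k A] (hC : InClass b C) (h : ¬ IsZero C) :
    0 < tdim k b C := by
  by_contra! hle
  refine h ?_
  rw [IsZero.iff_id_eq_zero]
  ext i x
  by_cases hi : i ∈ b.support
  · by_contra hx
    have := hC.isMinimal.finite i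
    have h1 : ¬ Subsingleton (C.X i) := fun _ => hx (Subsingleton.elim _ _)
    have h2 := kdim_pos k (C.X i) h1
    have h3 : kdim k (C.X i) ≤ tdim k b C :=
      Finset.single_le_sum (f := fun i => kdim k (C.X i)) (fun _ _ => Nat.zero_le _) hi
    omega
  · have := hC.subsingleton hi
    exact Subsingleton.elim _ _

end kdim

end

section

/-! ### Classes of complexes covered by finitely many parametrizations -/

section FinCovered

variable {k A : Type u} [Field k] [Ring A] [Algebra k A]
  {C D : ChainComplex (ModuleCat.{u} Aᵐᵒᵖ) ℤ}

theorem Param.Realizes.of_iso {p : Param k A} (h : p.Realizes C) (e : C ≅ D) : p.Realizes D := by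
  obtain ⟨s, hs⟩ := h
  exact ⟨s, hs.of_iso e⟩

open Matrix in
/-- A minimal complex is described by matrices. -/
theorem IsMinimal.exists_repBy [Module.Finite k A] (hC : IsMinimal C) :
    ∃ X : MatData A k, RepBy C X := by
  let _ (i : ℤ) : Module k (C.X i) := Module.compHom (C.X i) (algebraMap k Aᵐᵒᵖ)
  have hst (i : ℤ) : IsScalarTower k Aᵐᵒᵖ (C.X i) := ⟨fun c a m => by
    rw [Algebra.smul_def, mul_smul]
    rfl⟩
  have hfin (i : ℤ) : Module.Finite k (C.X i) := by
    have := hC.finite i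
    exact Module.Finite.trans Aᵐᵒᵖ (C.X i)
  let E (i : ℤ) : C.X i ≃ₗ[k] (Fin (Module.finrank k (C.X i)) → k) :=
    (Module.finBasis k (C.X i)).equivFun
  have hI : Finite (Σ i, Fin (Module.finrank k (C.X i))) := by
    obtain ⟨m, n, h⟩ := hC.bounded
    refine Finite.of_injective
      (β := Σ i : Set.Icc m n, Fin (Module.finrank k (C.X i))) (fun y => ⟨⟨y.1, ?_⟩, y.2⟩) ?_
    · by_contra hy
      rw [Set.mem_Icc, not_and_or, not_le, not_le] at hy
      have := ModuleCat.subsingleton_of_isZero (h y.1 hy)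
      have h0 : Module.finrank k (C.X y.1) = 0 := Module.finrank_zero_of_subsingleton
      exact (Fin.elim0 (h0 ▸ y.2 : Fin 0))
    · rintro ⟨i, y⟩ ⟨j, z⟩ h
      simp only [Sigma.mk.injEq, Subtype.mk.injEq] at h
      obtain ⟨rfl, h⟩ := h
      rw [eq_of_heq h]
  have hlin (i : ℤ) (c : k) (m : C.X i) : c • m = algebraMap k Aᵐᵒᵖ c • m := rfl
  let dk (i j : ℤ) : C.X i →ₗ[k] C.X j := (C.d i j).hom.restrictScalars k
  let ak (i : ℤ) (a : Aᵐᵒᵖ) : C.X i →ₗ[k] C.X i := Algebra.lsmul k k (C.X i) a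
  refine ⟨{ I := fun i => Fin (Module.finrank k (C.X i))
            finite := hI
            e := fun i => 1
            d := fun i j => LinearMap.toMatrix' ((E j).toLinearMap ∘ₗ dk i j ∘ₗ (E i).symm.toLinearMap)
            a := fun i a => LinearMap.toMatrix'
              ((E i).toLinearMap ∘ₗ ak i a ∘ₗ (E i).symm.toLinearMap) },
    fun i => (E i).toAddEquiv.toAddMonoidHom, fun i => (E i).symm.toAddEquiv.toAddMonoidHom,
    fun i x => (E i).symm_apply_apply x, fun i v => ?_, fun i c x => (E i).map_smul c x,
    fun i j v => ?_, fun i a v => ?_⟩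
  · exact ((E i).apply_symm_apply v).trans (one_mulVec v).symm
  · exact (LinearMap.toMatrix'_mulVec
      ((E j).toLinearMap ∘ₗ dk i j ∘ₗ (E i).symm.toLinearMap) v).symm
  · exact (LinearMap.toMatrix'_mulVec
      ((E i).toLinearMap ∘ₗ ak i a ∘ₗ (E i).symm.toLinearMap) v).symm

/-- The parametrization of a single complex. -/
abbrev Param.const (X : MatData A k) : Param k A where
  S := k
  n := 0
  l := Fin.elim0
  sep _ _ _ := Subsingleton.elim _ _
  X := X

theorem Param.const_realizes {X : MatData A k} (h : RepBy C X) : (Param.const X).Realizes C :=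
  ⟨AlgHom.id k k, h⟩

/-- The parametrization of the direct sums of two parametrized complexes. -/
abbrev Param.sum (p q : Param k A) : Param k A where
  S := p.S ⊗[k] q.S
  finiteType := by
    have := Algebra.FiniteType.baseChange (A := q.S) p.S (R := k)
    exact Algebra.FiniteType.trans (S := p.S) p.finiteType this
  n := p.n + q.n
  l := Fin.append (fun j => p.l j ⊗ₜ 1) (fun j => 1 ⊗ₜ q.l j)
  sep s s' h := by
    refine Algebra.TensorProduct.ext (p.sep _ _ fun j => ?_) (q.sep _ _ fun j => ?_)
    · have := h (Fin.castAdd q.n j)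
      rwa [Fin.append_left] at this
    · have := h (Fin.natAdd p.n j)
      rwa [Fin.append_right] at this
  X := (p.X.map (Algebra.TensorProduct.includeLeft : p.S →ₐ[k] p.S ⊗[k] q.S)).sum
    (q.X.map (Algebra.TensorProduct.includeRight : q.S →ₐ[k] p.S ⊗[k] q.S))

theorem Param.sum_realizes {p q : Param k A} (hC : p.Realizes C) (hD : q.Realizes D) :
    (p.sum q).Realizes (C ⊞ D) := by
  obtain ⟨s, hs⟩ := hC
  obtain ⟨t, ht⟩ := hD
  refine ⟨Algebra.TensorProduct.productMap s t, ?_⟩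
  have h := hs.sum ht
  have h1 : (Algebra.TensorProduct.productMap s t) ∘
      (Algebra.TensorProduct.includeLeft : p.S →ₐ[k] p.S ⊗[k] q.S) = s :=
    funext fun x => by simp
  have h2 : (Algebra.TensorProduct.productMap s t) ∘
      (Algebra.TensorProduct.includeRight : q.S →ₐ[k] p.S ⊗[k] q.S) = t :=
    funext fun x => by simp
  convert h using 1
  simp only [MatData.map, MatData.sum, Matrix.fromBlocks_map, Matrix.map_map, h1, h2,
    Matrix.map_zero _ (map_zero _)]

/-- The class `𝒞` is covered by finitely many parametrizations with at most `n` parameters. -/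
def FinCovered (k : Type u) {A : Type u} [Field k] [Ring A] [Algebra k A] (n : ℕ)
    (𝒞 : Set (ChainComplex (ModuleCat.{u} Aᵐᵒᵖ) ℤ)) : Prop :=
  ∃ T : Set (Param k A), T.Finite ∧ (∀ p ∈ T, p.n ≤ n) ∧ ∀ C ∈ 𝒞, ∃ p ∈ T, p.Realizes C

variable {n m : ℕ} {𝒞 𝒟 : Set (ChainComplex (ModuleCat.{u} Aᵐᵒᵖ) ℤ)}

theorem FinCovered.mono (h : FinCovered k n 𝒞) (hnm : n ≤ m) (hs : 𝒟 ⊆ 𝒞) :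
    FinCovered k m 𝒟 := by
  obtain ⟨T, hT, hn, hc⟩ := h
  exact ⟨T, hT, fun p hp => (hn p hp).trans hnm, fun C hC => hc C (hs hC)⟩

theorem FinCovered.biUnion {ι : Type*} {I : Set ι} (hI : I.Finite)
    {𝒞 : ι → Set (ChainComplex (ModuleCat.{u} Aᵐᵒᵖ) ℤ)} (h : ∀ i ∈ I, FinCovered k n (𝒞 i)) :
    FinCovered k n (⋃ i ∈ I, 𝒞 i) := by
  choose! T hT hn hc using h
  refine ⟨⋃ i ∈ I, T i, hI.biUnion hT, fun p hp => ?_, fun C hC => ?_⟩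
  · obtain ⟨i, hi, hp⟩ := Set.mem_iUnion₂.1 hp
    exact hn i hi p hp
  · obtain ⟨i, hi, hC⟩ := Set.mem_iUnion₂.1 hC
    obtain ⟨p, hp, hpC⟩ := hc i hi C hC
    exact ⟨p, Set.mem_iUnion₂.2 ⟨i, hi, hp⟩, hpC⟩

theorem FinCovered.union (h : FinCovered k n 𝒞) (h' : FinCovered k n 𝒟) :
    FinCovered k n (𝒞 ∪ 𝒟) := by
  obtain ⟨T, hT, hn, hc⟩ := h
  obtain ⟨T', hT', hn', hc'⟩ := h'
  refine ⟨T ∪ T', hT.union hT', fun p hp => hp.elim (hn p) (hn' p), fun C hC => ?_⟩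
  rcases hC with hC | hC
  · obtain ⟨p, hp, h⟩ := hc C hC
    exact ⟨p, Or.inl hp, h⟩
  · obtain ⟨p, hp, h⟩ := hc' C hC
    exact ⟨p, Or.inr hp, h⟩

theorem FinCovered.isoClass [Module.Finite k A] (hC : IsMinimal C) :
    FinCovered k 0 {D | Nonempty (C ≅ D)} := by
  obtain ⟨X, hX⟩ := hC.exists_repBy (k := k)
  exact ⟨{Param.const X}, Set.finite_singleton _, fun p hp => by rw [hp], fun D ⟨e⟩ =>
    ⟨_, rfl, (Param.const_realizes hX).of_iso e⟩⟩

theorem FinCovered.sum (h : FinCovered k n 𝒞) (h' : FinCovered k m 𝒟) :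
    FinCovered k (n + m) {E | ∃ C ∈ 𝒞, ∃ D ∈ 𝒟, Nonempty (C ⊞ D ≅ E)} := by
  obtain ⟨T, hT, hn, hc⟩ := h
  obtain ⟨T', hT', hn', hc'⟩ := h'
  refine ⟨Set.image2 Param.sum T T', hT.image2 _ hT', ?_, ?_⟩
  · rintro _ ⟨p, hp, q, hq, rfl⟩
    exact add_le_add (hn p hp) (hn' q hq)
  · rintro E ⟨C, hC, D, hD, ⟨e⟩⟩
    obtain ⟨p, hp, hpC⟩ := hc C hC
    obtain ⟨q, hq, hqD⟩ := hc' D hD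
    exact ⟨_, ⟨p, hp, q, hq, rfl⟩, (Param.sum_realizes hpC hqD).of_iso e⟩

open scoped ZeroObject in
theorem isMinimal_zero : IsMinimal (0 : ChainComplex (ModuleCat.{u} Aᵐᵒᵖ) ℤ) := by
  have hz (i : ℤ) : IsZero ((0 : ChainComplex (ModuleCat.{u} Aᵐᵒᵖ) ℤ).X i) :=
    (HomologicalComplex.eval (ModuleCat.{u} Aᵐᵒᵖ) (ComplexShape.down ℤ) i).map_isZero
      (isZero_zero _)
  have hs (i : ℤ) := ModuleCat.subsingleton_of_isZero (hz i)
  refine ⟨⟨0, 0, fun i _ => hz i⟩, fun i => inferInstance, fun i => inferInstance, fun i j x => ?_⟩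
  rw [Subsingleton.elim ((0 : ChainComplex (ModuleCat.{u} Aᵐᵒᵖ) ℤ).d i j x) 0]
  exact Submodule.zero_mem _

open scoped ZeroObject in
/-- If indecomposable complexes of bounded dimension need at most one parameter, complexes of
dimension at most `n` need at most `n` parameters. -/
theorem finCovered_of_indecomposable [Module.Finite k A] {b : ℤ →₀ ℕ}
    (h : ∀ d, FinCovered k 1 {C : ChainComplex (ModuleCat.{u} Aᵐᵒᵖ) ℤ |
      InClass b C ∧ Indecomposable C ∧ tdim k b C ≤ d}) (n : ℕ) :
    FinCovered k n {C : ChainComplex (ModuleCat.{u} Aᵐᵒᵖ) ℤ | InClass b C ∧ tdim k b C ≤ n} := by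
  induction n using Nat.strong_induction_on with
  | _ n ih =>
  have h0 := (FinCovered.isoClass (k := k) (isMinimal_zero (A := A))).mono (Nat.zero_le n) le_rfl
  rcases Nat.eq_zero_or_pos n with rfl | hn
  · refine h0.mono le_rfl fun C ⟨hC, hd⟩ => ?_
    by_cases hz : IsZero C
    · exact ⟨(isZero_zero _).iso hz⟩
    · have := hC.tdim_pos k hz
      omega
  have h1 := (h n).mono hn le_rfl
  -- Decomposable complexes split into summands of dimensions at most `j` and `n - j` with `0 < j <
  -- n`, and the numbers of parameters add up to `n`.
  have h2 := FinCovered.biUnion (k := k) (n := n) (Set.finite_Ioo 0 n)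
    (𝒞 := fun j => {E | ∃ C ∈ {C : ChainComplex (ModuleCat.{u} Aᵐᵒᵖ) ℤ |
        InClass b C ∧ tdim k b C ≤ j},
      ∃ D ∈ {C : ChainComplex (ModuleCat.{u} Aᵐᵒᵖ) ℤ | InClass b C ∧ tdim k b C ≤ n - j},
        Nonempty (C ⊞ D ≅ E)}) fun j hj => by
      have h3 := (ih j hj.2).sum (ih (n - j) (by have := hj.1; omega))
      rwa [Nat.add_sub_cancel' hj.2.le] at h3
  refine (h0.union (h1.union h2)).mono le_rfl fun C ⟨hC, hd⟩ => ?_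
  by_cases hz : IsZero C
  · exact Or.inl ⟨(isZero_zero _).iso hz⟩
  by_cases hi : Indecomposable C
  · exact Or.inr (Or.inl ⟨hC, hi, hd⟩)
  refine Or.inr (Or.inr ?_)
  have h4 : ∃ Y Z, ∃ _ : C ≅ Y ⊞ Z, ¬ IsZero Y ∧ ¬ IsZero Z := by
    by_contra! hcon
    exact hi ⟨hz, fun Y Z e => or_iff_not_imp_left.2 (hcon Y Z e)⟩
  obtain ⟨Y, Z, e, hY, hZ⟩ := h4
  have hYc : InClass b Y := (hC.of_iso e).of_retract biprod.inl biprod.fst biprod.inl_fst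
  have hZc : InClass b Z := (hC.of_iso e).of_retract biprod.inr biprod.snd biprod.inr_snd
  have h5 := tdim_eq_of_iso k (b := b) e
  rw [tdim_biprod k hYc hZc] at h5
  have h6 := hYc.tdim_pos k hY
  have h7 := hZc.tdim_pos k hZ
  exact Set.mem_iUnion₂.2 ⟨tdim k b Y, ⟨h6, by omega⟩, Y, ⟨hYc, le_rfl⟩, Z, ⟨hZc, by omega⟩, ⟨e.symm⟩⟩

end FinCovered

end

section

/-! ### Rational algebras -/

section Rational

open Polynomial

variable {k : Type u} [Field k] {f : k[X]}

theorem isDomain_localizationAway (hf : f ≠ 0) : IsDomain (Localization.Away f) :=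
  IsLocalization.isDomain_localization (powers_le_nonZeroDivisors_of_noZeroDivisors hf)

theorem algebraMap_localizationAway_injective (hf : f ≠ 0) :
    Function.Injective (algebraMap k[X] (Localization.Away f)) :=
  IsLocalization.injective _ (powers_le_nonZeroDivisors_of_noZeroDivisors hf)

/-- Ideals of a localization are extended from their contractions, here to `k[X]`. -/
theorem isPrincipalIdealRing_localizationAway : IsPrincipalIdealRing (Localization.Away f) := by
  refine ⟨fun I => ?_⟩
  obtain ⟨g, hg⟩ := IsPrincipalIdealRing.principal (I.under k[X])
  refine ⟨algebraMap _ _ g, ?_⟩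
  rw [← IsLocalization.map_under (Submonoid.powers f) (Localization.Away f) I, hg]
  change Ideal.map _ (Ideal.span {g}) = Ideal.span _
  rw [Ideal.map_span, Set.image_singleton]

theorem localizationAway_algHom_ext {R : Type*} [CommRing R] [Algebra k R]
    {φ ψ : Localization.Away f →ₐ[k] R}
    (h : φ (algebraMap k[X] _ X) = ψ (algebraMap k[X] _ X)) : φ = ψ := by
  refine IsLocalization.algHom_ext (Submonoid.powers f) ?_
  ext
  exact h

/-- The generic module `B[ε]/(ε^e)`. -/
abbrev GenRing (f : k[X]) (e : ℕ) : Type u := AdjoinRoot (X ^ e : (Localization.Away f)[X])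

/-- `f(X + ε)` differs from the unit `f(X)` by a multiple of the nilpotent `ε`, so it is a unit and
`X ↦ X + ε` extends to the localization. -/
theorem exists_generic_hom (f : k[X]) (e : ℕ) :
    ∃ θ : Localization.Away f →ₐ[k] GenRing f e,
      θ (algebraMap k[X] _ X) = algebraMap (Localization.Away f) _ (algebraMap k[X] _ X) +
        AdjoinRoot.root _ := by
  set ε : GenRing f e := AdjoinRoot.root _
  set z : GenRing f e := algebraMap (Localization.Away f) _ (algebraMap k[X] _ X)
  have hε : IsNilpotent ε := ⟨e, by
    have h := AdjoinRoot.eval₂_root (X ^ e : (Localization.Away f)[X])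
    rwa [eval₂_X_pow] at h⟩
  let g : k[X] →ₐ[k] GenRing f e := aeval (z + ε)
  have hu : IsUnit (g f) := by
    have h1 : IsUnit (aeval z f) := by
      have h2 : aeval z f = algebraMap (Localization.Away f) (GenRing f e)
          (algebraMap k[X] _ f) := by
        rw [aeval_algebraMap_apply, aeval_algebraMap_apply, aeval_X_left_apply]
      rw [h2]
      exact (IsLocalization.Away.algebraMap_isUnit f).map _
    obtain ⟨c, hc⟩ : ε ∣ g f - aeval z f := by
      have h3 := sub_dvd_eval_sub (z + ε) z (f.map (algebraMap k (GenRing f e)))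
      rwa [add_sub_cancel_left, eval_map_algebraMap, eval_map_algebraMap] at h3
    rw [← sub_add_cancel (g f) (aeval z f), add_comm, hc]
    exact IsNilpotent.isUnit_add_left_of_commute ((Commute.all ε c).isNilpotent_mul_right hε) h1 (Commute.all _ _)
  have hu' (y : Submonoid.powers f) : IsUnit (g y) := by
    obtain ⟨_, n, rfl⟩ := y
    rw [map_pow]
    exact hu.pow n
  refine ⟨IsLocalization.liftAlgHom (M := Submonoid.powers f) hu', ?_⟩
  rw [IsLocalization.liftAlgHom_apply, IsLocalization.lift_eq]
  exact aeval_X _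

/-- The module `B[ε]/(ε^e)`, on which `B` acts from the right by `X ↦ X + ε`. -/
def GenModule (f : k[X]) (e : ℕ) : Type u := GenRing f e

variable (e : ℕ)

/-- The homomorphism `X ↦ X + ε`. -/
def genericHom (f : k[X]) (e : ℕ) : Localization.Away f →ₐ[k] GenRing f e :=
  (exists_generic_hom f e).choose

theorem genericHom_X : genericHom f e (algebraMap k[X] _ X) =
    algebraMap (Localization.Away f) _ (algebraMap k[X] _ X) + AdjoinRoot.root _ :=
  (exists_generic_hom f e).choose_spec

instance : AddCommGroup (GenModule f e) := inferInstanceAs (AddCommGroup (GenRing f e))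
instance : Module (Localization.Away f) (GenModule f e) :=
  inferInstanceAs (Module (Localization.Away f) (GenRing f e))
instance : Module k (GenModule f e) := inferInstanceAs (Module k (GenRing f e))
instance : IsScalarTower k (Localization.Away f) (GenModule f e) :=
  inferInstanceAs (IsScalarTower k (Localization.Away f) (GenRing f e))
instance : Module (Localization.Away f)ᵐᵒᵖ (GenModule f e) :=
  Module.compHom (GenRing f e) ((genericHom f e).toRingHom.fromOpposite fun _ _ => Commute.all _ _)
instance : IsScalarTower k (Localization.Away f)ᵐᵒᵖ (GenModule f e) where
  smul_assoc c b l := by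
    let l' : GenRing f e := l
    change genericHom f e (c • b.unop) * l' = c • (genericHom f e b.unop * l')
    rw [map_smul, smul_mul_assoc]
instance : SMulCommClass (Localization.Away f) (Localization.Away f)ᵐᵒᵖ (GenModule f e) where
  smul_comm b c l := by
    let l' : GenRing f e := l
    change b • (genericHom f e c.unop * l') = genericHom f e c.unop * (b • l')
    rw [mul_smul_comm]
instance : Module.Finite (Localization.Away f) (GenModule f e) := (monic_X_pow e).finite_adjoinRoot
instance : Module.Free (Localization.Away f) (GenModule f e) := (monic_X_pow e).free_adjoinRoot

/-- Specialization of the generic module at the point `x`. -/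
theorem exists_specialization (x : Localization.Away f →ₐ[k] k) :
    ∃ q : GenRing f e →ₐ[k] (Localization.Away f ⧸ RingHom.ker x ^ e),
      (∀ b, q (genericHom f e b) = Ideal.Quotient.mk _ b) ∧
      (∀ b, q (algebraMap (Localization.Away f) _ b) = algebraMap k _ (x b)) ∧
      ∀ l, q l = 0 → l ∈ Ideal.map (algebraMap (Localization.Away f) (GenRing f e))
        (RingHom.ker x) := by
  set z : Localization.Away f := algebraMap k[X] _ X with hz
  set Q := Localization.Away f ⧸ RingHom.ker x ^ e
  let t : Localization.Away f := z - algebraMap k _ (x z)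
  have ht : t ∈ RingHom.ker x := by
    rw [RingHom.mem_ker, map_sub, AlgHom.commutes]
    exact sub_self _
  have hroot : (AdjoinRoot.root (X ^ e) : GenRing f e) ^ e = 0 := by
    have h := AdjoinRoot.eval₂_root (X ^ e : (Localization.Away f)[X])
    rwa [eval₂_X_pow] at h
  have heval : eval₂ (((Algebra.ofId k Q).comp x : Localization.Away f →ₐ[k] Q) :
      Localization.Away f →+* Q) (Ideal.Quotient.mk _ t) (X ^ e) = 0 := by
    rw [eval₂_X_pow, ← map_pow]
    exact Ideal.Quotient.eq_zero_iff_mem.2 (Ideal.pow_mem_pow ht e)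
  -- `B` is evaluated at `x` and `ε` is sent to `t = X - x(X)`, so `X + ε` goes to the class of `X`.
  let q : GenRing f e →ₐ[k] Q := AdjoinRoot.liftAlgHom (X ^ e : (Localization.Away f)[X])
    ((Algebra.ofId k Q).comp x) (Ideal.Quotient.mk _ t) (by
      rw [eval₂_X_pow, ← map_pow]
      exact Ideal.Quotient.eq_zero_iff_mem.2 (Ideal.pow_mem_pow ht e))
  have hq (b) : q (algebraMap (Localization.Away f) _ b) = algebraMap k _ (x b) :=
    AdjoinRoot.lift_of heval
  have hqr : q (AdjoinRoot.root _) = Ideal.Quotient.mk _ t :=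
    AdjoinRoot.lift_root heval
  have hqθ (b) : q (genericHom f e b) = Ideal.Quotient.mk _ b := by
    have h : q.comp (genericHom f e) = Ideal.Quotient.mkₐ k _ := by
      refine localizationAway_algHom_ext ?_
      change q (genericHom f e z) = Ideal.Quotient.mk _ z
      rw [hz, genericHom_X, map_add, hq, hqr]
      change Ideal.Quotient.mk _ (algebraMap k _ (x z)) + Ideal.Quotient.mk _ t = _
      rw [← map_add]
      congr 1
      exact add_sub_cancel _ _
    exact AlgHom.congr_fun h b
  refine ⟨q, hqθ, hq, fun l hl => ?_⟩
  set I := Ideal.map (algebraMap (Localization.Away f) (GenRing f e)) (RingHom.ker x)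
  let mI : GenRing f e →ₐ[k] GenRing f e ⧸ I := Ideal.Quotient.mkₐ k I
  have hmI (b : Localization.Away f) : mI (algebraMap (Localization.Away f) _ b) =
      algebraMap k _ (x b) := by
    have h : algebraMap (Localization.Away f) (GenRing f e) b -
        algebraMap (Localization.Away f) (GenRing f e) (algebraMap k _ (x b)) ∈ I := by
      rw [← map_sub]
      refine Ideal.mem_map_of_mem _ ?_
      rw [RingHom.mem_ker, map_sub, AlgHom.commutes]
      exact sub_self _
    exact (Ideal.Quotient.eq).2 h
  let K : Ideal (GenRing f e ⧸ I) := Ideal.span {mI (AdjoinRoot.root _)}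
  have hK : Ideal.map (mI.comp (genericHom f e)) (RingHom.ker x) ≤ K := by
    rw [Ideal.map_le_iff_le_comap]
    intro b hb
    have h : (Ideal.Quotient.mkₐ k K).comp (mI.comp (genericHom f e)) =
        (Algebra.ofId k _).comp x := by
      refine localizationAway_algHom_ext ?_
      change Ideal.Quotient.mk K (mI (genericHom f e z)) = algebraMap k _ (x z)
      rw [hz, genericHom_X, map_add, hmI, map_add]
      have h1 : Ideal.Quotient.mk K (mI (AdjoinRoot.root _)) = 0 :=
        Ideal.Quotient.eq_zero_iff_mem.2 (Ideal.mem_span_singleton_self _)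
      rw [h1, add_zero]
      rfl
    have h2 := AlgHom.congr_fun h b
    rw [AlgHom.comp_apply (Algebra.ofId k _) x, (RingHom.mem_ker).1 hb, map_zero] at h2
    have h3 : Ideal.Quotient.mk K ((mI.comp (genericHom f e)) b) = 0 := h2
    have h4 : (mI.comp (genericHom f e)) b ∈ K := Ideal.Quotient.eq_zero_iff_mem.1 h3
    exact Ideal.mem_comap.2 h4
  have hKe : K ^ e = ⊥ := by
    rw [Ideal.span_singleton_pow, ← map_pow, hroot, map_zero]
    exact Ideal.span_singleton_eq_bot.2 rfl
  -- Modulo `I` the element `X + ε` becomes `x(X) + ε`, so functions vanishing at `x` become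
  -- multiples of `ε`, whose `e`-th powers vanish. Hence `r` is defined; as `r q` is reduction
  -- modulo `I`, the kernel of `q` lies in `I`.
  let r : Q →+* GenRing f e ⧸ I := Ideal.Quotient.lift _ (mI.comp (genericHom f e)).toRingHom
    fun b hb => by
      have h := Ideal.mem_map_of_mem (mI.comp (genericHom f e)).toRingHom hb
      rw [Ideal.map_pow] at h
      have h3 := Ideal.pow_right_mono hK e h
      rw [hKe] at h3
      exact h3
  have hr : r.comp q.toRingHom = mI.toRingHom := by
    refine AdjoinRoot.ringHom_ext (RingHom.ext fun b => ?_) ?_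
    · change r (q (algebraMap (Localization.Away f) _ b)) =
        mI (algebraMap (Localization.Away f) _ b)
      rw [hq, hmI]
      change mI (genericHom f e (algebraMap k _ (x b))) = _
      rw [AlgHom.commutes, AlgHom.commutes]
    · change r (q (AdjoinRoot.root _)) = mI (AdjoinRoot.root _)
      rw [hqr]
      change mI (genericHom f e t) = _
      rw [map_sub, genericHom_X, AlgHom.commutes, map_sub, map_add, hmI, AlgHom.commutes]
      exact add_sub_cancel_left _ _
  have h4 : mI l = 0 := by
    have h5 := RingHom.congr_fun hr l
    refine h5.symm.trans ?_
    change r (q l) = 0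
    rw [hl, map_zero]
  exact Ideal.Quotient.eq_zero_iff_mem.1 h4

variable {A : Type u} [Ring A] [Algebra k A]

/-- For fixed `e`, all the complexes `B/𝔪^e ⊗ P` are fibres of one family over the curve `Spec B`,
whence a single parameter. -/
theorem isFiber_generic (x : Localization.Away f →ₐ[k] k)
    (P : ChainComplex (ModuleCat.{u} (Localization.Away f ⊗[k] Aᵐᵒᵖ)) ℤ) :
    IsFiber x.toRingHom (baseComplex (Localization.Away f) (GenModule f e) P)
      (tensorComplex (Localization.Away f ⧸ RingHom.ker x ^ e) P) := by
  obtain ⟨q, hqθ, hq, hker⟩ := exists_specialization e x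
  refine isFiber_baseComplex (x := x.toRingHom) (B := Localization.Away f) (L := GenModule f e)
    (Lx := Localization.Away f ⧸ RingHom.ker x ^ e) (q : GenRing f e →+ _) ?_ ?_ ?_ ?_ P
  · intro s (l : GenRing f e)
    change q (s • l) = x s • q l
    rw [Algebra.smul_def, map_mul, hq, Algebra.smul_def]
  · intro b (l : GenRing f e)
    change q (genericHom f e b.unop * l) = b • q l
    rw [map_mul, hqθ]
    obtain ⟨y, hy⟩ := Ideal.Quotient.mk_surjective (q l)
    rw [← hy, ← map_mul, mul_comm]
    rfl
  · intro y
    obtain ⟨b, rfl⟩ := Ideal.Quotient.mk_surjective y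
    exact ⟨genericHom f e b, hqθ b⟩
  · intro l hl
    have h := hker l hl
    have h1 : ∀ l : GenRing f e, l ∈ Ideal.map (algebraMap (Localization.Away f) (GenRing f e))
        (RingHom.ker x) → (l : GenModule f e) ∈ AddSubgroup.closure
          {y : GenModule f e | ∃ (s : Localization.Away f) (l : GenModule f e),
            x.toRingHom s = 0 ∧ y = s • l} := by
      intro l h
      induction h using Submodule.closure_induction with
      | zero => exact AddSubgroup.zero_mem _
      | add y z _ _ hy hz => exact AddSubgroup.add_mem _ hy hz
      | smul_mem a y hy =>
        obtain ⟨s, hs, rfl⟩ := hy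
        refine AddSubgroup.subset_closure ⟨s, a, hs, ?_⟩
        change a * algebraMap _ _ s = s • a
        rw [Algebra.smul_def, mul_comm]
    exact h1 l h

end Rational

end

section

/-! ### Complexes realized by rational families -/

theorem isZero_tensorComplex {k B A : Type u} [Field k] [Ring B] [Algebra k B] [Ring A]
    [Algebra k A] (L : Type u) [AddCommGroup L] [Module Bᵐᵒᵖ L] [Subsingleton L]
    (P : ChainComplex (ModuleCat.{u} (B ⊗[k] Aᵐᵒᵖ)) ℤ) : IsZero (tensorComplex L P) := by
  rw [IsZero.iff_id_eq_zero, ← tensorComplexMap_id, ← tensorComplexMap_zero]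
  congr 1
  ext x
  exact Subsingleton.elim _ _

/-- Factors are split off one at a time; indecomposability forces one of the two summands to vanish
at each stage. -/
theorem exists_factor {k B A : Type u} [Field k] [Ring B] [Algebra k B] [Ring A]
    [Algebra k A] {C : ChainComplex (ModuleCat.{u} Aᵐᵒᵖ) ℤ} (hC : Indecomposable C)
    (P : ChainComplex (ModuleCat.{u} (B ⊗[k] Aᵐᵒᵖ)) ℤ) (n : ℕ) (M : Fin n → Type u)
    [∀ i, AddCommGroup (M i)] [∀ i, Module Bᵐᵒᵖ (M i)] (e : C ≅ tensorComplex (∀ i, M i) P) :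
    ∃ i, Nonempty (C ≅ tensorComplex (M i) P) := by
  induction n with
  | zero => exact (hC.1 ((isZero_tensorComplex (∀ i, M i) P).of_iso e)).elim
  | succ n ih =>
    obtain ⟨e'⟩ := tensorComplex_prod (L := M 0) (L' := ∀ i : Fin n, M i.succ) P
    let E : C ≅ tensorComplex (M 0) P ⊞ tensorComplex (∀ i : Fin n, M i.succ) P :=
      e.trans ((tensorComplexIso P (Fin.consLinearEquiv Bᵐᵒᵖ M).symm).trans e')
    rcases hC.2 _ _ E with h | h
    · obtain ⟨i, hi⟩ := ih (fun i => M i.succ) (E.trans (isoZeroBiprod h).symm)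
      exact ⟨i.succ, hi⟩
    · exact ⟨0, ⟨E.trans (isoBiprodZero h).symm⟩⟩

/-! ### Finite-dimensional modules over rational algebras. -/

section RationalRealizes

open Polynomial

variable {k : Type u} [Field k] {f : k[X]} {A : Type u} [Ring A] [Algebra k A]

/-- Cayley–Hamilton: the characteristic polynomial of the action of `X` kills `L`, and it remains
nonzero in the localization. -/
theorem isTorsion_of_finite (hf : f ≠ 0) (L : Type u) [AddCommGroup L] [Module k L]
    [Module (Localization.Away f) L] [IsScalarTower k (Localization.Away f) L]
    [Module.Finite k L] : Module.IsTorsion (Localization.Away f) L := by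
  have := isDomain_localizationAway hf
  let φ : Module.End k L := Algebra.lsmul k k L (algebraMap k[X] (Localization.Away f) X)
  have h1 : aeval φ φ.charpoly = 0 := LinearMap.aeval_self_charpoly φ
  have h2 : aeval φ φ.charpoly = 
      Algebra.lsmul k k L (algebraMap k[X] (Localization.Away f) φ.charpoly) := by
    rw [aeval_algHom_apply, aeval_algebraMap_apply, aeval_X_left_apply]
  intro l
  refine ⟨⟨algebraMap k[X] _ φ.charpoly, mem_nonZeroDivisors_of_ne_zero fun h =>
    φ.charpoly_monic.ne_zero (algebraMap_localizationAway_injective hf (h.trans (map_zero _).symm))⟩, ?_⟩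
  exact LinearMap.congr_fun (h2.symm.trans h1) l

theorem ker_eq_span_of_irreducible [IsAlgClosed k] (hf : f ≠ 0) {p : Localization.Away f}
    (hp : Irreducible p) :
    ∃ x : Localization.Away f →ₐ[k] k, RingHom.ker x = Ideal.span {p} := by
  have := isDomain_localizationAway hf
  have := isPrincipalIdealRing_localizationAway (f := f)
  have hmax := PrincipalIdealRing.isMaximal_of_irreducible hp
  obtain ⟨x, hx⟩ := exists_point_of_le (k := k) (Ideal.span {p}) hmax.ne_top
  exact ⟨x, (hmax.eq_of_le (RingHom.ker_ne_top x) hx).symm⟩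

/-- The structure theorem over a principal ideal domain writes `L` as a product of modules
`B/(p^e)`, where `(p)` is the ideal of a point as `k` is algebraically closed. An indecomposable
complex sees only one factor. -/
theorem exists_point_of_indecomposable [IsAlgClosed k] (hf : f ≠ 0) (L : Type u) [AddCommGroup L]
    [Module k L] [Module (Localization.Away f)ᵐᵒᵖ L] [IsScalarTower k (Localization.Away f)ᵐᵒᵖ L]
    [Module.Finite k L] (P : ChainComplex (ModuleCat.{u} (Localization.Away f ⊗[k] Aᵐᵒᵖ)) ℤ)
    {C : ChainComplex (ModuleCat.{u} Aᵐᵒᵖ) ℤ} (hC : Indecomposable C)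
    (iso : C ≅ tensorComplex L P) :
    ∃ (x : Localization.Away f →ₐ[k] k) (e : ℕ), e ≠ 0 ∧
      Module.Finite k (Localization.Away f ⧸ RingHom.ker x ^ e) ∧ Nonempty (C ≅ tensorComplex (Localization.Away f ⧸ RingHom.ker x ^ e) P) := by
  have := isDomain_localizationAway hf
  have := isPrincipalIdealRing_localizationAway (f := f)
  let _ : Module (Localization.Away f) L :=
    Module.compHom L (RingEquiv.toOpposite (Localization.Away f)).toRingHom
  have hst : IsScalarTower k (Localization.Away f) L := ⟨fun c b l => by
    change op (c • b) • l = c • op b • l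
    rw [op_smul, smul_assoc]⟩
  have : Module.Finite (Localization.Away f) L := Module.Finite.of_restrictScalars_finite k _ L
  obtain ⟨ι, _, p, hp, e, ⟨E⟩⟩ := Module.equiv_directSum_of_isTorsion (isTorsion_of_finite (k := k) hf L)
  choose x hx using fun i => ker_eq_span_of_irreducible hf (hp i)
  have hker (i) : Submodule.span (Localization.Away f) {p i ^ e i} = RingHom.ker (x i) ^ e i := by
    rw [hx, Ideal.span_singleton_pow]
  classical
  let E' : L ≃ₗ[Localization.Away f] ∀ i, Localization.Away f ⧸ RingHom.ker (x i) ^ e i :=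
    (E.trans (DirectSum.linearEquivFunOnFintype _ _ _)).trans
      (LinearEquiv.piCongrRight fun i => Submodule.quotEquivOfEq _ _ (hker i))
  let E'' : L ≃ₗ[(Localization.Away f)ᵐᵒᵖ] ∀ i, Localization.Away f ⧸ RingHom.ker (x i) ^ e i :=
    { E' with
      map_smul' := fun b l => (E'.map_smul b.unop l).trans (op_smul_eq_smul b.unop (E' l)).symm }
  obtain ⟨j, ⟨h⟩⟩ := exists_factor hC P _ _ (iso.trans (tensorComplexIso P
    (E''.trans (LinearEquiv.piCongrLeft' _ _ (Fintype.equivFin ι)))))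
  have hfin : Module.Finite k (∀ i, Localization.Away f ⧸ RingHom.ker (x i) ^ e i) :=
    Module.Finite.equiv (E'.restrictScalars k)
  refine ⟨_, _, fun he => hC.1 ?_, Module.Finite.of_surjective
    (LinearMap.proj (R := k) (φ := fun i => Localization.Away f ⧸ RingHom.ker (x i) ^ e i)
      ((Fintype.equivFin ι).symm j)) (Function.surjective_eval _), ⟨h⟩⟩
  have : Subsingleton (Localization.Away f ⧸ RingHom.ker (x ((Fintype.equivFin ι).symm j)) ^
      e ((Fintype.equivFin ι).symm j)) := by
    rw [he, pow_zero, Ideal.one_eq_top]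
    exact Submodule.Quotient.subsingleton_iff.2 rfl
  exact (isZero_tensorComplex _ P).of_iso h

/-- Multiplication by a generator `p` of the ideal of `x` is nilpotent, so its power by the
dimension is zero. Thus `p^e` divides that power of `p`. -/
theorem le_finrank_quotient_pow (hf : f ≠ 0) (x : Localization.Away f →ₐ[k] k) (e : ℕ)
    [Module.Finite k (Localization.Away f ⧸ RingHom.ker x ^ e)] :
    e ≤ Module.finrank k (Localization.Away f ⧸ RingHom.ker x ^ e) := by
  have := isDomain_localizationAway hf
  have := isPrincipalIdealRing_localizationAway (f := f)
  obtain ⟨p, hp⟩ := IsPrincipalIdealRing.principal (RingHom.ker x)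
  have hp' : RingHom.ker x = Ideal.span {p} := hp
  have hp0 : p ≠ 0 := by
    rintro rfl
    have h1 : algebraMap k[X] (Localization.Away f) (X - C (x (algebraMap k[X] _ X))) ∈
        RingHom.ker x := by
      rw [RingHom.mem_ker, map_sub, map_sub, sub_eq_zero]
      exact (x.commutes _).symm
    rw [hp', Ideal.span_singleton_zero, Ideal.mem_bot] at h1
    exact X_sub_C_ne_zero _ (algebraMap_localizationAway_injective hf (h1.trans (map_zero _).symm))
  have hpu : ¬ IsUnit p := by
    rw [← Ideal.span_singleton_eq_top, ← hp']
    exact RingHom.ker_ne_top x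
  let N : Module.End k (Localization.Away f ⧸ RingHom.ker x ^ e) :=
    Algebra.lsmul k k _ p
  have hN (n : ℕ) : N ^ n = Algebra.lsmul k k _ (p ^ n) := (map_pow _ p n).symm
  have hnil : IsNilpotent N := by
    refine ⟨e, LinearMap.ext fun y => ?_⟩
    obtain ⟨y, rfl⟩ := Ideal.Quotient.mk_surjective y
    rw [hN]
    change Ideal.Quotient.mk _ (p ^ e * y) = 0
    refine Ideal.Quotient.eq_zero_iff_mem.2 (Ideal.mul_mem_right _ _ ?_)
    rw [hp', Ideal.span_singleton_pow]
    exact Ideal.mem_span_singleton_self _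
  have h2 : N ^ Module.finrank k (Localization.Away f ⧸ RingHom.ker x ^ e) = 0 := by
    have h3 := LinearMap.aeval_self_charpoly N
    rwa [hnil.charpoly_eq_X_pow_finrank, aeval_X_pow] at h3
  rw [hN] at h2
  have h4 : Ideal.Quotient.mk (RingHom.ker x ^ e) (p ^ Module.finrank k
      (Localization.Away f ⧸ RingHom.ker x ^ e) * 1) = 0 :=
    LinearMap.congr_fun h2 (Ideal.Quotient.mk _ 1)
  rw [Ideal.Quotient.eq_zero_iff_mem, mul_one] at h4
  have h5 : p ^ Module.finrank k (Localization.Away f ⧸ RingHom.ker x ^ e) ∈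
      Ideal.span {p ^ e} := by
    rw [← Ideal.span_singleton_pow, ← hp']
    exact h4
  exact (pow_dvd_pow_iff hp0 hpu).1 (Ideal.mem_span_singleton.1 h5)

/-- A nonzero finitely generated projective bimodule over a principal ideal domain has a unimodular
element. -/
theorem exists_unimodular {B : Type u} [CommRing B] [IsDomain B] [IsPrincipalIdealRing B]
    [Algebra k B] [Module.Finite k A] (M : ModuleCat.{u} (B ⊗[k] Aᵐᵒᵖ))
    [Module.Finite (B ⊗[k] Aᵐᵒᵖ) M] [Module.Projective (B ⊗[k] Aᵐᵒᵖ) M] (hM : ¬ Subsingleton M) :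
    ∃ (φ : M →+ B) (m : M), φ m = 1 ∧ ∀ (b : B) (m : M), φ ((b ⊗ₜ[k] (1 : Aᵐᵒᵖ)) • m) = b * φ m := by
  let _ : Module B M := Module.compHom M
    (Algebra.TensorProduct.includeLeft : B →ₐ[B] B ⊗[k] Aᵐᵒᵖ).toRingHom
  have hsmul (b : B) (m : M) : b • m = (b ⊗ₜ[k] (1 : Aᵐᵒᵖ)) • m := rfl
  have : IsScalarTower B (B ⊗[k] Aᵐᵒᵖ) M := ⟨fun b t m => by
    rw [hsmul, smul_smul]
    congr 1
    induction t using TensorProduct.induction_on with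
    | zero => rw [smul_zero, mul_zero]
    | tmul c a => rw [TensorProduct.smul_tmul', Algebra.TensorProduct.tmul_mul_tmul, one_mul,
        smul_eq_mul]
    | add t t' h h' => rw [smul_add, mul_add, h, h']⟩
  have hfin : Module.Finite B M := Module.Finite.trans (B ⊗[k] Aᵐᵒᵖ) M
  -- `B ⊗ Aᵐᵒᵖ` is free over `B`, so `M` is finitely generated projective over `B`, hence free. A
  -- basis vector and its coordinate function are taken.
  obtain ⟨s, hs⟩ := Module.projective_def'.1 (inferInstance : Module.Projective (B ⊗[k] Aᵐᵒᵖ) M)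
  have hproj : Module.Projective B M := Module.Projective.of_split (s.restrictScalars B)
    ((Finsupp.linearCombination (B ⊗[k] Aᵐᵒᵖ) (id : M → M)).restrictScalars B)
    (LinearMap.ext fun x => LinearMap.congr_fun hs x)
  let β := Module.Free.chooseBasis B M
  have : Nonempty (Module.Free.ChooseBasisIndex B M) := by
    by_contra h
    rw [not_nonempty_iff] at h
    exact hM β.repr.toEquiv.subsingleton
  obtain ⟨i⟩ := this
  exact ⟨(β.coord i).toAddMonoidHom, β i, by simp, fun b m => (β.coord i).map_smul b m⟩

/-- The dimension of `L` is bounded by the one of `L ⊗_B M`. -/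
theorem finrank_le_kdim_tensor [Module.Finite k A] {B : Type u} [CommRing B] [IsDomain B]
    [IsPrincipalIdealRing B] [Algebra k B] (M : ModuleCat.{u} (B ⊗[k] Aᵐᵒᵖ))
    [Module.Finite (B ⊗[k] Aᵐᵒᵖ) M] [Module.Projective (B ⊗[k] Aᵐᵒᵖ) M] (hM : ¬ Subsingleton M)
    (L : Type u) [AddCommGroup L] [Module k L] [Module Bᵐᵒᵖ L] [IsScalarTower k Bᵐᵒᵖ L]
    [Module.Finite Aᵐᵒᵖ ((tensorFunctor (k := k) (A := A) L).obj M)] :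
    Module.finrank k L ≤ kdim k ((tensorFunctor (k := k) (A := A) L).obj M) := by
  obtain ⟨φ, m, hm, hφ⟩ := exists_unimodular (k := k) (A := A) M hM
  -- `ψ` sends `l ⊗ m'` to `l φ(m')`, so it is a left inverse of `l ↦ l ⊗ m` because `φ m = 1`.
  let ψ : (tensorFunctor (k := k) (A := A) L).obj M →+ L := tensorLift
    (AddMonoidHom.mk' (fun m => AddMonoidHom.mk' (fun l : L => op (φ m) • l) (smul_add _))
      fun m m' => AddMonoidHom.ext fun l => by
        change op (φ (m + m')) • l = op (φ m) • l + op (φ m') • l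
        rw [map_add, MulOpposite.op_add, add_smul])
    (fun b m l => by
      change op (φ _) • l = op (φ m) • op b • l
      rw [hφ, smul_smul]
      rfl)
  refine finrank_le_kdim k _ (tmkHom m) (fun l l' h => ?_) fun c l => ?_
  · have h1 (l : L) : ψ (tmk m l) = l := by
      change op (φ m) • l = l
      rw [hm]
      exact one_smul _ _
    have h2 : ψ (tmk m l) = ψ (tmk m l') := congrArg ψ h
    rwa [h1, h1] at h2
  · change tmk m (c • l) = algebraMap k Aᵐᵒᵖ c • tmk m l
    rw [← algebraMap_smul Bᵐᵒᵖ c l, smul_tmk, ← algebraMap_tmul_one, tmk_balanced]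
    rfl

end RationalRealizes

end

section

/-! ### Derived tame algebras -/

section Tame

variable {k A : Type u} [Field k] [Ring A] [Algebra k A]

open Polynomial in
/-- The one-parameter family of the complexes `B/(x - λ)^e ⊗ P`. -/
def RationalFamily.param [Module.Finite k A] (F : RationalFamily k A) (e : ℕ) : Param k A where
  S := Localization.Away F.f
  n := 1
  l _ := algebraMap k[X] _ X
  sep _ _ h := localizationAway_algHom_ext (h 0)
  X := (exists_matData (baseComplex_isMinimalFamily (Localization.Away F.f) (GenModule F.f e)
    F.isMinimalFamily)).choose

theorem RationalFamily.param_realizes [Module.Finite k A] (F : RationalFamily k A) (e : ℕ)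
    (x : Localization.Away F.f →ₐ[k] k) :
    (F.param e).Realizes (tensorComplex (Localization.Away F.f ⧸ RingHom.ker x ^ e) F.P) :=
  ⟨x, (exists_matData (baseComplex_isMinimalFamily (Localization.Away F.f) (GenModule F.f e)
    F.isMinimalFamily)).choose_spec x _ (isFiber_generic e x F.P)⟩

instance {S : Type u} [CommRing S] (x : S →+* k) : Module k (PointModule x) :=
  inferInstanceAs (Module k k)

theorem finrank_pointModule {S : Type u} [CommRing S] (x : S →+* k) :
    Module.finrank k (PointModule x) = 1 := Module.finrank_self k

instance {S : Type u} [CommRing S] (x : S →+* k) : Module.Finite k (PointModule x) :=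
  inferInstanceAs (Module.Finite k k)

theorem isScalarTower_pointModule {S : Type u} [CommRing S] [Algebra k S] (x : S →ₐ[k] k) :
    IsScalarTower k Sᵐᵒᵖ (PointModule x.toRingHom) where
  smul_assoc c s v := by
    let w : k := v
    change x (c • s.unop) * w = c * (x s.unop * w)
    rw [map_smul, smul_eq_mul, mul_assoc]

theorem tensorMapL_surjective {B : Type u} [Ring B] [Algebra k B] {L L' : Type u}
    [AddCommGroup L] [Module Bᵐᵒᵖ L] [AddCommGroup L'] [Module Bᵐᵒᵖ L']
    (M : ModuleCat.{u} (B ⊗[k] Aᵐᵒᵖ)) (g : L →ₗ[Bᵐᵒᵖ] L') (hg : Function.Surjective g) :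
    Function.Surjective (tensorMapL M g) := by
  intro y
  induction y using tmk_induction with
  | h m l =>
    obtain ⟨l, rfl⟩ := hg l
    exact ⟨tmk m l, rfl⟩
  | hadd y z hy hz =>
    obtain ⟨y, rfl⟩ := hy
    obtain ⟨z, rfl⟩ := hz
    exact ⟨y + z, map_add _ _ _⟩

/-- The complexes at the points of a rational family have terms which are direct summands of the
terms of the other complexes of the family. -/
theorem RationalFamily.inClass_point (F : RationalFamily k A) {b : ℤ →₀ ℕ}
    (x : Localization.Away F.f →ₐ[k] k) {e : ℕ} (he : e ≠ 0)
    (hC : InClass b (tensorComplex (Localization.Away F.f ⧸ RingHom.ker x ^ e) F.P)) :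
    InClass b (tensorComplex (PointModule x.toRingHom) F.P) := by
  have := isScalarTower_pointModule x
  have hmin := F.isMinimalFamily.isMinimal_tensorComplex (PointModule x.toRingHom)
  refine ⟨hmin, fun i => ?_⟩
  -- The residue map `B/𝔪^e → k` exists because `e ≠ 0`. The induced surjection of terms splits, its
  -- target being projective.
  let g₀ : Localization.Away F.f ⧸ RingHom.ker x ^ e →+* k :=
    Ideal.Quotient.lift _ x.toRingHom fun s hs => Ideal.pow_le_self he hs
  let g : (Localization.Away F.f ⧸ RingHom.ker x ^ e) →ₗ[(Localization.Away F.f)ᵐᵒᵖ]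
      PointModule x.toRingHom :=
    { toFun := g₀
      map_add' := map_add g₀
      map_smul' := fun s y => by
        obtain ⟨y, rfl⟩ := Ideal.Quotient.mk_surjective y
        change x (y * s.unop) = x s.unop * x y
        rw [map_mul, mul_comm] }
  have hg : Function.Surjective g := fun c =>
    ⟨Ideal.Quotient.mk _ (algebraMap k _ c), x.commutes c⟩
  have := hmin.projective i
  let G : (tensorComplex (Localization.Away F.f ⧸ RingHom.ker x ^ e) F.P).X i →ₗ[Aᵐᵒᵖ]
      (tensorComplex (PointModule x.toRingHom) F.P).X i := (tensorMapL (F.P.X i) g).hom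
  obtain ⟨s, hs⟩ := Module.projective_lifting_property G LinearMap.id
    (tensorMapL_surjective (F.P.X i) g hg)
  exact IsRetract.trans ⟨s, G, hs⟩ (hC.isRetract i)

/-- Some term of `P` in the support of `b` is nonzero, and tensoring with it cannot make `L = B/𝔪^e`
smaller, while `dim L ≥ e`. Thus a dimension bound leaves finitely many exponents. -/
theorem RationalFamily.le_tdim [IsAlgClosed k] [Module.Finite k A] (F : RationalFamily k A) {b : ℤ →₀ ℕ}
    (x : Localization.Away F.f →ₐ[k] k) {e : ℕ}
    [Module.Finite k (Localization.Away F.f ⧸ RingHom.ker x ^ e)]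
    (hC : InClass b (tensorComplex (Localization.Away F.f ⧸ RingHom.ker x ^ e) F.P))
    (h0 : ¬ IsZero (tensorComplex (Localization.Away F.f ⧸ RingHom.ker x ^ e) F.P)) :
    e ≤ tdim k b (tensorComplex (Localization.Away F.f ⧸ RingHom.ker x ^ e) F.P) := by
  have := isDomain_localizationAway F.f_ne_zero
  have := isPrincipalIdealRing_localizationAway (f := F.f)
  have h1 : ∃ i ∈ b.support, ¬ Subsingleton (F.P.X i) := by
    by_contra! hcon
    refine h0 (by_contra fun h0 => ?_)
    have h2 := hC.tdim_pos k h0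
    rw [tdim, Finset.sum_pos_iff] at h2
    obtain ⟨i, hi, h3⟩ := h2
    have := hcon i hi
    have h4 : Subsingleton ((tensorComplex (Localization.Away F.f ⧸ RingHom.ker x ^ e) F.P).X i) :=
      subsingleton_of_forall_eq 0 fun (y : (tensorFunctor _).obj (F.P.X i)) => by
        induction y using tmk_induction with
        | h m l => rw [Subsingleton.elim m 0]; exact tmk_zero_left l
        | hadd y z hy hz => exact (congrArg₂ (· + ·) hy hz).trans (add_zero _)
    have h5 : kdim k ((tensorComplex (Localization.Away F.f ⧸ RingHom.ker x ^ e) F.P).X i) = 0 :=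
      @Module.finrank_zero_of_subsingleton k _ _ _ (_) _ h4
    omega
  obtain ⟨i, hi, h2⟩ := h1
  have := F.isMinimalFamily.finite i
  have := F.isMinimalFamily.projective i
  have h3 : Module.Finite Aᵐᵒᵖ ((tensorFunctor (k := k) (A := A)
      (Localization.Away F.f ⧸ RingHom.ker x ^ e)).obj (F.P.X i)) := hC.isMinimal.finite i
  refine (le_finrank_quotient_pow F.f_ne_zero x e).trans
    ((finrank_le_kdim_tensor (F.P.X i) h2 (Localization.Away F.f ⧸ RingHom.ker x ^ e)).trans ?_)
  exact Finset.single_le_sum (f := fun i => kdim k ((tensorComplex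
    (Localization.Away F.f ⧸ RingHom.ker x ^ e) F.P).X i)) (fun _ _ => Nat.zero_le _) hi

/-- Indecomposable minimal complexes of bounded rank over a derived tame algebra form finitely many
one-parameter families. -/
theorem DerivedTame.finCovered_indecomposable [IsAlgClosed k] [Module.Finite k A] (h : DerivedTame k A)
    (b : ℤ →₀ ℕ) (d : ℕ) :
    FinCovered k 1 {C : ChainComplex (ModuleCat.{u} Aᵐᵒᵖ) ℤ |
      InClass b C ∧ Indecomposable C ∧ tdim k b C ≤ d} := by
  obtain ⟨M, hM, hE⟩ := h
  choose E hE hcov using hE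
  obtain ⟨T, hT, hTcov⟩ := exists_finite_ranks (A := A) k b
  have h1 : FinCovered k 1 (⋃ r ∈ T, ⋃ D ∈ E r, {C : ChainComplex (ModuleCat.{u} Aᵐᵒᵖ) ℤ |
      IsMinimal C ∧ Nonempty (C ≅ D)}) := by
    refine FinCovered.biUnion hT fun r _ => FinCovered.biUnion (hE r) fun D _ => ?_
    -- The exceptional complexes `D` need not be minimal; only those isomorphic to a minimal complex
    -- matter.
    by_cases hD : ∃ C, IsMinimal C ∧ Nonempty (C ≅ D)
    · obtain ⟨C, hC, ⟨e⟩⟩ := hD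
      exact (FinCovered.isoClass hC).mono zero_le_one fun C' ⟨_, ⟨e'⟩⟩ => ⟨e.trans e'.symm⟩
    · exact ⟨∅, Set.finite_empty, fun p hp => hp.elim, fun C hC => (hD ⟨C, hC⟩).elim⟩
  have h2 : FinCovered k 1 (⋃ r ∈ T, ⋃ F ∈ {F ∈ M | F.HasVectorRank r}, ⋃ e ∈ Set.Iic d,
      {C : ChainComplex (ModuleCat.{u} Aᵐᵒᵖ) ℤ | ∃ x : Localization.Away F.f →ₐ[k] k,
        Nonempty (C ≅ tensorComplex (Localization.Away F.f ⧸ RingHom.ker x ^ e) F.P)}) := by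
    refine FinCovered.biUnion hT fun r _ => FinCovered.biUnion (hM r) fun F _ =>
      FinCovered.biUnion (Set.finite_Iic d) fun e _ => ?_
    refine ⟨{F.param e}, Set.finite_singleton _, fun p hp => ?_, fun C ⟨x, ⟨i⟩⟩ =>
      ⟨_, rfl, (F.param_realizes e x).of_iso i.symm⟩⟩
    rw [hp]
    exact le_rfl
  refine (h1.union h2).mono le_rfl fun C ⟨hC, hi, hd⟩ => ?_
  obtain ⟨r, hr, hCr⟩ := hTcov C hC
  rcases hcov r C hC.isMinimal hi hCr with ⟨D, hD, e⟩ | ⟨F, hF, L, _, _, _, _, hL, ⟨iso⟩⟩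
  · exact Or.inl (Set.mem_iUnion₂.2 ⟨r, hr, Set.mem_iUnion₂.2 ⟨D, hD, hC.isMinimal, e⟩⟩)
  · obtain ⟨x, e, he, hfin, ⟨iso⟩⟩ := exists_point_of_indecomposable F.f_ne_zero L F.P hi iso
    have hC' := hC.of_iso iso
    -- Finiteness in tameness concerns the rank of `F` at one-dimensional modules, not that of `C`.
    -- The terms at the point `x` are summands of those of `C`, so this rank is also among finitely
    -- many.
    obtain ⟨r', hr', hxr⟩ := hTcov _ (F.inClass_point x he hC')
    have hrank : F.HasVectorRank r' := ⟨PointModule x.toRingHom, inferInstance, inferInstance,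
      inferInstance, isScalarTower_pointModule x, finrank_pointModule _, hxr⟩
    have hed : e ≤ d := by
      refine (F.le_tdim x hC' fun hz => hi.1 (hz.of_iso iso)).trans ?_
      rw [← tdim_eq_of_iso k iso]
      exact hd
    exact Or.inr (Set.mem_iUnion₂.2 ⟨r', hr', Set.mem_iUnion₂.2 ⟨F, ⟨hF, hrank⟩,
      Set.mem_iUnion₂.2 ⟨e, hed, x, ⟨iso⟩⟩⟩⟩)

instance {V : Variety k} (x : V.Point) {U : V.X.Opens} (hx : x.pt ∈ U) :
    Module k (VarietyFamily.ResidueModule x hx) := inferInstanceAs (Module k k)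

instance {V : Variety k} (x : V.Point) {U : V.X.Opens} (hx : x.pt ∈ U) :
    Module.Finite k (VarietyFamily.ResidueModule x hx) := inferInstanceAs (Module.Finite k k)

theorem VarietyFamily.isMinimal_fiber {V : Variety k} (P : VarietyFamily k A V) (x : V.Point) :
    IsMinimal (P.fiber x) := by
  have hst : IsScalarTower k Γ(V.X, P.chart x)ᵐᵒᵖ
      (VarietyFamily.ResidueModule x (P.mem_chart x)) := ⟨fun c s v => by
    let w : k := v
    change x.eval (P.mem_chart x) (c • s.unop) * w = c * (x.eval (P.mem_chart x) s.unop * w)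
    rw [Algebra.smul_def, map_mul, Variety.Point.eval_algebraMap, mul_assoc]⟩
  have h : IsMinimalFamily k Γ(V.X, P.chart x) A (P.sections (P.chart x)) :=
    (P.exists_chart x.pt).choose_spec.2.2
  exact h.isMinimal_tensorComplex (VarietyFamily.ResidueModule x (P.mem_chart x))

/-- The number of parameters of complexes over a derived tame algebra. -/
theorem DerivedTame.par_le [IsAlgClosed k] [Module.Finite k A] (h : DerivedTame k A) (b : ℤ →₀ ℕ) :
    par k A b ≤ (((b.sum fun _ n => n) * Module.finrank k A : ℕ) : WithBot ℕ∞) := by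
  refine sSup_le ?_
  rintro _ ⟨V, P, hP, rfl⟩
  obtain ⟨T, hT, hn, hcov⟩ := finCovered_of_indecomposable (h.finCovered_indecomposable b)
    ((b.sum fun _ n => n) * Module.finrank k A)
  have := hT.to_subtype
  obtain ⟨N, ⟨E⟩⟩ := Finite.exists_equiv_fin T
  refine P.par_le (ι := ULift.{u} (Fin N)) (fun i => (E.symm i.down : Param k A))
    (fun i => hn _ (E.symm i.down).2) fun x => ?_
  have hC : InClass b (P.fiber x) := ⟨P.isMinimal_fiber x, fun i => by
    obtain ⟨e⟩ := hP x i
    exact IsRetract.of_equiv e.toLinearEquiv⟩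
  -- The bound in the theorem is the total dimension of the complexes.
  have hd : tdim k b (P.fiber x) = (b.sum fun _ n => n) * Module.finrank k A := by
    rw [tdim, Finsupp.sum, Finset.sum_mul]
    refine Finset.sum_congr rfl fun i _ => ?_
    obtain ⟨e⟩ := hP x i
    rw [kdim_eq_of_iso k e]
    exact kdim_free k _
  obtain ⟨p, hp, hx⟩ := hcov _ ⟨hC, hd.le⟩
  refine ⟨⟨E ⟨p, hp⟩⟩, ?_⟩
  simp only [Equiv.symm_apply_apply]
  exact hx

end Tame

end

section

/-! ### Complexes of free modules which contain a given complex -/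

section FreeCover

variable {R : Type u} [Ring R] {C : ChainComplex (ModuleCat.{u} R) ℤ} {F : ℤ → ModuleCat.{u} R}
  (s : ∀ i, C.X i ⟶ F i) (p : ∀ i, F i ⟶ C.X i) (h : ∀ i, s i ≫ p i = 𝟙 (C.X i))

/-- The complex with the terms `F i` and the differentials of its direct summand `C`. -/
def extendComplex : ChainComplex (ModuleCat.{u} R) ℤ where
  X := F
  d i j := p i ≫ C.d i j ≫ s j
  shape i j hij := by rw [C.shape i j hij, zero_comp, comp_zero]
  d_comp_d' i j l _ _ := by
    simp only [Category.assoc, reassoc_of% (h j), HomologicalComplex.d_comp_d_assoc, zero_comp,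
      comp_zero]

/-- The inclusion of the direct summand. -/
def toExtendComplex : C ⟶ extendComplex s p h where
  f := s
  comm' i j _ := by
    change s i ≫ p i ≫ C.d i j ≫ s j = C.d i j ≫ s j
    rw [reassoc_of% (h i)]

/-- The projection to the direct summand. -/
def fromExtendComplex : extendComplex s p h ⟶ C where
  f := p
  comm' i j _ := by
    change p i ≫ C.d i j = (p i ≫ C.d i j ≫ s j) ≫ p j
    rw [Category.assoc, Category.assoc, h j, Category.comp_id]

theorem toExtendComplex_from : toExtendComplex s p h ≫ fromExtendComplex s p h = 𝟙 C := by
  ext i : 1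
  exact h i

theorem extendComplex_isMinimalOver {J : Set R} (hC : IsMinimalOver J C)
    (hF : ∀ i, Module.Finite R (F i)) (hF' : ∀ i, Module.Projective R (F i))
    (hb : ∃ m n : ℤ, ∀ i : ℤ, (i < m ∨ n < i) → IsZero (F i)) :
    IsMinimalOver J (extendComplex s p h) where
  bounded := hb
  finite := hF
  projective := hF'
  minimal i j x := by
    have h1 := hC.minimal i j (p i x)
    change (s j).hom (C.d i j (p i x)) ∈ Submodule.span R
      {y : F j | ∃ r ∈ J, ∃ m : F j, y = r • m}
    generalize C.d i j (p i x) = y at h1 ⊢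
    induction h1 using Submodule.span_induction with
    | mem y hy =>
      obtain ⟨r, hr, m, rfl⟩ := hy
      exact Submodule.subset_span ⟨r, hr, s j m, (s j).hom.map_smul r m⟩
    | zero => rw [map_zero]; exact Submodule.zero_mem _
    | add y z _ _ hy hz => rw [map_add]; exact Submodule.add_mem _ hy hz
    | smul r y _ hy => rw [map_smul]; exact Submodule.smul_mem _ _ hy

/-- A minimal complex is a direct summand of a minimal complex of free modules, whose differentials
factor through the summand. -/
theorem IsMinimalOver.exists_freeCover {J : Set R} (hC : IsMinimalOver J C) :
    ∃ (n : ℤ →₀ ℕ) (F : ChainComplex (ModuleCat.{u} R) ℤ) (s : C ⟶ F) (p : F ⟶ C),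
      IsMinimalOver J F ∧ s ≫ p = 𝟙 C ∧ (∀ i, Nonempty (F.X i ≅ ModuleCat.of R (Fin (n i) → R))) ∧
      ∀ i j, F.d i j = p.f i ≫ C.d i j ≫ s.f j := by
  have h1 (i : ℤ) : ∃ n : ℕ, (Subsingleton (C.X i) → n = 0) ∧
      ∃ (s : C.X i ⟶ ModuleCat.of R (Fin n → R)) (p : ModuleCat.of R (Fin n → R) ⟶ C.X i),
        s ≫ p = 𝟙 (C.X i) := by
    by_cases hs : Subsingleton (C.X i)
    · exact ⟨0, fun _ => rfl, 0, 0, (ModuleCat.isZero_of_subsingleton _).eq_of_src _ _⟩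
    · have := hC.finite i
      have := hC.projective i
      obtain ⟨n, p, hp⟩ := Module.Finite.exists_fin' R (C.X i)
      obtain ⟨s, hs'⟩ := Module.projective_lifting_property p LinearMap.id hp
      exact ⟨n, fun h => (hs h).elim, ModuleCat.ofHom s, ModuleCat.ofHom p,
        ModuleCat.hom_ext hs'⟩
  choose n hn s p h using h1
  obtain ⟨a, b, hab⟩ := hC.bounded
  have h0 (i : ℤ) (hi : i < a ∨ b < i) : n i = 0 :=
    hn i (ModuleCat.subsingleton_of_isZero (hab i hi))
  have hfin : (Function.support n).Finite := (Set.finite_Icc a b).subset fun i hi => by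
    by_contra hcon
    rw [Set.mem_Icc, not_and_or, not_le, not_le] at hcon
    exact hi (h0 i hcon)
  refine ⟨Finsupp.ofSupportFinite n hfin, extendComplex s p h, toExtendComplex s p h,
    fromExtendComplex s p h, extendComplex_isMinimalOver s p h hC (fun i => ?_) (fun i => ?_)
    ⟨a, b, fun i hi => ?_⟩, toExtendComplex_from s p h, fun i => ⟨Iso.refl _⟩, fun i j => rfl⟩
  · exact inferInstanceAs (Module.Finite R (Fin (n i) → R))
  · exact inferInstanceAs (Module.Projective R (Fin (n i) → R))
  · have : IsEmpty (Fin (n i)) := by rw [h0 i hi]; infer_instance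
    exact ModuleCat.isZero_of_subsingleton _

end FreeCover

/-! ### Tensor products of free bimodules. -/

section FreeRank

variable {k B A : Type u} [Field k] [Ring B] [Algebra k B] [Ring A] [Algebra k A]

theorem sum_smul_single {R : Type*} [Ring R] {n : ℕ} (z : Fin n → R) :
    ∑ i, z i • (Pi.single i 1 : Fin n → R) = z := by
  refine (Finset.sum_congr rfl fun i _ => ?_).trans (Finset.univ_sum_single z)
  rw [← Pi.single_smul, smul_eq_mul, mul_one]

/-- The tensor product of a free bimodule with a vector space is free. -/
theorem tensorFunctor_free (n : ℕ) (L : Type u) [AddCommGroup L] [Module k L] [Module Bᵐᵒᵖ L]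
    [IsScalarTower k Bᵐᵒᵖ L] [Module.Finite k L] :
    Nonempty ((tensorFunctor (k := k) (A := A) L).obj
      (ModuleCat.of (B ⊗[k] Aᵐᵒᵖ) (Fin n → B ⊗[k] Aᵐᵒᵖ)) ≅
      ModuleCat.of Aᵐᵒᵖ (Fin (n * Module.finrank k L) → A)) := by
  have hcomm : SMulCommClass k Bᵐᵒᵖ L := IsScalarTower.to_smulCommClass
  let M := ModuleCat.of (B ⊗[k] Aᵐᵒᵖ) (Fin n → B ⊗[k] Aᵐᵒᵖ)
  let x (i : Fin n) : M := (Pi.single i 1 : Fin n → B ⊗[k] Aᵐᵒᵖ)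
  let f (i : Fin n) : M →ₗ[B ⊗[k] Aᵐᵒᵖ] B ⊗[k] Aᵐᵒᵖ := LinearMap.proj i
  let β := Module.finBasis k L
  obtain ⟨G, hG, hG'⟩ := exists_baseObj_dualBasis (S := k) (L := L) M x f (fun y => by
      let z : Fin n → B ⊗[k] Aᵐᵒᵖ := y
      exact sum_smul_single z) β (fun j => β.coord j)
    (fun y => β.sum_repr y)
  -- The product of the two dual bases comes from bases, so its coordinates are orthonormal and it
  -- is a basis.
  have hGe (i i' : Fin n) (j j') : G (i', j') (bmk k (x i) (β j)) =
      if (i', j') = (i, j) then 1 else 0 := by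
    by_cases hi : i' = i
    · subst hi
      rw [hG' (i', j') (x i') (β j) 1 1 (Pi.single_eq_same (M := fun _ => B ⊗[k] Aᵐᵒᵖ) i' 1), op_one,
        one_smul]
      by_cases hj : j' = j
      · subst hj
        simp [Algebra.TensorProduct.one_def]
      · simp [hj, Finsupp.single_eq_of_ne hj]
    · rw [hG' (i', j') (x i) (β j) 0 0 ((Pi.single_eq_of_ne (M := fun _ => B ⊗[k] Aᵐᵒᵖ) hi 1).trans
        (TensorProduct.zero_tmul _ _).symm), TensorProduct.tmul_zero]
      simp [hi]
  have hlid (a : Aᵐᵒᵖ) (y : BaseObj k L M) : a • y = ((1 : k) ⊗ₜ[k] a) • y := by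
    rw [lid_smul_baseObj, Algebra.TensorProduct.lid_tmul, one_smul]
  let lid := Algebra.TensorProduct.lid k Aᵐᵒᵖ
  let φ : BaseObj k L M →ₗ[Aᵐᵒᵖ] (Fin n × Fin (Module.finrank k L) → A) :=
    { toFun := fun y ij => (lid (G ij y)).unop
      map_add' := fun y z => funext fun ij => by
        rw [map_add, map_add, MulOpposite.unop_add]
        rfl
      map_smul' := fun a y => funext fun ij => by
        rw [hlid, map_smul, smul_eq_mul, map_mul, Algebra.TensorProduct.lid_tmul, one_smul,
          unop_mul]
        rfl }
  have hφ : Function.Bijective φ := by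
    refine ⟨(injective_iff_map_eq_zero φ).2 fun y hy => ?_, fun v => ?_⟩
    · rw [← hG y]
      refine Finset.sum_eq_zero fun ij _ => ?_
      have h1 : G ij y = 0 :=
        lid.injective ((unop_injective (congrFun hy ij)).trans (map_zero lid).symm)
      rw [h1]
      exact zero_smul (k ⊗[k] Aᵐᵒᵖ) (bmk k (x ij.1) (β ij.2))
    · refine ⟨∑ ij, op (v ij) • bmk k (x ij.1) (β ij.2), ?_⟩
      rw [map_sum]
      have h1 (ij) : φ (op (v ij) • bmk k (x ij.1) (β ij.2)) = Pi.single ij (v ij) := by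
        rw [map_smul]
        ext ij'
        change (lid (G ij' _)).unop * v ij = _
        rw [hGe]
        by_cases h : ij' = ij
        · subst h
          simp [lid]
        · rw [if_neg h, Pi.single_eq_of_ne h, map_zero, MulOpposite.unop_zero, zero_mul]
      rw [Finset.sum_congr rfl fun ij _ => h1 ij, Finset.univ_sum_single]
  exact ⟨((LinearEquiv.ofBijective φ hφ).trans
    (LinearEquiv.funCongrLeft Aᵐᵒᵖ A finProdFinEquiv.symm)).toModuleIso⟩

end FreeRank

end

section

/-! ### Cancellation -/

section Cancellation

open Polynomial in
/-- In a finite-dimensional algebra without nontrivial idempotents, all elements are invertible or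
nilpotent. -/
theorem isUnit_or_isNilpotent (k : Type*) {E : Type*} [Field k] [Ring E] [Algebra k E]
    [Module.Finite k E] (hE : ∀ e : E, e * e = e → e = 0 ∨ e = 1) (x : E) :
    IsUnit x ∨ IsNilpotent x := by
  obtain ⟨q, hq, hXq⟩ := exists_eq_pow_rootMultiplicity_mul_and_not_dvd (minpoly k x)
    (minpoly.ne_zero (Algebra.IsIntegral.isIntegral x)) 0
  rw [C_0, sub_zero] at hq hXq
  set m := rootMultiplicity 0 (minpoly k x)
  -- The minimal polynomial is `X ^ m * q` with `X` prime to `q`, and `a X^(m+1) + b q = 1`. Then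
  -- `(b q)(x)` is idempotent; if it is `0`, then `x` is invertible, and if it is `1`, then `x ^ m =
  -- 0`.
  obtain ⟨a, b, hab⟩ : IsCoprime (X ^ (m + 1)) q :=
    ((irreducible_X (R := k)).coprime_iff_not_dvd.2 hXq).pow_left
  obtain ⟨φ, hφ⟩ : ∃ φ : k[X] →+* E, φ = (aeval x : k[X] →ₐ[k] E).toRingHom := ⟨_, rfl⟩
  have hX : φ X = x := by rw [hφ]; exact aeval_X x
  have hm : φ (X ^ m * q) = 0 := by rw [← hq, hφ]; exact minpoly.aeval k x
  have h2 : φ (b * q) * φ (b * q) = φ (b * q) := by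
    have h3 : b * q * (b * q) = b * q - b * a * X * (X ^ m * q) := by
      linear_combination (b * q) * hab
    rw [← map_mul, h3, map_sub, map_mul φ _ (X ^ m * q), hm, mul_zero, sub_zero]
  rcases hE _ h2 with h | h
  · left
    have h5 : φ (a * X ^ m) * x = 1 := by
      rw [← hX, ← map_mul, ← add_zero (φ _), ← h, ← map_add, ← map_one φ, ← hab, pow_succ,
        mul_assoc]
    have h6 : x * φ (a * X ^ m) = 1 := by
      rw [← h5]
      nth_rw 1 [← hX]
      rw [← map_mul, mul_comm, map_mul, hX]
    exact ⟨⟨x, _, h6, h5⟩, rfl⟩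
  · right
    refine ⟨m, ?_⟩
    rw [← mul_one (x ^ m), ← h, ← hX, ← map_pow, ← map_mul, mul_left_comm, map_mul, hm, mul_zero]

variable {𝒞 : Type*} [Category 𝒞] [Preadditive 𝒞] [HasBinaryBiproducts 𝒞]

/-- Objects all of whose endomorphisms are invertible or nilpotent can be cancelled. -/
theorem cancel_of_isUnit_or_isNilpotent {Z X Y : 𝒞} (hZ : ∀ x : End Z, IsUnit x ∨ IsNilpotent x)
    (f : Z ⊞ X ≅ Z ⊞ Y) : Nonempty (X ≅ Y) := by
  let a : End Z := biprod.inl ≫ f.hom ≫ biprod.fst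
  let a' : End Z := biprod.inl ≫ f.inv ≫ biprod.fst
  let r : Z ⟶ X := biprod.inl ≫ f.inv ≫ biprod.snd
  let c : X ⟶ Z := biprod.inr ≫ f.hom ≫ biprod.fst
  let w : End Z := r ≫ c
  -- The corner at `Z` of `f⁻¹` followed by `f`; in `End Z` products are compositions read from
  -- right to left.
  have h : a * a' + w = 1 := by
    change (biprod.inl ≫ f.inv ≫ biprod.fst) ≫ (biprod.inl ≫ f.hom ≫ biprod.fst) +
      (biprod.inl ≫ f.inv ≫ biprod.snd) ≫ (biprod.inr ≫ f.hom ≫ biprod.fst) = 𝟙 Z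
    have h1 : biprod.inl ≫ f.inv ≫ (biprod.fst ≫ biprod.inl + biprod.snd ≫ biprod.inr) ≫
        f.hom ≫ biprod.fst = 𝟙 Z := by
      rw [biprod.total, Category.id_comp, Iso.inv_hom_id_assoc, biprod.inl_fst]
    rw [← h1]
    simp only [Preadditive.add_comp, Preadditive.comp_add, Category.assoc]
  -- A unipotent automorphism of `Z ⊞ X` changes the corner `a` of `f` into `a + w t`. Once that
  -- corner is invertible, Gaussian elimination gives `X ≅ Y`.
  have hcrit (t : End Z) (ht : IsUnit (a + w * t)) : Nonempty (X ≅ Y) := by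
    let g : Z ⊞ X ≅ Z ⊞ Y := (Biprod.unipotentUpper (t ≫ r)).trans f
    have hg : biprod.inl ≫ g.hom ≫ biprod.fst = a + w * t := by
      change biprod.inl ≫ (Biprod.ofComponents (𝟙 Z) (t ≫ r) 0 (𝟙 X) ≫ f.hom) ≫ biprod.fst =
        biprod.inl ≫ f.hom ≫ biprod.fst + t ≫ r ≫ c
      have h2 : biprod.inl ≫ Biprod.ofComponents (𝟙 Z) (t ≫ r) 0 (𝟙 X) =
          biprod.inl + t ≫ r ≫ biprod.inr := by
        ext <;> simp
      rw [Category.assoc, reassoc_of% h2]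
      simp only [Preadditive.add_comp, Category.assoc, c]
    have : IsIso (biprod.inl ≫ g.hom ≫ biprod.fst) := by
      rw [hg]
      exact (isUnit_iff_isIso _).1 ht
    exact ⟨Biprod.isoElim g⟩
  rcases hZ a with ha | ha
  · refine hcrit 0 ?_
    rwa [mul_zero, add_zero]
  -- Now `a` is nilpotent. If `a a'` is a unit, `a` and all its powers have right inverses, so `End
  -- Z` is zero. Otherwise `w = 1 - a a'` is a unit and `t = w⁻¹ (1 - a)` makes the corner equal to
  -- `1`.
  rcases hZ (a * a') with h1 | h1
  · refine hcrit 0 ?_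
    rw [mul_zero, add_zero]
    obtain ⟨n, hn⟩ := ha
    have h2 (m : ℕ) : ∃ y, a ^ m * y = 1 := by
      induction m with
      | zero => exact ⟨1, by rw [pow_zero, one_mul]⟩
      | succ m ih =>
        obtain ⟨y, hy⟩ := ih
        obtain ⟨u, hu⟩ := h1
        refine ⟨a' * ↑u⁻¹ * y, ?_⟩
        rw [pow_succ, mul_assoc, ← mul_assoc a, ← mul_assoc a, ← hu, u.mul_inv, one_mul, hy]
    obtain ⟨y, hy⟩ := h2 n
    rw [hn, zero_mul] at hy
    have := subsingleton_of_zero_eq_one hy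
    exact isUnit_of_subsingleton _
  · have h2 : IsUnit w := by
      rw [← add_sub_cancel_left (a * a') w, h]
      exact h1.isUnit_one_sub
    obtain ⟨u, hu⟩ := h2
    refine hcrit (↑u⁻¹ * (1 - a)) ?_
    rw [← hu, u.mul_inv_cancel_left, add_sub_cancel]
    exact isUnit_one

/-- Indecomposable objects with idempotents split have no nontrivial idempotents. -/
theorem Indecomposable.eq_zero_or_eq_one [IsIdempotentComplete 𝒞] {Z : 𝒞} (hZ : Indecomposable Z)
    (e : End Z) (he : e * e = e) : e = 0 ∨ e = 1 := by
  have he' : (1 - e) * (1 - e) = 1 - e := by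
    simp only [mul_sub, sub_mul, one_mul, mul_one, he, sub_self, sub_zero]
  obtain ⟨Y, i, p, hip, hpi⟩ := IsIdempotentComplete.idempotents_split Z e he
  obtain ⟨Y', i', p', hip', hpi'⟩ := IsIdempotentComplete.idempotents_split Z (1 - e) he'
  have htot : p ≫ i + p' ≫ i' = 𝟙 Z := by
    rw [hpi, hpi']
    exact add_sub_cancel e (1 : End Z)
  have h1 : i ≫ p' = 0 := by
    have h2 : i = i ≫ e := by rw [← hpi, reassoc_of% hip]
    have h3 : p' = (1 - e : End Z) ≫ p' := by rw [← hpi', Category.assoc, hip', Category.comp_id]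
    have h4 : e ≫ (1 - e : End Z) = 0 := by
      change (1 - e) * e = 0
      rw [sub_mul, one_mul, he, sub_self]
    rw [h2, h3, Category.assoc, reassoc_of% h4, zero_comp, comp_zero]
  have h1' : i' ≫ p = 0 := by
    have h2 : i' = i' ≫ (1 - e : End Z) := by rw [← hpi', reassoc_of% hip']
    have h3 : p = e ≫ p := by rw [← hpi, Category.assoc, hip, Category.comp_id]
    have h4 : (1 - e : End Z) ≫ e = 0 := by
      change e * (1 - e) = 0
      rw [mul_sub, mul_one, he, sub_self]
    rw [h2, h3, Category.assoc, reassoc_of% h4, zero_comp, comp_zero]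
  let β : BinaryBicone Y Y' :=
    { pt := Z
      fst := p
      snd := p'
      inl := i
      inr := i'
      inl_fst := hip
      inl_snd := h1
      inr_fst := h1'
      inr_snd := hip' }
  have hβ : β.IsBilimit := isBinaryBilimitOfTotal β htot
  rcases hZ.2 Y Y' (biprod.uniqueUpToIso _ _ hβ) with h | h
  · left
    rw [← hpi, h.eq_of_tgt p 0, zero_comp]
  · right
    have h5 : (1 - e : End Z) = 0 := by
      rw [← hpi', h.eq_of_tgt p' 0, zero_comp]
    exact (sub_eq_zero.1 h5).symm

end Cancellation

/-! ### Cancellation of minimal complexes. -/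

section CancelComplex

variable {A : Type u} [Ring A] {b : ℤ →₀ ℕ}

open scoped ModuleCat in
theorem InClass.finite_end (k : Type u) [Field k] [Algebra k A] [Module.Finite k A]
    {C : ChainComplex (ModuleCat.{u} Aᵐᵒᵖ) ℤ} (hC : InClass b C) :
    Module.Finite k (End C) := by
  have hfin (i : ℤ) : Module.Finite k (C.X i) := by
    have := hC.isMinimal.finite i
    exact Module.Finite.trans Aᵐᵒᵖ (C.X i)
  let φ : End C →ₗ[k] ∀ i : b.support, (C.X i →ₗ[k] C.X i) :=
    { toFun := fun f i => (f.f i).hom.restrictScalars k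
      map_add' := fun f g => rfl
      map_smul' := fun c f => rfl }
  refine Module.Finite.of_injective φ fun f g hfg => ?_
  refine HomologicalComplex.hom_ext _ _ fun i => ?_
  by_cases hi : i ∈ b.support
  · refine ModuleCat.hom_ext (LinearMap.ext fun x => ?_)
    exact LinearMap.congr_fun (congrFun hfg ⟨i, hi⟩) x
  · have := hC.subsingleton hi
    exact (ModuleCat.isZero_of_subsingleton _).eq_of_src _ _

/-- Minimal complexes over a finite-dimensional algebra can be cancelled. -/
theorem InClass.cancel (k : Type u) [Field k] [Algebra k A] [Module.Finite k A]
    {Z X Y : ChainComplex (ModuleCat.{u} Aᵐᵒᵖ) ℤ} (hZ : InClass b Z)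
    (f : Z ⊞ X ≅ Z ⊞ Y) : Nonempty (X ≅ Y) := by
  induction h : tdim k b Z using Nat.strong_induction_on generalizing Z X Y with
  | _ n ih =>
  by_cases hz : IsZero Z
  · exact ⟨(isoZeroBiprod hz).trans (f.trans (isoZeroBiprod hz).symm)⟩
  by_cases hi : Indecomposable Z
  · have := hZ.finite_end k
    have : IsIdempotentComplete (ChainComplex (ModuleCat.{u} Aᵐᵒᵖ) ℤ) :=
      Idempotents.isIdempotentComplete_of_abelian _
    exact cancel_of_isUnit_or_isNilpotent
      (isUnit_or_isNilpotent k (Indecomposable.eq_zero_or_eq_one hi)) f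
  have h4 : ∃ Z₁ Z₂, ∃ _ : Z ≅ Z₁ ⊞ Z₂, ¬ IsZero Z₁ ∧ ¬ IsZero Z₂ := by
    by_contra! hcon
    exact hi ⟨hz, fun Y Z e => or_iff_not_imp_left.2 (hcon Y Z e)⟩
  obtain ⟨Z₁, Z₂, e, h₁, h₂⟩ := h4
  have hZ₁ : InClass b Z₁ := (hZ.of_iso e).of_retract biprod.inl biprod.fst biprod.inl_fst
  have hZ₂ : InClass b Z₂ := (hZ.of_iso e).of_retract biprod.inr biprod.snd biprod.inr_snd
  have h5 := tdim_eq_of_iso k (b := b) e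
  rw [tdim_biprod k hZ₁ hZ₂] at h5
  have h6 := hZ₁.tdim_pos k h₁
  have h7 := hZ₂.tdim_pos k h₂
  -- A decomposable `Z` is cancelled in two steps, each with a summand of smaller dimension.
  obtain ⟨g⟩ := ih _ (by omega) hZ₁ (X := Z₂ ⊞ X) (Y := Z₂ ⊞ Y)
    ((biprod.associator Z₁ Z₂ X).symm.trans ((biprod.mapIso e.symm (Iso.refl X)).trans
      (f.trans ((biprod.mapIso e (Iso.refl Y)).trans (biprod.associator Z₁ Z₂ Y))))) rfl
  exact ih _ (by omega) hZ₂ g rfl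

end CancelComplex

end

section

/-! ### Modules over a free algebra given by blocks -/

section Block

variable {k S : Type u} [Field k] [CommRing S] [Algebra k S] {c : ℕ}

/-- The module `S^c ⊕ S^c` over a free algebra, the generators of which act through the
off-diagonal blocks `M j`. -/
def BlockModule (_M : Fin 4 → Matrix (Fin c) (Fin c) S) : Type u := (Fin c → S) × (Fin c → S)

variable (M : Fin 4 → Matrix (Fin c) (Fin c) S)

instance : AddCommGroup (BlockModule M) :=
  inferInstanceAs (AddCommGroup ((Fin c → S) × (Fin c → S)))
instance : Module S (BlockModule M) := inferInstanceAs (Module S ((Fin c → S) × (Fin c → S)))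
instance : Module k (BlockModule M) := inferInstanceAs (Module k ((Fin c → S) × (Fin c → S)))
instance : IsScalarTower k S (BlockModule M) :=
  inferInstanceAs (IsScalarTower k S ((Fin c → S) × (Fin c → S)))
instance : SMulCommClass S k (BlockModule M) :=
  inferInstanceAs (SMulCommClass S k ((Fin c → S) × (Fin c → S)))
instance : Module.Finite S (BlockModule M) :=
  inferInstanceAs (Module.Finite S ((Fin c → S) × (Fin c → S)))
instance : Module.Free S (BlockModule M) :=
  inferInstanceAs (Module.Free S ((Fin c → S) × (Fin c → S)))

theorem finrank_blockModule (M : Fin 4 → Matrix (Fin c) (Fin c) k) :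
    Module.finrank k (BlockModule M) = c + c := by
  change Module.finrank k ((Fin c → k) × (Fin c → k)) = c + c
  simp

/-- The action of a generator. -/
def blockEnd (j : Fin 4) : Module.End S (BlockModule M) :=
  LinearMap.inl S (Fin c → S) (Fin c → S) ∘ₗ (M j).mulVecLin ∘ₗ
    LinearMap.snd S (Fin c → S) (Fin c → S)

variable (k) in
/-- The action of the free algebra. -/
def blockHom : FreeAlgebra k (Fin 4) →ₐ[k] (Module.End S (BlockModule M))ᵐᵒᵖ :=
  FreeAlgebra.lift k fun j => op (blockEnd M j)

instance : Module (FreeAlgebra k (Fin 4))ᵐᵒᵖ (BlockModule M) :=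
  Module.compHom (R := Module.End S (BlockModule M)) _
    { toFun := fun b => (blockHom k M b.unop).unop
      map_one' := by rw [unop_one, map_one, unop_one]
      map_mul' := fun b b' => by rw [unop_mul, map_mul, unop_mul]
      map_zero' := by rw [MulOpposite.unop_zero, map_zero, MulOpposite.unop_zero]
      map_add' := fun b b' => by rw [MulOpposite.unop_add, map_add, MulOpposite.unop_add] }

theorem block_smul (b : (FreeAlgebra k (Fin 4))ᵐᵒᵖ) (l : BlockModule M) :
    b • l = (blockHom k M b.unop).unop l := rfl

theorem block_ι_smul (j : Fin 4) (l : BlockModule M) :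
    op (FreeAlgebra.ι k j) • l = blockEnd M j l := by
  rw [block_smul, unop_op, blockHom, FreeAlgebra.lift_ι_apply, unop_op]

instance : IsScalarTower k (FreeAlgebra k (Fin 4))ᵐᵒᵖ (BlockModule M) where
  smul_assoc r b l := by
    rw [block_smul, block_smul, MulOpposite.unop_smul, map_smul, MulOpposite.unop_smul]
    rfl

instance : SMulCommClass S (FreeAlgebra k (Fin 4))ᵐᵒᵖ (BlockModule M) where
  smul_comm s b l := by rw [block_smul, block_smul, map_smul]

variable {T : Type u} [CommRing T] [Algebra k T]

/-- The map of block modules given by a change of rings. -/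
def blockMap (x : S →ₐ[k] T) : BlockModule M →+ BlockModule fun j => (M j).map x where
  toFun l := ((fun i => x (l.1 i), fun i => x (l.2 i)) : (Fin c → T) × (Fin c → T))
  map_zero' := by
    change ((fun i => x 0, fun i => x 0) : (Fin c → T) × (Fin c → T)) = 0
    rw [map_zero]
    rfl
  map_add' l l' := by
    refine Prod.ext (funext fun i => map_add x _ _) (funext fun i => map_add x _ _)

theorem blockMap_smul (x : S →ₐ[k] T) (b : (FreeAlgebra k (Fin 4))ᵐᵒᵖ) (l : BlockModule M) :
    blockMap M x (b • l) = b • blockMap M x l := by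
  obtain ⟨b, rfl⟩ := op_surjective b
  induction b using FreeAlgebra.induction generalizing l with
  | grade0 r =>
    have h1 : op (algebraMap k (FreeAlgebra k (Fin 4)) r) =
      algebraMap k (FreeAlgebra k (Fin 4))ᵐᵒᵖ r := rfl
    rw [h1, algebraMap_smul, algebraMap_smul]
    exact Prod.ext (funext fun i => map_smul x r _) (funext fun i => map_smul x r _)
  | grade1 j =>
    rw [block_ι_smul, block_ι_smul]
    refine Prod.ext (funext fun i => ?_) (funext fun i => map_zero x)
    exact RingHom.map_mulVec x.toRingHom (M j) l.2 i
  | mul b b' h h' => rw [MulOpposite.op_mul, mul_smul, mul_smul, h', h]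
  | add b b' h h' => rw [MulOpposite.op_add, add_smul, add_smul, map_add, h, h']

theorem isFiber_block {A : Type u} [Ring A] [Algebra k A] (x : S →ₐ[k] k)
    (P : ChainComplex (ModuleCat.{u} (FreeAlgebra k (Fin 4) ⊗[k] Aᵐᵒᵖ)) ℤ) :
    IsFiber x.toRingHom (baseComplex S (BlockModule M) P)
      (tensorComplex (BlockModule fun j => (M j).map x) P) := by
  refine isFiber_baseComplex (x := x.toRingHom) (blockMap M x) ?_ (blockMap_smul M x) ?_ ?_ P
  · intro s l
    refine Prod.ext (funext fun i => ?_) (funext fun i => ?_)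
    · exact map_mul x s _
    · exact map_mul x s _
  · intro l
    refine ⟨((fun i => algebraMap k S (l.1 i), fun i => algebraMap k S (l.2 i)) :
      (Fin c → S) × (Fin c → S)), ?_⟩
    exact Prod.ext (funext fun i => x.commutes _) (funext fun i => x.commutes _)
  · intro l hl
    have h1 (i) : x (l.1 i) = 0 := congrFun (congrArg Prod.fst hl) i
    have h2 (i) : x (l.2 i) = 0 := congrFun (congrArg Prod.snd hl) i
    let e (i : Fin c) : BlockModule M := ((Pi.single i 1, 0) : (Fin c → S) × (Fin c → S))
    let e' (i : Fin c) : BlockModule M := ((0, Pi.single i 1) : (Fin c → S) × (Fin c → S))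
    have h3 : l = ∑ i, l.1 i • e i + ∑ i, l.2 i • e' i := by
      change l = ((∑ i, l.1 i • ((Pi.single i 1, 0) : (Fin c → S) × (Fin c → S)) +
        ∑ i, l.2 i • ((0, Pi.single i 1) : (Fin c → S) × (Fin c → S))) :
          (Fin c → S) × (Fin c → S))
      refine Prod.ext ?_ ?_
      · rw [Prod.fst_add, Prod.fst_sum, Prod.fst_sum]
        simp only [Prod.smul_mk, smul_zero, Finset.sum_const_zero, add_zero]
        exact (sum_smul_single _).symm
      · rw [Prod.snd_add, Prod.snd_sum, Prod.snd_sum]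
        simp only [Prod.smul_mk, smul_zero, Finset.sum_const_zero, zero_add]
        exact (sum_smul_single _).symm
    rw [h3]
    refine AddSubgroup.add_mem _ (AddSubgroup.sum_mem _ fun i _ => ?_)
      (AddSubgroup.sum_mem _ fun i _ => ?_)
    · exact AddSubgroup.subset_closure ⟨l.1 i, e i, h1 i, rfl⟩
    · exact AddSubgroup.subset_closure ⟨l.2 i, e' i, h2 i, rfl⟩

/-- The blocks `1`, a diagonal matrix, the all-one matrix, and `Z`. -/
def blockMat (t : Fin c → k) (Z : Matrix (Fin c) (Fin c) S) : Fin 4 → Matrix (Fin c) (Fin c) S :=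
  ![1, Matrix.diagonal fun i => algebraMap k S (t i), Matrix.of fun _ _ => 1, Z]

theorem blockMat_map (t : Fin c → k) (Z : Matrix (Fin c) (Fin c) S) (x : S →ₐ[k] T) :
    (fun j => (blockMat t Z j).map x) = blockMat t (Z.map x) := by
  funext j
  fin_cases j
  · exact Matrix.map_one x (map_zero x) (map_one x)
  · change (Matrix.diagonal _).map x = Matrix.diagonal _
    rw [Matrix.diagonal_map (map_zero x)]
    congr 1
    funext i
    exact x.commutes _
  · ext i j
    exact map_one x
  · rfl

open Matrix in
/-- The matrix `Z` is an invariant of the block module. -/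
theorem blockMat_injective {t : Fin c → k} (ht : Function.Injective t)
    {Z Z' : Matrix (Fin c) (Fin c) k}
    (g : BlockModule (blockMat t Z) ≃ₗ[(FreeAlgebra k (Fin 4))ᵐᵒᵖ] BlockModule (blockMat t Z')) :
    Z = Z' := by
  let V := (Fin c → k) × (Fin c → k)
  let G : V →+ V := g.toAddEquiv.toAddMonoidHom
  have hG (r : k) (v : V) : G (r • v) = r • G v := by
    let l : BlockModule (blockMat t Z) := v
    have h := g.map_smul (algebraMap k (FreeAlgebra k (Fin 4))ᵐᵒᵖ r) l
    rw [algebraMap_smul, algebraMap_smul] at h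
    exact h
  have hM (j : Fin 4) (v : V) : G (blockMat t Z j *ᵥ v.2, 0) = (blockMat t Z' j *ᵥ (G v).2, 0) := by
    let l : BlockModule (blockMat t Z) := v
    have h := g.map_smul (op (FreeAlgebra.ι k j)) l
    rw [block_ι_smul, block_ι_smul] at h
    exact h
  let α : (Fin c → k) →ₗ[k] (Fin c → k) :=
    { toFun := fun v => (G (0, v)).2
      map_add' := fun v w => by
        have h : ((0, v + w) : V) = (0, v) + (0, w) := by simp
        rw [h, map_add, Prod.snd_add]
      map_smul' := fun r v => by
        have h : ((0, r • v) : V) = r • (0, v) := by simp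
        rw [h, hG]
        rfl }
  -- Commuting with the identity block forces both diagonal blocks of `g` to be the same `α`.
  have hα (u : Fin c → k) : G (u, 0) = (α u, 0) := by
    have h := hM 0 (0, u)
    change G ((1 : Matrix (Fin c) (Fin c) k) *ᵥ u, 0) = ((1 : Matrix (Fin c) (Fin c) k) *ᵥ α u, 0) at h
    rwa [one_mulVec, one_mulVec] at h
  let a := LinearMap.toMatrix' α
  have ha (v) : a *ᵥ v = α v := LinearMap.toMatrix'_mulVec α v
  have hcomm (j : Fin 4) : a * blockMat t Z j = blockMat t Z' j * a := by
    refine Matrix.toLin'.injective (LinearMap.ext fun v => ?_)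
    rw [toLin'_apply, toLin'_apply, ← mulVec_mulVec, ← mulVec_mulVec, ha, ha]
    have h := hM j (0, v)
    rw [hα] at h
    exact congrArg Prod.fst h
  -- Commuting with a diagonal matrix with distinct entries makes `α` diagonal; commuting with the
  -- all-one matrix then makes it scalar, so it carries `Z` to `Z' = Z`.
  have hoff (i j : Fin c) (hij : i ≠ j) : a i j = 0 := by
    have h := congrFun (congrFun (hcomm 1) i) j
    change (a * diagonal fun i => t i) i j = ((diagonal fun i => t i) * a) i j at h
    rw [mul_diagonal, diagonal_mul] at h
    have h2 : a i j * (t j - t i) = 0 := by rw [mul_sub, h]; ring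
    exact (mul_eq_zero.1 h2).resolve_right fun h3 => hij (ht (sub_eq_zero.1 h3)).symm
  have hl (N : Matrix (Fin c) (Fin c) k) (i j) : (a * N) i j = a i i * N i j := by
    rw [mul_apply]
    exact Finset.sum_eq_single i (fun l _ h => by rw [hoff i l h.symm, zero_mul])
      fun h => (h (Finset.mem_univ i)).elim
  have hr (N : Matrix (Fin c) (Fin c) k) (i j) : (N * a) i j = N i j * a j j := by
    rw [mul_apply]
    exact Finset.sum_eq_single j (fun l _ h => by rw [hoff l j h, mul_zero])
      fun h => (h (Finset.mem_univ j)).elim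
  have hdiag (i j : Fin c) : a i i = a j j := by
    have h := congrFun (congrFun (hcomm 2) i) j
    rw [hl, hr] at h
    change a i i * 1 = 1 * a j j at h
    rwa [mul_one, one_mul] at h
  ext i j
  have h := congrFun (congrFun (hcomm 3) i) j
  rw [hl, hr, hdiag j i] at h
  change a i i * Z i j = Z' i j * a i i at h
  have h0 : a i i ≠ 0 := by
    intro h0
    have h1 : α (Pi.single i 1) = 0 := by
      rw [← ha]
      ext l
      rw [mulVec_single_one, col_apply]
      by_cases hli : l = i
      · rw [hli, h0]; rfl
      · rw [hoff l i hli]; rfl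
    have h2 : G (Pi.single i 1, 0) = G 0 := by
      rw [hα, h1, map_zero]
      rfl
    have h3 := congrArg Prod.fst (g.injective h2 : ((Pi.single i 1, 0) : V) = 0)
    exact one_ne_zero (α := k) ((Pi.single_eq_same (M := fun _ => k) i 1).symm.trans (congrFun h3 i))
  rw [mul_comm] at h
  exact mul_right_cancel₀ h0 h

end Block

end

section

/-! ### The number of parameters of derived wild algebras -/

section Complement

/-- A retract is a direct summand. -/
theorem exists_biprod_iso_of_retract {𝒞 : Type*} [Category 𝒞] [Preadditive 𝒞]
    [HasBinaryBiproducts 𝒞] [IsIdempotentComplete 𝒞] {X Y : 𝒞} (s : X ⟶ Y) (p : Y ⟶ X)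
    (h : s ≫ p = 𝟙 X) :
    ∃ (Z : 𝒞) (i : Z ⟶ Y) (q : Y ⟶ Z), i ≫ q = 𝟙 Z ∧ i ≫ p = 0 ∧ Nonempty (Z ⊞ X ≅ Y) := by
  have hsp : (𝟙 Y - p ≫ s) ≫ p = 0 := by
    rw [Preadditive.sub_comp, Category.id_comp, Category.assoc, h, Category.comp_id, sub_self]
  have hss : s ≫ (𝟙 Y - p ≫ s) = 0 := by
    rw [Preadditive.comp_sub, Category.comp_id, reassoc_of% h, sub_self]
  have he : (𝟙 Y - p ≫ s) ≫ (𝟙 Y - p ≫ s) = 𝟙 Y - p ≫ s := by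
    rw [Preadditive.comp_sub, Category.comp_id, reassoc_of% hsp, zero_comp, sub_zero]
  obtain ⟨Z, i, q, hiq, hqi⟩ := IsIdempotentComplete.idempotents_split Y _ he
  have h1 : i ≫ p = 0 := by
    rw [← Category.id_comp (i ≫ p), ← hiq, Category.assoc, reassoc_of% hqi, hsp, comp_zero]
  have h2 : s ≫ q = 0 := by
    rw [← Category.comp_id (s ≫ q), ← hiq, Category.assoc, reassoc_of% hqi, reassoc_of% hss,
      zero_comp]
  let β : BinaryBicone Z X :=
    { pt := Y
      fst := q
      snd := p
      inl := i
      inr := s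
      inl_fst := hiq
      inl_snd := h1
      inr_fst := h2
      inr_snd := h }
  have hβ : β.IsBilimit := isBinaryBilimitOfTotal β (by
    change q ≫ i + p ≫ s = 𝟙 Y
    rw [hqi, sub_add_cancel])
  exact ⟨Z, i, q, hiq, h1, ⟨(biprod.uniqueUpToIso _ _ hβ).symm⟩⟩

variable {k B A : Type u} [Field k] [Ring B] [Algebra k B] [Ring A] [Algebra k A]
  {P F : ChainComplex (ModuleCat.{u} (B ⊗[k] Aᵐᵒᵖ)) ℤ} {n : ℤ →₀ ℕ}

theorem nonempty_iso_tensorComplex_free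
    (hX : ∀ i, Nonempty (F.X i ≅ ModuleCat.of (B ⊗[k] Aᵐᵒᵖ) (Fin (n i) → B ⊗[k] Aᵐᵒᵖ)))
    (L : Type u) [AddCommGroup L] [Module k L] [Module Bᵐᵒᵖ L] [IsScalarTower k Bᵐᵒᵖ L]
    [Module.Finite k L] (i : ℤ) : Nonempty ((tensorComplex L F).X i ≅
      freeRank A (Module.finrank k L • n) i) := by
  obtain ⟨e⟩ := hX i
  obtain ⟨e'⟩ := tensorFunctor_free (k := k) (B := B) (A := A) (n i) L
  rw [freeRank, Finsupp.smul_apply, smul_eq_mul, mul_comm]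
  exact ⟨((tensorFunctor L).mapIso e).trans e'⟩

/-- The complement of a direct summand through which the differentials factor. -/
theorem exists_complement {s : P ⟶ F} {p : F ⟶ P} (hF : IsMinimalFamily k B A F)
    (hsp : s ≫ p = 𝟙 P)
    (hX : ∀ i, Nonempty (F.X i ≅ ModuleCat.of (B ⊗[k] Aᵐᵒᵖ) (Fin (n i) → B ⊗[k] Aᵐᵒᵖ)))
    (hd : ∀ i j, F.d i j = p.f i ≫ P.d i j ≫ s.f j)
    (L : Type u) [AddCommGroup L] [Module k L] [Module Bᵐᵒᵖ L] [IsScalarTower k Bᵐᵒᵖ L]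
    [Module.Finite k L] : ∃ T : ChainComplex (ModuleCat.{u} Aᵐᵒᵖ) ℤ,
      InClass (Module.finrank k L • n) T ∧ (∀ i j, T.d i j = 0) ∧
      Nonempty (T ⊞ tensorComplex L P ≅ tensorComplex L F) := by
  let Φ := (tensorFunctor (k := k) (B := B) (A := A) L).mapHomologicalComplex (.down ℤ)
  have : IsIdempotentComplete (ChainComplex (ModuleCat.{u} Aᵐᵒᵖ) ℤ) :=
    Idempotents.isIdempotentComplete_of_abelian _
  have h : Φ.map s ≫ Φ.map p = 𝟙 (Φ.obj P) := by rw [← Φ.map_comp, hsp, Φ.map_id]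
  obtain ⟨T, i, q, hiq, hip, e⟩ := exists_biprod_iso_of_retract (Φ.map s) (Φ.map p) h
  have hF' : InClass (Module.finrank k L • n) (tensorComplex L F) := by
    refine ⟨hF.isMinimal_tensorComplex L, fun j => ?_⟩
    obtain ⟨e⟩ := nonempty_iso_tensorComplex_free hX L j
    exact .of_equiv e.toLinearEquiv
  refine ⟨T, hF'.of_retract i q hiq, fun a b => ?_, e⟩
  have h1 : (Φ.obj F).d a b = (Φ.map p).f a ≫ (Φ.obj P).d a b ≫ (Φ.map s).f b := by
    change (tensorFunctor L).map (F.d a b) = (tensorFunctor L).map _ ≫ (tensorFunctor L).map _ ≫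
      (tensorFunctor L).map _
    rw [hd, Functor.map_comp, Functor.map_comp]
  have h2 : i.f a ≫ (Φ.map p).f a = 0 := by
    rw [← HomologicalComplex.comp_f, hip, HomologicalComplex.zero_f]
  have h3 : i.f b ≫ q.f b = 𝟙 _ := by
    rw [← HomologicalComplex.comp_f, hiq, HomologicalComplex.id_f]
  -- The differential of `F` factors through `p`, which is zero on the complement.
  rw [← Category.comp_id (T.d a b), ← h3, ← i.comm_assoc, h1, Category.assoc,
    reassoc_of% h2, zero_comp]

/-- Complements of the same vector rank with zero differentials can be cancelled. -/
theorem nonempty_iso_of_complement [Module.Finite k A] {b : ℤ →₀ ℕ} {r : VectorRank A}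
    {T T' X X' C C' : ChainComplex (ModuleCat.{u} Aᵐᵒᵖ) ℤ} (hT : InClass b T)
    (hd : ∀ i j, T.d i j = 0) (hd' : ∀ i j, T'.d i j = 0) (hr : HasVectorRank T r)
    (hr' : HasVectorRank T' r) (e : T ⊞ X ≅ C) (e' : T' ⊞ X' ≅ C') (f : C ≅ C') :
    Nonempty (X ≅ X') := by
  let g : T ≅ T' := HomologicalComplex.Hom.isoOfComponents
    (fun i => (hr i).some.trans (hr' i).some.symm) fun i j _ => by
      rw [hd, hd', comp_zero, zero_comp]
  exact hT.cancel k (e.trans (f.trans (e'.symm.trans (biprod.mapIso g.symm (Iso.refl X')))))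

end Complement

/-! ### Points and dimension of affine varieties. -/

section AffinePoints

variable {k S : Type u} [Field k] [CommRing S] [Algebra k S] [Algebra.FiniteType k S]
  [_root_.IsReduced S]

theorem mem_basicOpen_iff (y : (affineVariety k S).Point) (s : S) :
    affinePoint y s ≠ 0 ↔ (y.pt : PrimeSpectrum S) ∈ PrimeSpectrum.basicOpen s := by
  have h := y.eval_ne_zero_iff (U := ⊤) trivial (affineTop (k := k) s)
  refine Iff.trans h ?_
  exact (basicOpen_eq_of_affine (R := .of S) s) ▸ Iff.rfl

theorem pt_eq_of_affinePoint_eq {y y' : (affineVariety k S).Point}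
    (h : affinePoint y = affinePoint y') : y.pt = y'.pt := by
  refine PrimeSpectrum.ext (Ideal.ext fun s => not_iff_not.1 ?_)
  have h1 := mem_basicOpen_iff y s
  rw [h] at h1
  exact h1.symm.trans (mem_basicOpen_iff y' s)

/-- Finite sets of points have dimension at most `0`. -/
theorem dim_le_zero_of_finite (Y : Set (affineVariety k S).Point)
    (hY : (Variety.Point.pt '' Y : Set (affineVariety k S).X).Finite) : Variety.dim Y ≤ 0 := by
  let Z : Set (affineVariety k S).X := Variety.Point.pt '' Y
  have : Finite Z := hY
  have : T1Space Z := by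
    refine t1Space_iff_exists_open.2 ?_
    rintro ⟨_, y, hy, rfl⟩ ⟨_, y', hy', rfl⟩ hne
    obtain ⟨s, hs⟩ : ∃ s, affinePoint y s ≠ affinePoint y' s := by
      by_contra! hcon
      exact hne (Subtype.ext (pt_eq_of_affinePoint_eq (AlgHom.ext hcon)))
    -- Normalized to vanish at `y'`, a separating function gives an open set containing `y` but not
    -- `y'`. The finite set is then discrete.
    let f := s - algebraMap k S (affinePoint y' s)
    have hf (z : (affineVariety k S).Point) :
        affinePoint z f = affinePoint z s - affinePoint y' s := by
      rw [map_sub, AlgHom.commutes]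
      rfl
    refine ⟨Subtype.val ⁻¹' (PrimeSpectrum.basicOpen f : Set (PrimeSpectrum S)),
      (PrimeSpectrum.basicOpen f).2.preimage continuous_subtype_val, ?_, fun h => ?_⟩
    · refine (mem_basicOpen_iff y f).1 ?_
      rw [hf]
      exact sub_ne_zero.2 hs
    · refine (mem_basicOpen_iff y' f).2 h ?_
      rw [hf, sub_self]
  exact topologicalKrullDim_zero_of_discreteTopology Z

theorem natCast_le_dim_univ [IsAlgClosed k] {n : ℕ} (h : (n : WithBot ℕ∞) ≤ ringKrullDim S) :
    (n : WithBot ℕ∞) ≤ Variety.dim (Set.univ : Set (affineVariety k S).Point) := by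
  obtain ⟨q, rfl⟩ := Order.le_krullDim_iff.1 h
  have : IsAffine (affineVariety k S).X := inferInstanceAs (IsAffine (Spec (.of S)))
  exact le_dim_of_chain (isAffineOpen_top _) (affineTop (k := k) (S := S)).symm.toAlgHom
    (affineTop (k := k) (S := S)).symm.surjective 1 q
    (fun j h1 => (q j).2.ne_top ((Ideal.eq_top_iff_one _).2 h1)) _ fun _ _ _ _ _ _ => trivial

end AffinePoints

/-! ### Quadratic growth for derived wild algebras. -/

section Wild

variable {k A : Type u} [Field k] [Ring A] [Algebra k A]

/-- A family over an affine variety such that the points with isomorphic fibres form finite sets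
has at least as many parameters as the dimension of the variety. -/
theorem natCast_le_par [IsAlgClosed k] {S : Type u} [CommRing S] [Algebra k S]
    [Algebra.FiniteType k S] [_root_.IsReduced S] (P : VarietyFamily k A (affineVariety k S))
    (hP : ∀ x, (Variety.Point.pt '' P.isoLocus x : Set (affineVariety k S).X).Finite) {n : ℕ}
    (h : (n : WithBot ℕ∞) ≤ ringKrullDim S) : (n : WithBot ℕ∞) ≤ P.par := by
  -- Finite isomorphism loci have dimension at most `0`, so the stratum with `i = 0` is the whole
  -- variety.
  refine le_sSup ⟨0, ?_⟩
  have h1 : P.locus 0 = Set.univ :=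
    Set.eq_univ_of_forall fun x => (dim_le_zero_of_finite _ (hP x)).trans_eq Nat.cast_zero.symm
  rw [h1, Nat.cast_zero, add_zero]
  exact natCast_le_dim_univ h

/-- Derived wild algebras have families with quadratically growing numbers of parameters. -/
theorem DerivedWild.exists_le_par [IsAlgClosed k] [Module.Finite k A] (h : DerivedWild k A) :
    ∃ b : ℤ →₀ ℕ, ∀ c : ℕ, ((c ^ 2 : ℕ) : WithBot ℕ∞) ≤ par k A (c • b) := by
  obtain ⟨P, hP, hstrict⟩ := h (FreeAlgebra k (Fin 4))
  obtain ⟨n, F, s, p, hF, hsp, hX, hd⟩ := hP.exists_freeCover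
  -- The block modules have dimension `2 c`, so tensoring multiplies the ranks `n` of the terms of
  -- `F` by `2 c`.
  refine ⟨n + n, fun c => ?_⟩
  let S := MvPolynomial (Fin c × Fin c) k
  let Z : Matrix (Fin c) (Fin c) S := Matrix.of fun i j => MvPolynomial.X (i, j)
  let t : Fin c → k := fun i => Infinite.natEmbedding k i
  have ht : Function.Injective t := (Infinite.natEmbedding k).injective.comp Fin.val_injective
  let L (W : Matrix (Fin c) (Fin c) k) := BlockModule (blockMat t W)
  have hfin (W) : Module.Finite k (L W) :=
    inferInstanceAs (Module.Finite k ((Fin c → k) × (Fin c → k)))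
  have hQ := baseComplex_isMinimalFamily S (BlockModule (blockMat t Z)) hF
  let Fam := tildeFamily hQ
  have hfib (y : (affineVariety k S).Point) :
      Nonempty (Fam.fiber y ≅ tensorComplex (L (Z.map (affinePoint y))) F) := by
    have h1 := isFiber_block (A := A) (blockMat t Z) (affinePoint y) F
    rw [blockMat_map] at h1
    exact (isFiber_tildeFamily hQ y).unique h1
  have hrank (W) : Module.finrank k (L W) • n = c • (n + n) := by
    rw [finrank_blockModule, add_smul, smul_add]
  have hle : ((c ^ 2 : ℕ) : WithBot ℕ∞) ≤ Fam.par := by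
    refine natCast_le_par Fam (fun x => ?_) ?_
    · obtain ⟨R, hR, hR'⟩ := exists_finite_ranks (A := A) k (c • (n + n))
      -- The points with a given fibre are sorted by the vector rank of the complement. Within one
      -- rank, cancellation, strictness and the invariance of `Z` leave at most one point.
      let Y (r : VectorRank A) : Set (affineVariety k S).Point :=
        {y ∈ Fam.isoLocus x | ∃ T : ChainComplex (ModuleCat.{u} Aᵐᵒᵖ) ℤ, InClass (c • (n + n)) T ∧
          (∀ i j, T.d i j = 0) ∧ HasVectorRank T r ∧
          Nonempty (T ⊞ tensorComplex (L (Z.map (affinePoint y))) P ≅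
            tensorComplex (L (Z.map (affinePoint y))) F)}
      refine (hR.biUnion (t := fun r => Variety.Point.pt '' Y r) fun r _ =>
        Set.Subsingleton.finite ?_).subset ?_
      · rintro _ ⟨y, ⟨⟨f⟩, T, hT, hTd, hTr, ⟨e⟩⟩, rfl⟩ _ ⟨y', ⟨⟨f'⟩, T', -, hTd', hTr', ⟨e'⟩⟩, rfl⟩
        obtain ⟨g⟩ := hfib y
        obtain ⟨g'⟩ := hfib y'
        obtain ⟨φ⟩ := (hstrict.iso_iff _ _).1 (nonempty_iso_of_complement (k := k) hT hTd hTd'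
          hTr hTr' e e' (g.symm.trans (f.trans (f'.symm.trans g'))))
        have h2 := blockMat_injective ht φ
        refine pt_eq_of_affinePoint_eq (MvPolynomial.algHom_ext fun ij => ?_)
        exact congrFun (congrFun h2 ij.1) ij.2
      · rintro _ ⟨y, hy, rfl⟩
        obtain ⟨T, hT, hTd, e⟩ := exists_complement hF hsp hX hd (L (Z.map (affinePoint y)))
        rw [hrank] at hT
        obtain ⟨r, hr, hTr⟩ := hR' T hT
        exact Set.mem_biUnion hr ⟨y, ⟨hy, T, hT, hTd, hTr, e⟩, rfl⟩
    · rw [MvPolynomial.ringKrullDim_of_isNoetherianRing, ringKrullDim_eq_zero_of_field, zero_add,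
        Nat.card_prod, Nat.card_fin, sq]
  refine hle.trans (le_sSup ⟨_, Fam, fun y i => ?_, rfl⟩)
  obtain ⟨e⟩ := hfib y
  obtain ⟨e'⟩ := nonempty_iso_tensorComplex_free hX (L (Z.map (affinePoint y))) i
  rw [hrank] at e'
  exact ⟨((HomologicalComplex.eval _ _ i).mapIso e).trans e'⟩

end Wild

end

end DerivedParam

end

theorem proposition4p2 (k A : Type u) [Field k] [IsAlgClosed k] [Ring A] [Algebra k A]
    [Module.Finite k A] :
    (DerivedParam.DerivedTame k A → ∀ b : ℤ →₀ ℕ,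
      DerivedParam.par k A b ≤ (((b.sum fun _ n => n) * Module.finrank k A : ℕ) : WithBot ℕ∞)) ∧
    (DerivedParam.DerivedWild k A → ∃ b : ℤ →₀ ℕ, ∀ c : ℕ,
      ((c ^ 2 : ℕ) : WithBot ℕ∞) ≤ DerivedParam.par k A (c • b)) ∧
    ¬ (DerivedParam.DerivedTame k A ∧ DerivedParam.DerivedWild k A) := by
  refine ⟨fun h b => h.par_le b, fun h => h.exists_le_par, fun ⟨ht, hw⟩ => ?_⟩
  obtain ⟨b, hb⟩ := hw.exists_le_par
  set N := (b.sum fun _ n => n) * Module.finrank k A with hN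
  -- At `c = N + 1` the two bounds would give `(N + 1)² ≤ (N + 1) N`.
  have h1 := (hb (N + 1)).trans (ht.par_le ((N + 1) • b))
  have h2 : (((N + 1) • b).sum fun _ n => n) = (N + 1) * b.sum fun _ n => n := by
    rw [Finsupp.sum_smul_index (fun _ => rfl), Finsupp.mul_sum]
  rw [h2, mul_assoc, ← hN] at h1
  have h3 : (N + 1) ^ 2 ≤ (N + 1) * N := by exact_mod_cast h1
  nlinarith
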